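/- Let $\mathbb I$ be a finite set (totally ordered, for bookkeeping only), let $\varepsilon>0$, $\beta>0$, $\mu\in\mathbb R$, and write $(u,v)=\varepsilon\sum_{x\in\mathbb I}u_xv_x$. Let $\mathcal F=\bigwedge\mathbb C^{\mathbb I}$ be the antisymmetric Fock space, $a^+_x$ and $a^-_x=(a^+_x)^*$ the fermionic creation and annihilation operators, normalised so that $\{a^+_x,a^-_y\}=\varepsilon^{-1}\delta_{xy}$, and $\mathcal N_{\rm p}=(a^+,a^-)$ the particle number operator. Let $\mathcal E$ be a hermitian $\mathbb I\times\mathbb I$ matrix, let $H_0$ be the operator on $\mathcal F$ with $H_0-\mu \mathcal N_{\rm p}=(a^+,\mathcal E a^-)$, let $V$ be any linear map $\mathcal F\to\mathcal F$ that is even (commutes with the fermion parity $(-1)^{\mathcal N_{\rm p}}$), and let $H=H_0+V$. Let $c^-_x,c^+_x$ ($x\in\mathbb I$) be Grassmann generators that anticommute with each other and with all $a^\pm_y$, and put $$Z(c^-,c^+)=\mathrm{Tr}_{\mathcal F}\left[e^{-\beta(H-\mu \mathcal N_{\rm p})}\,e^{(c^+,a^+)}\,e^{(c^-,a^-)}\right].$$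 Let $f_\beta(\mathcal E)=(1+e^{\beta\mathcal E})^{-1}$ and, for $\tau,\tau'\in\mathbb R$, $$\mathcal C_{\tau,\tau'}=\begin{cases}-f_\beta(-\mathcal E)\,e^{-(\tau-\tau')\mathcal E},&\tau>\tau',\\ f_\beta(\mathcal E)\,e^{-(\tau-\tau')\mathcal E},&\tau\le\tau'.\end{cases}$$ For $N\ge1$ and $m\in\{1,\dots,N\}$ let $\tau_m=m\beta/N$, and let $R^{(N)}$ be the matrix on $\mathbb C^N\otimes\mathbb C^{\mathbb I}$ with blocks $R^{(N)}_{m,n}=\mathcal C_{\tau_m,\tau_n}$. For an invertible matrix $C$ on $\mathbb C^N\otimes\mathbb C^{\mathbb I}$ let $d\mu_C(\bar\psi,\psi)$ be the normalised Grassmann Gaussian integral in the variables $(\bar\psi_{k,x},\psi_{k,x})_{1\le k\le N,\,x\in\mathbb I}$ with density proportional to $\exp\left(\varepsilon\sum_{k,x}\bar\psi_{k,x}(C^{-1}\psi)_{k,x}\right)$, and let $(\mu_C*F)(\bar\phi,\phi)=\int d\mu_C(\bar\psi,\psi)\,F(\bar\psi+\bar\phi,\psi+\phi)$. Then $V$ has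 a unique normal ordered form $\mathcal N(V)(a^+,a^-)$ (a linear combination of the products $\prod_{x\in J}a^+_x\prod_{y\in L}a^-_y$, $J,L\subseteq\mathbb I$, with increasing order in each product), and with $$\mathcal V=\frac{\beta}{N}\sum_{k=1}^N\mathcal N(V)(\bar\psi_k,\psi_k),\qquad \bar\eta^{(N)}_k=\mathcal C_{\beta,\tau_k}^{\rm T}c^-,\qquad \eta^{(N)}_k=\mathcal C_{\tau_k,\tau_1}c^+,$$ the limit on the right hand side of $$Z(c^-,c^+)=Z_0\;e^{(c^-,f_\beta(\mathcal E)c^+)}\;\lim_{N\to\infty}\left(\mu_{R^{(N)}}*e^{-\mathcal V}\right)(\bar\eta^{(N)},\eta^{(N)})$$ exists (in the finite dimensional Grassmann algebra generated by the $c^\pm_x$) and the identity holds, where $Z_0=\det(1+e^{-\beta\mathcal E})=\mathrm{Tr}_{\mathcal F}\,e^{-\beta(H_0-\mu \mathcal N_{\rm p})}$. -/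

import Mathlib

open Filter Topology
open scoped TensorProduct

namespace FermionFI

noncomputable section

/-! ### Grassmann algebras -/

/-- The complex Grassmann algebra with one generator for every element of `S`. -/
abbrev Gr (S : Type*) : Type _ := ExteriorAlgebra ℂ (S → ℂ)

/-- The generator of the Grassmann algebra with label `s`. -/
def gen {S : Type*} [DecidableEq S] (s : S) : Gr S :=
  ExteriorAlgebra.ι ℂ (Pi.single s 1)

/-- The substitution homomorphism that replaces the generator `s` by the linear combination
`∑ t, M s t • gen t` of generators. -/
def subst {S T : Type*} [Fintype S] (M : S → T → ℂ) : Gr S →ₐ[ℂ] Gr T :=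
  ExteriorAlgebra.map (Fintype.linearCombination ℂ M)

/-- The (left) Grassmann derivative with respect to the generator `s`. -/
def grDeriv {S : Type*} (s : S) : Module.End ℂ (Gr S) :=
  CliffordAlgebra.contractLeft (LinearMap.proj s)

/-- The exponential of a nilpotent element (a finite sum). -/
def nilExp {A : Type*} [Ring A] [Algebra ℂ A] (a : A) : A :=
  ∑ n ∈ Finset.range (nilpotencyClass a), ((n.factorial : ℂ)⁻¹) • a ^ n

/-- The exponential in a Grassmann algebra: the scalar part of an element is exponentiated in `ℂ`,
the remainder is nilpotent. -/
def grExp {S : Type*} (a : Gr S) : Gr S :=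
  Complex.exp (ExteriorAlgebra.algebraMapInv a) •
    nilExp (a - algebraMap ℂ (Gr S) (ExteriorAlgebra.algebraMapInv a))

/-- The bilinear pairing `(u, v) = ε ∑ x, u x * v x`. -/
def pairing {X A : Type*} [Fintype X] [Ring A] [Algebra ℂ A] (ε : ℝ) (u v : X → A) : A :=
  (ε : ℂ) • ∑ x, u x * v x

/-- A complex matrix applied to a vector with entries in a complex algebra. -/
def matApply {X A : Type*} [Fintype X] [Ring A] [Algebra ℂ A] (M : Matrix X X ℂ) (v : X → A) :
    X → A :=
  fun x => ∑ y, M x y • v y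

/-- The ordered product of the `A x` over `x ∈ J`, in increasing order of `x`. -/
def orderedProd {I A : Type*} [LinearOrder I] [Ring A] (a : I → A) (J : Finset I) : A :=
  ((J.sort (· ≤ ·)).map a).prod

/-- The normal ordered polynomial with coefficients `v`, evaluated at the families `a`, `b`: all
factors `a` are to the left of all factors `b`. -/
def normalPoly {I A : Type*} [LinearOrder I] [Fintype I] [Ring A] [Algebra ℂ A]
    (v : Finset I → Finset I → ℂ) (a b : I → A) : A :=
  ∑ J : Finset I, ∑ L : Finset I, v J L • (orderedProd a J * orderedProd b L)

/-! ### Grassmann Gaussian integration -/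

/-- The Berezin integral `∫ ∏ᵢ dψ̄ᵢ dψᵢ` over the variables `ψ̄ᵢ` (label `inl (inl i)`) and `ψᵢ`
(label `inl (inr i)`); the remaining generators, labelled by `T`, are parameters. The factors of the
product commute with each other, so their order does not matter. -/
def berezin {K T : Type*} [Fintype K] [Fintype T] [DecidableEq T] :
    Gr ((K ⊕ K) ⊕ T) →ₗ[ℂ] Gr T :=
  (subst (Sum.elim (fun _ : K ⊕ K => (0 : T → ℂ)) (fun t => Pi.single t 1))).toLinearMap ∘ₗ
    ((Finset.univ : Finset K).toList.map fun i =>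
      grDeriv (Sum.inl (Sum.inl i) : (K ⊕ K) ⊕ T) * grDeriv (Sum.inl (Sum.inr i))).prod

/-- The Gaussian weight `exp (ψ̄, C⁻¹ ψ)`. -/
def gaussWeight {K T : Type*} [Fintype K] [DecidableEq K] [DecidableEq T]
    (ε : ℝ) (C : Matrix K K ℂ) : Gr ((K ⊕ K) ⊕ T) :=
  grExp (pairing ε (fun i => gen (Sum.inl (Sum.inl i)))
    (matApply C⁻¹ (fun i => gen (Sum.inl (Sum.inr i)))))

/-- The normalised Gaussian integral `∫ dμ_C(ψ̄, ψ) F(ψ̄, ψ)`, where `dμ_C` is proportional to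
`D(ψ̄, ψ) exp (ψ̄, C⁻¹ ψ)` and has total mass one (`C` is an invertible matrix). -/
def gaussInt {K T : Type*} [Fintype K] [DecidableEq K] [Fintype T] [DecidableEq T]
    (ε : ℝ) (C : Matrix K K ℂ) (F : Gr ((K ⊕ K) ⊕ T)) : Gr T :=
  (ExteriorAlgebra.algebraMapInv (berezin (gaussWeight (T := T) ε C)))⁻¹ •
    berezin (gaussWeight ε C * F)

/-- The Gaussian convolution
`(μ_C * F)(φ̄, φ) = ∫ dμ_C(ψ̄, ψ) F(ψ̄ + φ̄, ψ + φ)`. -/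
def gaussConv {K : Type*} [Fintype K] [DecidableEq K]
    (ε : ℝ) (C : Matrix K K ℂ) (F : Gr (K ⊕ K)) : Gr (K ⊕ K) :=
  gaussInt ε C
    (subst (fun s : K ⊕ K =>
      (Pi.single (Sum.inl s) 1 + Pi.single (Sum.inr s) 1 : (K ⊕ K) ⊕ (K ⊕ K) → ℂ)) F)

/-! ### Fock space -/

/-- The linear operators on the antisymmetric Fock space `⋀ ℂ^I`. They are represented by their
matrices with respect to the orthonormal occupation number basis
`e_J = e_{x₁} ∧ ⋯ ∧ e_{xₘ}`, where `J = {x₁ < ⋯ < xₘ}` runs over the subsets of `I`. -/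
abbrev Op (I : Type*) : Type _ := Matrix (Finset I) (Finset I) ℂ

section Fock

variable {I : Type*} [LinearOrder I] [Fintype I]

/-- The creation operators `a⁺_x`: up to normalisation, the exterior multiplication by `e_x`,
`e_J ↦ e_x ∧ e_J`, which is zero for `x ∈ J` and `± e_{J ∪ {x}}` for `x ∉ J`, the sign being
determined by the number of elements of `J` below `x`.
The normalisation is `{a⁺_x, a⁻_y} = ε⁻¹ δ_{xy}`. -/
def aPlus (ε : ℝ) (x : I) : Op I :=
  ((Real.sqrt ε : ℂ)⁻¹) • Matrix.of fun L J =>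
    if x ∉ J ∧ L = insert x J then (-1 : ℂ) ^ (J.filter (· < x)).card else 0

/-- The annihilation operators `a⁻_x`, the adjoints of the creation operators. -/
def aMinus (ε : ℝ) (x : I) : Op I := (aPlus ε x).conjTranspose

/-- The quadratic operator `(a⁺, E a⁻)`. -/
def quadOp (ε : ℝ) (E : Matrix I I ℂ) : Op I :=
  pairing ε (aPlus ε) (matApply E (aMinus ε))

/-- The particle number operator `(a⁺, a⁻)`. -/
def numOp (ε : ℝ) : Op I :=
  pairing ε (aPlus (I := I) ε) (aMinus ε)

/-! ### Even and odd operators -/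

/-- The fermion parity operator `(-1)^N`. -/
def parity (I : Type*) [LinearOrder I] [Fintype I] : Op I :=
  Matrix.diagonal fun J => (-1 : ℂ) ^ J.card

theorem parity_mul_self : parity I * parity I = 1 := by
  rw [parity, Matrix.diagonal_mul_diagonal, ← Matrix.diagonal_one]
  congr 1
  ext J
  rw [← mul_pow]
  simp

/-- The operators that are even (`i = 0`, commuting with the fermion parity) or odd (`i = 1`,
anticommuting with it). -/
def opGrade (I : Type*) [LinearOrder I] [Fintype I] (i : ZMod 2) : Submodule ℂ (Op I) where
  carrier := {A | parity I * A = (if i = 0 then (1 : ℂ) else -1) • (A * parity I)}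
  add_mem' {A B} hA hB := by
    simp only [Set.mem_ofPred_eq] at *
    rw [mul_add, hA, hB, add_mul, smul_add]
  zero_mem' := by simp
  smul_mem' c A hA := by
    simp only [Set.mem_ofPred_eq] at *
    rw [mul_smul_comm, hA, smul_mul_assoc, smul_comm]

theorem mem_opGrade {i : ZMod 2} {A : Op I} :
    A ∈ opGrade I i ↔ parity I * A = (if i = 0 then (1 : ℂ) else -1) • (A * parity I) :=
  Iff.rfl

theorem mem_opGrade_zero {A : Op I} :
    A ∈ opGrade I 0 ↔ parity I * A = A * parity I := by
  rw [mem_opGrade, if_pos rfl, one_smul]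

theorem mem_opGrade_one {A : Op I} :
    A ∈ opGrade I 1 ↔ parity I * A = -(A * parity I) := by
  rw [mem_opGrade, if_neg one_ne_zero, neg_one_smul ℂ]

instance opGrade_gradedMonoid : SetLike.GradedMonoid (opGrade I) where
  one_mem := by simp [mem_opGrade]
  mul_mem := by
    intro i j A B hA hB
    rw [mem_opGrade] at *
    rw [← mul_assoc, hA, smul_mul_assoc, mul_assoc, hB, mul_smul_comm, smul_smul, mul_assoc]
    congr 1
    revert i j
    have key : ∀ i j : ZMod 2, (if i = 0 then (1 : ℂ) else -1) * (if j = 0 then (1 : ℂ) else -1) =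
        if i + j = 0 then (1 : ℂ) else -1 := by
      intro i j
      have hi : i = 0 ∨ i = 1 := by revert i; decide
      have hj : j = 0 ∨ j = 1 := by revert j; decide
      have h2 : (1 : ZMod 2) + 1 = 0 := by decide
      rcases hi with rfl | rfl <;> rcases hj with rfl | rfl <;> simp [h2]
    intro i j _ _
    exact key i j

/-- The even part of an operator. -/
def evenPart : Op I →ₗ[ℂ] opGrade I 0 :=
  LinearMap.codRestrict (opGrade I 0)
    ((2⁻¹ : ℂ) • (LinearMap.id + LinearMap.mulLeft ℂ (parity I) ∘ₗ LinearMap.mulRight ℂ (parity I)))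
    (fun A => by
      have h := parity_mul_self (I := I)
      have h2 : parity I * (parity I * (A * parity I)) = A * parity I := by
        rw [← mul_assoc, h, one_mul]
      have h3 : parity I * (A * parity I) * parity I = parity I * A := by
        rw [mul_assoc, mul_assoc, h, mul_one]
      rw [mem_opGrade_zero]
      simp only [LinearMap.smul_apply, LinearMap.add_apply, LinearMap.id_apply,
        LinearMap.comp_apply, LinearMap.mulLeft_apply, LinearMap.mulRight_apply,
        mul_smul_comm, smul_mul_assoc, mul_add, add_mul, h2, h3]
      rw [add_comm])

/-- The odd part of an operator. -/
def oddPart : Op I →ₗ[ℂ] opGrade I 1 :=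
  LinearMap.codRestrict (opGrade I 1)
    ((2⁻¹ : ℂ) • (LinearMap.id - LinearMap.mulLeft ℂ (parity I) ∘ₗ LinearMap.mulRight ℂ (parity I)))
    (fun A => by
      have h := parity_mul_self (I := I)
      have h2 : parity I * (parity I * (A * parity I)) = A * parity I := by
        rw [← mul_assoc, h, one_mul]
      have h3 : parity I * (A * parity I) * parity I = parity I * A := by
        rw [mul_assoc, mul_assoc, h, mul_one]
      rw [mem_opGrade_one]
      simp only [LinearMap.smul_apply, LinearMap.sub_apply, LinearMap.id_apply,
        LinearMap.comp_apply, LinearMap.mulLeft_apply, LinearMap.mulRight_apply,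
        mul_smul_comm, smul_mul_assoc, mul_sub, sub_mul, h2, h3]
      rw [← smul_neg, neg_sub])

theorem evenPart_coe (A : Op I) :
    (evenPart A : Op I) = (2⁻¹ : ℂ) • (A + parity I * (A * parity I)) := rfl

theorem oddPart_coe (A : Op I) :
    (oddPart A : Op I) = (2⁻¹ : ℂ) • (A - parity I * (A * parity I)) := rfl

instance opGrade_gradedAlgebra : GradedAlgebra (opGrade I) where
  decompose' A := DirectSum.of (fun i => opGrade I i) 0 (evenPart A) +
    DirectSum.of (fun i => opGrade I i) 1 (oddPart A)
  left_inv A := by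
    rw [map_add, DirectSum.coeAddMonoidHom_of, DirectSum.coeAddMonoidHom_of, evenPart_coe,
      oddPart_coe, ← smul_add, add_add_sub_cancel, ← two_smul ℂ A, smul_smul]
    norm_num
  right_inv x := by
    have h := parity_mul_self (I := I)
    induction x using DirectSum.induction_on with
    | zero => simp
    | add x y hx hy =>
      conv_rhs => rw [← hx, ← hy]
      simp only [map_add]
      abel
    | of i A =>
      simp only [DirectSum.coeAddMonoidHom_of]
      have hi : i = 0 ∨ i = 1 := by
        clear A
        revert i
        decide
      rcases hi with rfl | rfl
      · have hA := mem_opGrade_zero.1 A.2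
        have e : parity I * ((A : Op I) * parity I) = A := by
          rw [← mul_assoc, hA, mul_assoc, h, mul_one]
        have h0 : evenPart (A : Op I) = A := by
          ext1
          rw [evenPart_coe, e, ← two_smul ℂ, smul_smul]
          norm_num
        have h1 : oddPart (A : Op I) = 0 := by
          ext1
          rw [oddPart_coe, e, sub_self, smul_zero]
          rfl
        rw [h0, h1, map_zero, add_zero]
      · have hA := mem_opGrade_one.1 A.2
        have e : parity I * ((A : Op I) * parity I) = -A := by
          rw [← mul_assoc, hA]
          refine (neg_mul _ _).trans ?_
          rw [mul_assoc, h, mul_one]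
        have h0 : oddPart (A : Op I) = A := by
          ext1
          rw [oddPart_coe, e, sub_neg_eq_add, ← two_smul ℂ, smul_smul]
          norm_num
        have h1 : evenPart (A : Op I) = 0 := by
          ext1
          rw [evenPart_coe, e, add_neg_cancel, smul_zero]
          rfl
        rw [h0, h1, map_zero, zero_add]

end Fock

/-! ### The generating function -/

section Generating

variable {I : Type*} [LinearOrder I] [Fintype I]

/-- Operators on Fock space with coefficients in the Grassmann algebra of the sources: the graded
tensor product, in which the sources anticommute with the odd operators. The sources `c⁻_x` and
`c⁺_x` have the labels `inl x` and `inr x`. -/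
abbrev SourceOp (I : Type*) [LinearOrder I] [Fintype I] : Type _ :=
  (CliffordAlgebra.evenOdd (0 : QuadraticForm ℂ (I ⊕ I → ℂ))) ᵍ⊗[ℂ] (opGrade I)

/-- A source as an operator with Grassmann coefficients. -/
def srcOp (c : Gr (I ⊕ I)) : SourceOp I :=
  GradedTensorProduct.tmul ℂ c (1 : Op I)

/-- An operator on Fock space as an operator with Grassmann coefficients. -/
def liftOp (A : Op I) : SourceOp I :=
  GradedTensorProduct.tmul ℂ (1 : Gr (I ⊕ I)) A

/-- The trace over Fock space, with values in the Grassmann algebra of the sources: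
it maps `c A` to `Tr (A) c`. -/
def srcTrace (X : SourceOp I) : Gr (I ⊕ I) :=
  TensorProduct.rid ℂ (Gr (I ⊕ I))
    (LinearMap.lTensor (Gr (I ⊕ I)) (Matrix.traceLinearMap (Finset I) ℂ ℂ)
      ((GradedTensorProduct.of ℂ (CliffordAlgebra.evenOdd (0 : QuadraticForm ℂ (I ⊕ I → ℂ)))
        (opGrade I)).symm X))

/-- The source `c⁻_x`. -/
def cMinus (x : I) : Gr (I ⊕ I) := gen (Sum.inl x)

/-- The source `c⁺_x`. -/
def cPlus (x : I) : Gr (I ⊕ I) := gen (Sum.inr x)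

/-- The generating function `Z(c⁻, c⁺) = Tr [exp (-β K) exp (c⁺, a⁺) exp (c⁻, a⁻)]`, where `K`
stands for `H - μ N`. -/
def genFun (ε β : ℝ) (K : Op I) : Gr (I ⊕ I) :=
  srcTrace (liftOp (NormedSpace.exp (-(β : ℂ) • K)) *
    nilExp (pairing ε (fun x => srcOp (cPlus x)) (fun x => liftOp (aPlus ε x))) *
    nilExp (pairing ε (fun x => srcOp (cMinus x)) (fun x => liftOp (aMinus ε x))))

/-! ### The time-discretised Grassmann integral -/

/-- The Fermi function `f_β(E) = (1 + exp (β E))⁻¹` of a matrix. -/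
def fermi (β : ℝ) (E : Matrix I I ℂ) : Matrix I I ℂ :=
  (1 + NormedSpace.exp ((β : ℂ) • E))⁻¹

/-- The time-ordered two-point function
`C(τ, E) = - 1_{τ > 0} f_β(-E) exp (-τ E) + 1_{τ ≤ 0} f_β(E) exp (-τ E)`. -/
def twoPoint (β : ℝ) (E : Matrix I I ℂ) (τ : ℝ) : Matrix I I ℂ :=
  if 0 < τ then -(fermi β (-E) * NormedSpace.exp (-(τ : ℂ) • E))
  else fermi β E * NormedSpace.exp (-(τ : ℂ) • E)

/-- The discrete time `τ_m = m β / N`; the index `m ∈ {1, …, N}` is represented by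
`m - 1 ∈ Fin N`. -/
def time (β : ℝ) (N : ℕ) (k : Fin N) : ℝ := ((k : ℝ) + 1) * (β / N)

/-- The covariance `R^{(N)}_{m,n} = C(τ_m - τ_n, E)`, a matrix on `ℂ^N ⊗ ℂ^I`. -/
def covR (β : ℝ) (E : Matrix I I ℂ) (N : ℕ) : Matrix (Fin N × I) (Fin N × I) ℂ :=
  fun p q => twoPoint β E (time β N p.1 - time β N q.1) p.2 q.2

/-- `𝒱 = (β / N) ∑ k, v (ψ̄_k, ψ_k)`, for the normal ordered polynomial with coefficients `v`. The
generators `ψ̄_{k,x}` and `ψ_{k,x}` have the labels `inl (k, x)` and `inr (k, x)`. -/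
def interaction (β : ℝ) (v : Finset I → Finset I → ℂ) (N : ℕ) :
    Gr ((Fin N × I) ⊕ (Fin N × I)) :=
  ((β / N : ℝ) : ℂ) • ∑ k : Fin N,
    normalPoly v (fun x => gen (Sum.inl (k, x))) (fun x => gen (Sum.inr (k, x)))

/-- `η̄_k = C(β - τ_k, E)ᵀ c⁻`, as a linear combination of the generators of the source algebra. -/
def etaBar (β : ℝ) (E : Matrix I I ℂ) (N : ℕ) (p : Fin N × I) : I ⊕ I → ℂ :=
  Sum.elim (fun y => (twoPoint β E (β - time β N p.1)).transpose p.2 y) (fun _ => 0)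

/-- `η_k = C(τ_k - τ_1, E) c⁺`, as a linear combination of the generators of the source algebra. -/
def eta (β : ℝ) (E : Matrix I I ℂ) (N : ℕ) (p : Fin N × I) : I ⊕ I → ℂ :=
  Sum.elim (fun _ => 0) (fun y => twoPoint β E (time β N p.1 - β / N) p.2 y)

/-- `(μ_{R^{(N)}} * exp (-𝒱)) (η̄^{(N)}, η^{(N)})`. -/
def discreteIntegral (ε β : ℝ) (E : Matrix I I ℂ) (v : Finset I → Finset I → ℂ) (N : ℕ) :
    Gr (I ⊕ I) :=
  subst (Sum.elim (etaBar β E N) (eta β E N))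
    (gaussConv ε (covR β E N) (grExp (-interaction β v N)))

end Generating

end

end FermionFI

open FermionFI

/-!
Both sides of the identity are thermal traces of the same time-ordered product, written in two ways.

The Gaussian convolution is determined by an integration by parts recursion (`gaussEval_gen_mul`): a
leading Grassmann variable is replaced by its shift, or contracted with one of the other variables by
means of the covariance. The trace of `exp (-β (a⁺, E a⁻))` times a time-ordered word in the operators
`a^±(τ_k)`, shifted by sources, obeys the same recursion (`srcTrace_contract`), because moving an odd
operator around the trace costs a sign and a conjugation with the Boltzmann operator; the resulting
anticommutators are the entries of `covR` (`exists_thermal_split`). This is the Wick theorem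
(`srcTrace_timeOrdered_word`), valid for every choice of the shifts. The Boltzmann factor of the
interaction is a product over the time slices of one normal ordered polynomial (`exists_sliceCoeff`),
hence `μ_R * exp (-𝒱)` is, up to the factor `Z₀`, the trace of a product of operators, one for each
time slice (`srcTrace_prod_wordPoly`).

The particular shifts `η̄`, `η` make the sources disappear from the inner slices by conjugation with a
single operator `shiftOp`, the product of `exp (-(f(E)ᵀ c⁻, a⁻))` and a similar exponential in `c⁺`
and `a⁺`. Only the first and the last slice are exceptional, since the two-point function jumps
there, and each of them tends to `1`. The inner slices telescope to a power of the transfer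
operator, which is `1 - (β / N) (V + (a⁺, E a⁻)) + o(1 / N)`, so that its power converges to
`exp (-β (V + (a⁺, E a⁻)))` (`tendsto_pow_exp`, `tendsto_prod_sliceOp`). In the trace of the limit, the
exponentials of the source terms are moved around the trace and combined; `f(E) + f(-E) = 1` turns
them into `exp (c⁺, a⁺) exp (c⁻, a⁻)`, and the Weyl relation produces the Gaussian factor
(`srcTrace_limit`).

All of this takes place in finite dimensional algebras. The topology of the algebra of operators with
Grassmann coefficients is its module topology, for which every linear functional is continuous.
-/

namespace FermionFI

set_option linter.unusedSectionVars false

/-! ### Canonical anticommutation relations on Fock space -/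

section CAR

variable {I : Type*} [LinearOrder I] [Fintype I]

/-- The Jordan-Wigner sign of `e_x ∧ e_J`. -/
noncomputable def wedgeSign (x : I) (J : Finset I) : ℂ := (-1) ^ (J.filter (· < x)).card

/-- Exterior multiplication by `e_x`, without the normalisation of `aPlus`. -/
noncomputable def wedge (x : I) : Op I :=
  Matrix.of fun L J => if x ∉ J ∧ L = insert x J then wedgeSign x J else 0

theorem aPlus_eq (ε : ℝ) (x : I) : aPlus ε x = ((Real.sqrt ε : ℂ)⁻¹) • wedge x := rfl

theorem aMinus_eq (ε : ℝ) (x : I) :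
    aMinus ε x = ((Real.sqrt ε : ℂ)⁻¹) • (wedge x).conjTranspose := by
  rw [aMinus, aPlus_eq, Matrix.conjTranspose_smul]
  congr 1
  simp

theorem wedgeSign_mul_self (x : I) (J : Finset I) : wedgeSign x J * wedgeSign x J = 1 := by
  rw [wedgeSign, ← mul_pow]
  simp

theorem wedgeSign_ne_zero (x : I) (J : Finset I) : wedgeSign x J ≠ 0 := by
  simp [wedgeSign]

theorem star_wedgeSign (x : I) (J : Finset I) : star (wedgeSign x J) = wedgeSign x J := by
  simp [wedgeSign]

theorem wedgeSign_insert (x y : I) (J : Finset I) (hy : y ∉ J) :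
    wedgeSign x (insert y J) = (if y < x then -1 else 1) * wedgeSign x J := by
  unfold wedgeSign
  rw [Finset.filter_insert]
  split_ifs with h
  · rw [Finset.card_insert_of_notMem (by simp [hy]), pow_succ]
    ring
  · simp

theorem mul_wedge_apply (A : Op I) (x : I) (M P : Finset I) :
    (A * wedge x) M P = if x ∉ P then wedgeSign x P * A M (insert x P) else 0 := by
  rw [Matrix.mul_apply, Finset.sum_eq_single (insert x P)]
  · by_cases h : x ∈ P <;> simp [wedge, h, mul_comm]
  · intro J _ hJ
    simp [wedge, hJ]
  · simp

theorem wedge_mul_apply (A : Op I) (x : I) (M P : Finset I) :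
    (wedge x * A) M P = if x ∈ M then wedgeSign x (M.erase x) * A (M.erase x) P else 0 := by
  rw [Matrix.mul_apply, Finset.sum_eq_single (M.erase x)]
  · by_cases h : x ∈ M
    · simp [wedge, h]
    · have : M ≠ insert x (M.erase x) := fun h' => h (h' ▸ Finset.mem_insert_self _ _)
      simp only [wedge, Matrix.of_apply, this, and_false, if_false, h, zero_mul]
  · intro J _ hJ
    have : ¬ (x ∉ J ∧ M = insert x J) := by
      rintro ⟨h1, h2⟩
      exact hJ (by rw [h2, Finset.erase_insert h1])
    simp only [wedge, Matrix.of_apply, if_neg this, zero_mul]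
  · simp

theorem wedge_anticomm (x y : I) : wedge x * wedge y + wedge y * wedge x = 0 := by
  ext M P
  rw [Matrix.add_apply, mul_wedge_apply, mul_wedge_apply]
  simp only [wedge, Matrix.of_apply, Matrix.zero_apply]
  by_cases hxy : x = y
  · subst hxy
    simp
  by_cases hx : x ∈ P
  · simp [hx]
  by_cases hy : y ∈ P
  · simp [hy]
  have hyx : y ≠ x := fun h => hxy h.symm
  rw [Finset.insert_comm y x P]
  by_cases hM : M = insert x (insert y P)
  · simp only [hx, hy, hM, hxy, hyx, Finset.mem_insert, not_false_eq_true, true_and, or_self,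
      if_true, wedgeSign_insert _ _ _ hx, wedgeSign_insert _ _ _ hy]
    rcases lt_or_gt_of_ne hxy with h | h
    · simp [h, h.not_gt]; ring
    · simp [h, h.not_gt]; ring
  · simp [hM]

theorem wedge_mul_star_apply (x y : I) (M P : Finset I) :
    (wedge x * (wedge y).conjTranspose) M P = if y ∈ P ∧ x ∉ P.erase y ∧ M = insert x (P.erase y)
      then wedgeSign y (P.erase y) * wedgeSign x (P.erase y) else 0 := by
  rw [Matrix.mul_apply, Finset.sum_eq_single (P.erase y)]
  · by_cases h : y ∈ P
    · by_cases h' : x ∉ P.erase y ∧ M = insert x (P.erase y)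
      · rw [if_pos ⟨h, h'⟩]
        simp only [wedge, Matrix.of_apply, Matrix.conjTranspose_apply, if_pos h']
        simp [h, star_wedgeSign, mul_comm]
      · rw [if_neg (fun hh => h' hh.2)]
        simp only [wedge, Matrix.of_apply, if_neg h', zero_mul]
    · have : P ≠ insert y (P.erase y) := fun h' => h (h' ▸ Finset.mem_insert_self _ _)
      simp only [wedge, Matrix.of_apply, Matrix.conjTranspose_apply, this, and_false, if_false,
        h, false_and, star_zero, mul_zero]
  · intro J _ hJ
    have : ¬ (y ∉ J ∧ P = insert y J) := by
      rintro ⟨h1, h2⟩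
      exact hJ (by rw [h2, Finset.erase_insert h1])
    simp only [wedge, Matrix.of_apply, Matrix.conjTranspose_apply, if_neg this, star_zero, mul_zero]
  · simp

theorem star_mul_wedge_apply (x y : I) (M P : Finset I) :
    ((wedge y).conjTranspose * wedge x) M P = if x ∉ P ∧ y ∉ M ∧ insert x P = insert y M
      then wedgeSign x P * wedgeSign y M else 0 := by
  rw [mul_wedge_apply]
  by_cases h : x ∉ P
  · by_cases h' : y ∉ M ∧ insert x P = insert y M
    · rw [if_pos h, if_pos ⟨h, h'⟩]
      simp only [wedge, Matrix.of_apply, Matrix.conjTranspose_apply, if_pos h', star_wedgeSign]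
    · rw [if_pos h, if_neg (fun hh => h' hh.2)]
      simp only [wedge, Matrix.of_apply, Matrix.conjTranspose_apply, if_neg h', star_zero, mul_zero]
  · rw [if_neg h, if_neg (fun hh => h hh.1)]

theorem wedge_star_anticomm (x y : I) :
    (wedge y).conjTranspose * wedge x + wedge x * (wedge y).conjTranspose =
      if x = y then 1 else 0 := by
  ext M P
  rw [Matrix.add_apply, wedge_mul_star_apply, star_mul_wedge_apply]
  by_cases hxy : x = y
  · subst hxy
    rw [if_pos rfl]
    by_cases hx : x ∈ P
    · rw [if_neg (fun h => h.1 hx), Finset.insert_erase hx]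
      by_cases hM : M = P
      · subst hM
        simp [hx, wedgeSign_mul_self]
      · simp [hM]
    · rw [if_neg (fun h : x ∈ P ∧ _ => hx h.1)]
      by_cases hM : M = P
      · subst hM
        simp [hx, wedgeSign_mul_self]
      · have : ¬ (x ∉ P ∧ x ∉ M ∧ insert x P = insert x M) := by
          rintro ⟨-, h1, h2⟩
          apply hM
          rw [← Finset.erase_insert h1, ← h2, Finset.erase_insert hx]
        simp [hM, this]
  · rw [if_neg hxy, Matrix.zero_apply]
    have hyx : y ≠ x := fun h => hxy h.symm
    by_cases h : y ∈ P ∧ x ∉ P ∧ M = insert x (P.erase y)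
    · obtain ⟨hy, hx, rfl⟩ := h
      have hxe : x ∉ P.erase y := fun h => hx (Finset.mem_of_mem_erase h)
      have e : insert x P = insert y (insert x (P.erase y)) := by
        rw [Finset.insert_comm, Finset.insert_erase hy]
      have e2 : wedgeSign x P = (if y < x then -1 else 1) * wedgeSign x (P.erase y) := by
        rw [← wedgeSign_insert _ _ _ (Finset.notMem_erase y P), Finset.insert_erase hy]
      rw [if_pos ⟨hx, by simp [hyx], e⟩, if_pos ⟨hy, hxe, rfl⟩, e2, wedgeSign_insert _ _ _ hxe]
      rcases lt_or_gt_of_ne hxy with h | h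
      · simp [h, h.not_gt]; ring
      · simp [h, h.not_gt]; ring
    · rw [if_neg, if_neg, add_zero]
      · rintro ⟨hy, hx, hM⟩
        exact h ⟨hy, fun hx' => hx (Finset.mem_erase.2 ⟨hxy, hx'⟩), hM⟩
      · rintro ⟨hx, hy, hM⟩
        have hyP : y ∈ P := by
          have : y ∈ insert x P := hM ▸ Finset.mem_insert_self _ _
          exact (Finset.mem_insert.1 this).resolve_left hyx
        refine h ⟨hyP, hx, ?_⟩
        rw [← Finset.erase_insert hy, ← hM, Finset.erase_insert_of_ne hxy]

theorem aPlus_anticomm (ε : ℝ) (x y : I) : aPlus ε x * aPlus ε y + aPlus ε y * aPlus ε x = 0 := by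
  simp only [aPlus_eq, smul_mul_assoc, mul_smul_comm, ← smul_add, wedge_anticomm, smul_zero]

theorem aMinus_anticomm (ε : ℝ) (x y : I) :
    aMinus ε x * aMinus ε y + aMinus ε y * aMinus ε x = 0 := by
  have := congrArg Matrix.conjTranspose (aPlus_anticomm ε y x)
  simpa [aMinus, Matrix.conjTranspose_add, Matrix.conjTranspose_mul] using this

theorem aMinus_aPlus_anticomm {ε : ℝ} (hε : 0 < ε) (x y : I) :
    aMinus ε x * aPlus ε y + aPlus ε y * aMinus ε x = if x = y then ((ε : ℂ)⁻¹) • 1 else 0 := by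
  have h2 : ((Real.sqrt ε : ℂ)⁻¹) * ((Real.sqrt ε : ℂ)⁻¹) = (ε : ℂ)⁻¹ := by
    rw [← mul_inv, ← Complex.ofReal_mul, Real.mul_self_sqrt hε.le]
  simp only [aPlus_eq, aMinus_eq, smul_mul_assoc, mul_smul_comm, ← smul_add, wedge_star_anticomm,
    smul_smul, h2]
  by_cases h : x = y <;> simp [h, eq_comm]

theorem parity_mul_wedge (x : I) : parity I * wedge x = -(wedge x * parity I) := by
  ext M P
  simp only [parity, Matrix.diagonal_mul, Matrix.neg_apply, Matrix.mul_diagonal]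
  simp only [wedge, Matrix.of_apply]
  split_ifs with h
  · rw [h.2, Finset.card_insert_of_notMem h.1, pow_succ]
    ring
  · simp

theorem parity_conjTranspose : (parity I).conjTranspose = parity I := by
  rw [parity, Matrix.diagonal_conjTranspose]
  congr 1
  ext J
  simp

theorem aPlus_mem_odd (ε : ℝ) (x : I) : aPlus ε x ∈ opGrade I 1 := by
  rw [mem_opGrade_one, aPlus_eq, mul_smul_comm, parity_mul_wedge, smul_mul_assoc, smul_neg]

theorem aMinus_mem_odd (ε : ℝ) (x : I) : aMinus ε x ∈ opGrade I 1 := by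
  have h := congrArg Matrix.conjTranspose (mem_opGrade_one.1 (aPlus_mem_odd ε x))
  rw [Matrix.conjTranspose_neg, Matrix.conjTranspose_mul, Matrix.conjTranspose_mul,
    parity_conjTranspose] at h
  rw [mem_opGrade_one, aMinus, h, neg_neg]

end CAR

/-! ### Normal ordered form of an operator -/

section NormalForm

variable {I : Type*} [LinearOrder I] [Fintype I]

theorem wedge_prod_apply_eq_zero (l : List I) (M P : Finset I)
    (h : (l.map wedge).prod M P ≠ 0) : M = l.toFinset ∪ P ∧ Disjoint l.toFinset P := by
  induction l generalizing M with
  | nil =>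
    rw [List.map_nil, List.prod_nil, Matrix.one_apply] at h
    simp only [ne_eq, ite_eq_right_iff, one_ne_zero, imp_false, not_not] at h
    simp [h]
  | cons x l ih =>
    rw [List.map_cons, List.prod_cons, wedge_mul_apply] at h
    split_ifs at h with hx
    · obtain ⟨h1, h2⟩ := ih _ (right_ne_zero_of_mul h)
      have hxP : x ∉ P := by
        intro hxP
        have : x ∈ M.erase x := h1 ▸ Finset.mem_union_right _ hxP
        simp at this
      refine ⟨?_, ?_⟩
      · rw [List.toFinset_cons, Finset.insert_union, ← h1, Finset.insert_erase hx]
      · rw [List.toFinset_cons, Finset.disjoint_insert_left]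
        exact ⟨hxP, h2⟩
    · exact absurd rfl h

theorem wedge_prod_apply_ne_zero (l : List I) (hl : l.Nodup) (P : Finset I)
    (h : Disjoint l.toFinset P) : (l.map wedge).prod (l.toFinset ∪ P) P ≠ 0 := by
  induction l with
  | nil => simp
  | cons x l ih =>
    rw [List.nodup_cons] at hl
    rw [List.toFinset_cons, Finset.disjoint_insert_left] at h
    have e : (insert x l.toFinset ∪ P).erase x = l.toFinset ∪ P := by
      rw [Finset.insert_union, Finset.erase_insert]
      simp [hl.1, h.1]
    rw [List.map_cons, List.prod_cons, wedge_mul_apply, List.toFinset_cons, if_pos (by simp), e]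
    exact mul_ne_zero (wedgeSign_ne_zero _ _) (ih hl.2 h.2)

theorem prod_map_smul {ι A : Type*} [Ring A] [Algebra ℂ A] (c : ℂ) (f : ι → A) (l : List ι) :
    (l.map fun x => c • f x).prod = c ^ l.length • (l.map f).prod := by
  induction l with
  | nil => simp
  | cons x l ih => simp [ih, smul_smul, pow_succ]

theorem aPlus_prod_eq (ε : ℝ) (l : List I) : (l.map (aPlus ε)).prod =
    ((Real.sqrt ε : ℂ)⁻¹) ^ l.length • (l.map wedge).prod :=
  prod_map_smul _ _ _

theorem aMinus_prod_eq (ε : ℝ) (l : List I) : (l.map (aMinus ε)).prod =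
    ((Real.sqrt ε : ℂ)⁻¹) ^ l.length • ((l.reverse.map wedge).prod).conjTranspose := by
  rw [show aMinus ε = fun x : I => ((Real.sqrt ε : ℂ)⁻¹) • (wedge x).conjTranspose from
    funext (aMinus_eq ε), prod_map_smul, Matrix.conjTranspose_list_prod, List.map_map,
    List.map_reverse, List.reverse_reverse]
  rfl

theorem sqrt_inv_pow_ne_zero {ε : ℝ} (hε : 0 < ε) (n : ℕ) :
    ((Real.sqrt ε : ℂ)⁻¹) ^ n ≠ 0 :=
  pow_ne_zero _ (inv_ne_zero (Complex.ofReal_ne_zero.2 (Real.sqrt_pos.2 hε).ne'))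

theorem orderedProd_aPlus_support (ε : ℝ) (J M Q : Finset I)
    (h : orderedProd (aPlus ε) J M Q ≠ 0) : M = J ∪ Q ∧ Disjoint J Q := by
  rw [orderedProd, aPlus_prod_eq, Matrix.smul_apply, smul_eq_mul] at h
  simpa using wedge_prod_apply_eq_zero _ _ _ (right_ne_zero_of_mul h)

theorem orderedProd_aMinus_support (ε : ℝ) (L Q P : Finset I)
    (h : orderedProd (aMinus ε) L Q P ≠ 0) : P = L ∪ Q ∧ Disjoint L Q := by
  rw [orderedProd, aMinus_prod_eq, Matrix.smul_apply, smul_eq_mul,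
    Matrix.conjTranspose_apply] at h
  simpa using wedge_prod_apply_eq_zero _ _ _ (star_ne_zero.1 (right_ne_zero_of_mul h))

theorem orderedProd_aPlus_vacuum {ε : ℝ} (hε : 0 < ε) (J : Finset I) :
    orderedProd (aPlus ε) J J ∅ ≠ 0 := by
  have h := wedge_prod_apply_ne_zero (J.sort (· ≤ ·)) (Finset.sort_nodup _ _) ∅ (by simp)
  rw [orderedProd, aPlus_prod_eq, Matrix.smul_apply, smul_eq_mul]
  exact mul_ne_zero (sqrt_inv_pow_ne_zero hε _) (by simpa using h)

theorem orderedProd_aMinus_vacuum {ε : ℝ} (hε : 0 < ε) (L : Finset I) :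
    orderedProd (aMinus ε) L ∅ L ≠ 0 := by
  have h := wedge_prod_apply_ne_zero (L.sort (· ≤ ·)).reverse
    (List.nodup_reverse.2 (Finset.sort_nodup _ _)) ∅ (by simp)
  rw [orderedProd, aMinus_prod_eq, Matrix.smul_apply, smul_eq_mul, Matrix.conjTranspose_apply]
  exact mul_ne_zero (sqrt_inv_pow_ne_zero hε _) (star_ne_zero.2 (by simpa using h))

/-- Normal ordered monomials are linearly independent: the matrix element between `e_J` and `e_L`
involves, besides the coefficient of the monomial `(J, L)` itself, only monomials with fewer
annihilators. -/
theorem normalPoly_eq_zero {ε : ℝ} (hε : 0 < ε) (v : Finset I → Finset I → ℂ)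
    (h : normalPoly v (aPlus ε) (aMinus ε) = 0) (L J : Finset I) : v J L = 0 := by
  induction L using Finset.strongInduction generalizing J with
  | H L ih =>
    have h1 := congrFun (congrFun h J) L
    simp only [normalPoly, Matrix.sum_apply, Matrix.smul_apply, Matrix.mul_apply, smul_eq_mul,
      Matrix.zero_apply] at h1
    have key : ∀ J' L' Q, v J' L' * (orderedProd (aPlus ε) J' J Q * orderedProd (aMinus ε) L' Q L)
        ≠ 0 → J' = J ∧ L' = L ∧ Q = ∅ := by
      intro J' L' Q hne
      obtain ⟨e1, d1⟩ := orderedProd_aPlus_support ε J' J Q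
        (left_ne_zero_of_mul (right_ne_zero_of_mul hne))
      obtain ⟨e2, d2⟩ := orderedProd_aMinus_support ε L' Q L
        (right_ne_zero_of_mul (right_ne_zero_of_mul hne))
      have hL : L' = L := by
        by_contra hLL
        exact left_ne_zero_of_mul hne (ih L' (Finset.ssubset_iff_subset_ne.2
          ⟨e2 ▸ Finset.subset_union_left, hLL⟩) J')
      have hQ : Q = ∅ := by
        subst hL
        have : Q ⊆ L' := by
          conv_rhs => rw [e2]
          exact Finset.subset_union_right
        exact Finset.disjoint_self_iff_empty _ |>.1 (Finset.disjoint_of_subset_left this d2)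
      exact ⟨by rw [e1, hQ, Finset.union_empty], hL, hQ⟩
    rw [Finset.sum_eq_single J, Finset.sum_eq_single L, Finset.sum_eq_single ∅] at h1
    · exact (mul_eq_zero.1 h1).resolve_right (mul_ne_zero (orderedProd_aPlus_vacuum hε J)
        (orderedProd_aMinus_vacuum hε L))
    · intro Q _ hQ
      by_contra hne
      obtain ⟨e2, d2⟩ := orderedProd_aMinus_support ε L Q L (right_ne_zero_of_mul hne)
      have : Q ⊆ L := by
        conv_rhs => rw [e2]
        exact Finset.subset_union_right
      exact hQ (Finset.disjoint_self_iff_empty _ |>.1 (Finset.disjoint_of_subset_left this d2))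
    · simp
    · intro L' _ hL'
      by_contra hne
      rw [Finset.mul_sum] at hne
      obtain ⟨Q, _, hQ⟩ := Finset.exists_ne_zero_of_sum_ne_zero hne
      exact hL' (key _ _ _ hQ).2.1
    · simp
    · intro J' _ hJ'
      by_contra hne
      obtain ⟨L', _, hne⟩ := Finset.exists_ne_zero_of_sum_ne_zero hne
      rw [Finset.mul_sum] at hne
      obtain ⟨Q, _, hQ⟩ := Finset.exists_ne_zero_of_sum_ne_zero hne
      exact hJ' (key _ _ _ hQ).1
    · simp

/-- Evaluation of normal ordered polynomials, as a linear map in the coefficients. -/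
noncomputable def normalPolyLin {A : Type*} [Ring A] [Algebra ℂ A] (a b : I → A) :
    (Finset I → Finset I → ℂ) →ₗ[ℂ] A where
  toFun v := normalPoly v a b
  map_add' v w := by
    simp only [normalPoly, Pi.add_apply, add_smul, Finset.sum_add_distrib]
  map_smul' c v := by
    simp only [normalPoly, Pi.smul_apply, smul_eq_mul, mul_smul, Finset.smul_sum, RingHom.id_apply]

theorem normalPoly_injective {ε : ℝ} (hε : 0 < ε) :
    Function.Injective fun v : Finset I → Finset I → ℂ => normalPoly v (aPlus ε) (aMinus ε) := by
  have : Function.Injective (normalPolyLin (aPlus (I := I) ε) (aMinus ε)) := by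
    rw [injective_iff_map_eq_zero]
    intro v hv
    funext J L
    exact normalPoly_eq_zero hε v hv L J
  exact this

theorem existsUnique_normalPoly {ε : ℝ} (hε : 0 < ε) (V : Op I) :
    ∃! v : Finset I → Finset I → ℂ, normalPoly v (aPlus ε) (aMinus ε) = V := by
  have hs : Function.Surjective (normalPolyLin (aPlus (I := I) ε) (aMinus ε)) :=
    (LinearMap.injective_iff_surjective_of_finrank_eq_finrank rfl).1 (normalPoly_injective hε)
  obtain ⟨v, hv⟩ := hs V
  exact ⟨v, hv, fun w hw => normalPoly_injective hε (hw.trans hv.symm)⟩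

theorem parity_mul_prod (l : List (Op I)) (hl : ∀ A ∈ l, A ∈ opGrade I 1) :
    parity I * l.prod = (-1 : ℂ) ^ l.length • (l.prod * parity I) := by
  induction l with
  | nil => simp
  | cons A l ih =>
    rw [List.prod_cons, ← mul_assoc, mem_opGrade_one.1 (hl A (by simp)), neg_mul, mul_assoc,
      ih fun B hB => hl B (by simp [hB]), List.length_cons, pow_succ', mul_smul_comm, neg_mul,
      one_mul, neg_smul, mul_assoc]

/-- The normal ordered form of an even operator only contains monomials of even degree. -/
theorem normalPoly_even {ε : ℝ} (hε : 0 < ε) {V : Op I} (hV : parity I * V = V * parity I)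
    {v : Finset I → Finset I → ℂ} (hv : normalPoly v (aPlus ε) (aMinus ε) = V)
    {J L : Finset I} (h : v J L ≠ 0) : Even (J.card + L.card) := by
  have h1 : normalPoly (fun J L => (-1 : ℂ) ^ (J.card + L.card) * v J L) (aPlus ε) (aMinus ε) =
      V := by
    have h2 : parity I * V * parity I = V := by rw [hV, mul_assoc, parity_mul_self, mul_one]
    rw [← h2, ← hv]
    simp only [normalPoly, Finset.mul_sum, Finset.sum_mul]
    refine Finset.sum_congr rfl fun J _ => Finset.sum_congr rfl fun L _ => ?_
    have h3 := parity_mul_prod ((J.sort (· ≤ ·)).map (aPlus ε) ++ (L.sort (· ≤ ·)).map (aMinus ε))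
      (by
        intro A hA
        simp only [List.mem_append, List.mem_map] at hA
        rcases hA with ⟨x, -, rfl⟩ | ⟨x, -, rfl⟩
        exacts [aPlus_mem_odd ε x, aMinus_mem_odd ε x])
    rw [List.prod_append, List.length_append, List.length_map, List.length_map,
      Finset.length_sort, Finset.length_sort] at h3
    rw [mul_smul_comm, smul_mul_assoc, orderedProd, orderedProd, h3, smul_mul_assoc, mul_assoc _ (parity I),
      parity_mul_self, mul_one, smul_smul, mul_comm]
  have h4 := congrFun (congrFun (normalPoly_injective hε (h1.trans hv.symm)) J) L
  by_contra hodd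
  rw [Nat.not_even_iff_odd] at hodd
  rw [hodd.neg_one_pow] at h4
  apply h
  linear_combination (-1 / 2 : ℂ) * h4

end NormalForm

/-! ### Matrix exponentials -/

section MatrixExp

open scoped Matrix.Norms.Operator

variable {n : Type*} [Fintype n] [DecidableEq n]

theorem semiconjBy_exp {X A B : Matrix n n ℂ} (h : SemiconjBy X A B) :
    SemiconjBy X (NormedSpace.exp A) (NormedSpace.exp B) := by
  let : NormedAlgebra ℚ (Matrix n n ℂ) := NormedAlgebra.restrictScalars ℚ ℂ _
  exact h.exp_right

theorem exp_smul_one (c : ℂ) :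
    NormedSpace.exp (c • (1 : Matrix n n ℂ)) = Complex.exp c • (1 : Matrix n n ℂ) := by
  rw [← Matrix.diagonal_one, ← Matrix.diagonal_smul, Matrix.exp_diagonal, ← Matrix.diagonal_smul]
  congr 1
  ext i
  rw [Pi.coe_exp]
  simp [Complex.exp_eq_exp_ℂ]

theorem exp_smul_add (z w : ℂ) (A : Matrix n n ℂ) :
    NormedSpace.exp ((z + w) • A) = NormedSpace.exp (z • A) * NormedSpace.exp (w • A) := by
  rw [add_smul, Matrix.exp_add_of_commute]
  exact ((Commute.refl A).smul_left z).smul_right w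

theorem exp_smul_mul_exp_neg_smul (z : ℂ) (A : Matrix n n ℂ) :
    NormedSpace.exp (z • A) * NormedSpace.exp (-z • A) = 1 := by
  rw [← exp_smul_add, add_neg_cancel, zero_smul, NormedSpace.exp_zero]

theorem exp_neg_smul_mul_exp_smul (z : ℂ) (A : Matrix n n ℂ) :
    NormedSpace.exp (-z • A) * NormedSpace.exp (z • A) = 1 := by
  rw [← exp_smul_add, neg_add_cancel, zero_smul, NormedSpace.exp_zero]

/-- The exponential of a multiple of an idempotent. -/
theorem exp_smul_idempotent {P : Matrix n n ℂ} (hP : P * P = P) (c : ℂ) :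
    NormedSpace.exp (c • P) = 1 + (Complex.exp c - 1) • P := by
  have h1 : SemiconjBy P (c • (1 : Matrix n n ℂ)) (c • P) := by
    simp [SemiconjBy, hP]
  have h2 : SemiconjBy (1 - P) (0 : Matrix n n ℂ) (c • P) := by
    simp [SemiconjBy, mul_sub, hP]
  have h1' := semiconjBy_exp h1
  have h2' := semiconjBy_exp h2
  rw [exp_smul_one, SemiconjBy, mul_smul_comm, mul_one] at h1'
  rw [NormedSpace.exp_zero, SemiconjBy, mul_one, mul_sub, mul_one, ← h1'] at h2'
  rw [sub_eq_iff_eq_add.1 h2'.symm, sub_smul, one_smul]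
  abel

/-- The spectral theorem in coordinates. -/
theorem exists_spectral {E : Matrix n n ℂ} (hE : E.IsHermitian) :
    ∃ (U : Matrix n n ℂ) (d : n → ℝ), U * U.conjTranspose = 1 ∧ U.conjTranspose * U = 1 ∧
      E = U * Matrix.diagonal (fun i => (d i : ℂ)) * U.conjTranspose := by
  refine ⟨hE.eigenvectorUnitary, hE.eigenvalues, ?_, ?_, ?_⟩
  · exact Unitary.mul_star_self_of_mem hE.eigenvectorUnitary.2
  · exact Unitary.star_mul_self_of_mem hE.eigenvectorUnitary.2
  · exact hE.spectral_theorem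

theorem exp_spectral {U : Matrix n n ℂ} {d : n → ℝ} (h1 : U * U.conjTranspose = 1) (z : ℂ) :
    NormedSpace.exp (z • (U * Matrix.diagonal (fun i => (d i : ℂ)) * U.conjTranspose)) =
      U * Matrix.diagonal (fun i => Complex.exp (z * d i)) * U.conjTranspose := by
  have hinv : U⁻¹ = U.conjTranspose := Matrix.inv_eq_right_inv h1
  have hU : IsUnit U := IsUnit.of_mul_eq_one _ h1
  rw [← smul_mul_assoc, ← mul_smul_comm, ← hinv, Matrix.exp_conj _ _ hU, ← Matrix.diagonal_smul,
    Matrix.exp_diagonal]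
  congr 3
  ext i
  rw [Pi.coe_exp]
  simp [Complex.exp_eq_exp_ℂ]

end MatrixExp

/-! ### Quadratic Hamiltonians -/

section Quadratic

open scoped Matrix

variable {I : Type*} [LinearOrder I] [Fintype I]

/-- The creation operator `∑ x, u x • a⁺_x`. -/
noncomputable def creation (ε : ℝ) : (I → ℂ) →ₗ[ℂ] Op I := Fintype.linearCombination ℂ (aPlus ε)

/-- The annihilation operator `∑ x, u x • a⁻_x`, linear in `u`. -/
noncomputable def annihilation (ε : ℝ) : (I → ℂ) →ₗ[ℂ] Op I :=
  Fintype.linearCombination ℂ (aMinus ε)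

theorem creation_apply (ε : ℝ) (u : I → ℂ) : creation ε u = ∑ x, u x • aPlus ε x := rfl

theorem annihilation_apply (ε : ℝ) (u : I → ℂ) : annihilation ε u = ∑ x, u x • aMinus ε x := rfl

theorem creation_single (ε : ℝ) (x : I) : creation ε (Pi.single x 1) = aPlus ε x := by
  simp [creation]

theorem annihilation_single (ε : ℝ) (x : I) : annihilation ε (Pi.single x 1) = aMinus ε x := by
  simp [annihilation]

theorem creation_anticomm (ε : ℝ) (u w : I → ℂ) :
    creation ε u * creation ε w + creation ε w * creation ε u = 0 := by
  simp only [creation_apply, Finset.sum_mul, Finset.mul_sum, smul_mul_assoc, mul_smul_comm,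
    Finset.smul_sum]
  rw [Finset.sum_comm (γ := I), ← Finset.sum_add_distrib]
  refine Finset.sum_eq_zero fun x _ => ?_
  rw [← Finset.sum_add_distrib]
  refine Finset.sum_eq_zero fun y _ => ?_
  rw [smul_comm, ← smul_add, ← smul_add, aPlus_anticomm, smul_zero, smul_zero]

theorem annihilation_anticomm (ε : ℝ) (u w : I → ℂ) :
    annihilation ε u * annihilation ε w + annihilation ε w * annihilation ε u = 0 := by
  simp only [annihilation_apply, Finset.sum_mul, Finset.mul_sum, smul_mul_assoc, mul_smul_comm,
    Finset.smul_sum]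
  rw [Finset.sum_comm (γ := I), ← Finset.sum_add_distrib]
  refine Finset.sum_eq_zero fun x _ => ?_
  rw [← Finset.sum_add_distrib]
  refine Finset.sum_eq_zero fun y _ => ?_
  rw [smul_comm, ← smul_add, ← smul_add, aMinus_anticomm, smul_zero, smul_zero]

theorem annihilation_creation_anticomm {ε : ℝ} (hε : 0 < ε) (u w : I → ℂ) :
    annihilation ε u * creation ε w + creation ε w * annihilation ε u =
      ((ε : ℂ)⁻¹ * (u ⬝ᵥ w)) • 1 := by
  simp only [creation_apply, annihilation_apply, Finset.sum_mul, Finset.mul_sum, smul_mul_assoc,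
    mul_smul_comm, Finset.smul_sum]
  rw [Finset.sum_comm (γ := I), ← Finset.sum_add_distrib]
  simp_rw [← Finset.sum_add_distrib, smul_comm (w _) (u _), ← smul_add,
    aMinus_aPlus_anticomm hε]
  simp only [dotProduct, Finset.sum_smul, Finset.mul_sum]
  refine Finset.sum_congr rfl fun x _ => ?_
  rw [Finset.sum_eq_single x]
  · simp [smul_smul]; ring_nf
  · intro y _ hy
    simp [hy.symm]
  · simp

theorem creation_mem_odd (ε : ℝ) (u : I → ℂ) : creation ε u ∈ opGrade I 1 :=
  Submodule.sum_mem _ fun x _ => Submodule.smul_mem _ _ (aPlus_mem_odd ε x)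

theorem annihilation_mem_odd (ε : ℝ) (u : I → ℂ) : annihilation ε u ∈ opGrade I 1 :=
  Submodule.sum_mem _ fun x _ => Submodule.smul_mem _ _ (aMinus_mem_odd ε x)

theorem quadOp_eq (ε : ℝ) (E : Matrix I I ℂ) :
    quadOp ε E = (ε : ℂ) • ∑ x, aPlus ε x * annihilation ε (E x) := rfl

theorem quadOp_mul_creation {ε : ℝ} (hε : 0 < ε) (E : Matrix I I ℂ) (u : I → ℂ) :
    quadOp ε E * creation ε u = creation ε u * quadOp ε E + creation ε (E *ᵥ u) := by
  have key : ∀ x, aPlus ε x * annihilation ε (E x) * creation ε u =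
      creation ε u * (aPlus ε x * annihilation ε (E x)) +
        ((ε : ℂ)⁻¹ * (E x ⬝ᵥ u)) • aPlus ε x := by
    intro x
    have h1 := creation_anticomm ε (Pi.single x 1) u
    rw [creation_single] at h1
    rw [mul_assoc, eq_sub_of_add_eq (annihilation_creation_anticomm hε (E x) u), mul_sub,
      ← mul_assoc, eq_neg_of_add_eq_zero_left h1]
    simp [mul_assoc, add_comm]
  rw [quadOp_eq, smul_mul_assoc, Finset.sum_mul, mul_smul_comm, Finset.mul_sum]
  simp only [key, Finset.sum_add_distrib, smul_add]
  congr 1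
  rw [creation_apply, Finset.smul_sum]
  refine Finset.sum_congr rfl fun x _ => ?_
  rw [smul_smul, mul_inv_cancel_left₀ (Complex.ofReal_ne_zero.2 hε.ne')]
  rfl

theorem quadOp_mul_annihilation {ε : ℝ} (hε : 0 < ε) (E : Matrix I I ℂ) (u : I → ℂ) :
    quadOp ε E * annihilation ε u =
      annihilation ε u * quadOp ε E + annihilation ε ((-E.transpose) *ᵥ u) := by
  have key : ∀ x, aPlus ε x * annihilation ε (E x) * annihilation ε u =
      annihilation ε u * (aPlus ε x * annihilation ε (E x)) -
        ((ε : ℂ)⁻¹ * u x) • annihilation ε (E x) := by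
    intro x
    have h1 := annihilation_creation_anticomm hε u (Pi.single x 1)
    rw [creation_single] at h1
    rw [mul_assoc, eq_neg_of_add_eq_zero_left (annihilation_anticomm ε (E x) u), mul_neg,
      ← mul_assoc, eq_sub_of_add_eq' h1, sub_mul, neg_sub, smul_mul_assoc, one_mul, mul_assoc]
    simp
  rw [quadOp_eq, smul_mul_assoc, Finset.sum_mul, mul_smul_comm, Finset.mul_sum]
  simp only [key, Finset.sum_sub_distrib, smul_sub]
  rw [sub_eq_add_neg]
  congr 1
  rw [neg_eq_iff_eq_neg, ← map_neg, Matrix.neg_mulVec, neg_neg, Finset.smul_sum]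
  simp_rw [smul_smul, mul_inv_cancel_left₀ (Complex.ofReal_ne_zero.2 hε.ne'), ← map_smul]
  rw [← map_sum]
  congr 1
  ext y
  simp [Matrix.mulVec, dotProduct, mul_comm]

theorem mulVec_eq_sum_col (M : Matrix I I ℂ) (v : I → ℂ) : M *ᵥ v = ∑ i, v i • M.col i := by
  ext x
  simp [Matrix.mulVec, dotProduct, mul_comm]

/-- If the commutator with `K` acts on the operators `F u` through a hermitian matrix `M`, then
conjugation with `exp (z K)` acts through `exp (z M)`. -/
theorem exp_mul_of_commutator {K : Op I} {M : Matrix I I ℂ} (hM : M.IsHermitian)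
    (F : (I → ℂ) →ₗ[ℂ] Op I) (h : ∀ u, K * F u = F u * K + F (M *ᵥ u)) (z : ℂ) (u : I → ℂ) :
    NormedSpace.exp (z • K) * F u =
      F (NormedSpace.exp (z • M) *ᵥ u) * NormedSpace.exp (z • K) := by
  obtain ⟨U, d, h1, h2, hU⟩ := exists_spectral hM
  have hcol : ∀ i, NormedSpace.exp (z • K) * F (U.col i) =
      Complex.exp (z * d i) • (F (U.col i) * NormedSpace.exp (z • K)) := by
    intro i
    have hMi : M *ᵥ U.col i = (d i : ℂ) • U.col i := by
      rw [← Matrix.mulVec_single_one, Matrix.mulVec_mulVec]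
      conv_lhs => rw [hU, mul_assoc, h2, mul_one]
      rw [← Matrix.mulVec_mulVec]
      have : Matrix.diagonal (fun i => (d i : ℂ)) *ᵥ Pi.single i 1 =
          (d i : ℂ) • (Pi.single i 1 : I → ℂ) := by
        ext j
        by_cases hj : j = i
        · subst hj; simp [Matrix.mulVec_diagonal]
        · simp [Matrix.mulVec_diagonal, hj]
      rw [this, Matrix.mulVec_smul]
    have hs : SemiconjBy (F (U.col i)) (z • K + (z * d i) • (1 : Op I)) (z • K) := by
      rw [SemiconjBy, smul_mul_assoc, h, hMi, mul_add, mul_smul_comm, smul_add, map_smul, smul_smul,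
        mul_smul_comm, mul_one]
    have hs' := semiconjBy_exp hs
    rw [Matrix.exp_add_of_commute _ _ ((Commute.one_right _).smul_right _), exp_smul_one, SemiconjBy,
      mul_smul_comm, mul_one, mul_smul_comm] at hs'
    exact hs'.symm
  have hu : u = ∑ i, (U.conjTranspose *ᵥ u) i • U.col i := by
    rw [← mulVec_eq_sum_col, Matrix.mulVec_mulVec, h1, Matrix.one_mulVec]
  have hexp : NormedSpace.exp (z • M) *ᵥ u =
      ∑ i, (U.conjTranspose *ᵥ u) i • Complex.exp (z * d i) • U.col i := by
    rw [hU, exp_spectral h1, ← Matrix.mulVec_mulVec, ← Matrix.mulVec_mulVec, mulVec_eq_sum_col]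
    refine Finset.sum_congr rfl fun i _ => ?_
    rw [Matrix.mulVec_diagonal, smul_smul, mul_comm]
  rw [hexp, map_sum, Finset.sum_mul]
  conv_lhs => rw [hu, map_sum, Finset.mul_sum]
  refine Finset.sum_congr rfl fun i _ => ?_
  rw [map_smul, map_smul, map_smul, mul_smul_comm, hcol, smul_mul_assoc, smul_mul_assoc]

theorem exp_quadOp_mul_creation {ε : ℝ} (hε : 0 < ε) {E : Matrix I I ℂ} (hE : E.IsHermitian)
    (z : ℂ) (u : I → ℂ) : NormedSpace.exp (z • quadOp ε E) * creation ε u =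
      creation ε (NormedSpace.exp (z • E) *ᵥ u) * NormedSpace.exp (z • quadOp ε E) :=
  exp_mul_of_commutator hE (creation ε) (quadOp_mul_creation hε E) z u

theorem exp_quadOp_mul_annihilation {ε : ℝ} (hε : 0 < ε) {E : Matrix I I ℂ} (hE : E.IsHermitian)
    (z : ℂ) (u : I → ℂ) : NormedSpace.exp (z • quadOp ε E) * annihilation ε u =
      annihilation ε (u ᵥ* NormedSpace.exp (-z • E)) * NormedSpace.exp (z • quadOp ε E) := by
  rw [exp_mul_of_commutator hE.transpose.neg (annihilation ε) (quadOp_mul_annihilation hε E) z u,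
    smul_neg, ← neg_smul, ← Matrix.transpose_smul, Matrix.exp_transpose, Matrix.mulVec_transpose]

theorem commute_parity_quadOp (ε : ℝ) (E : Matrix I I ℂ) : quadOp ε E ∈ opGrade I 0 := by
  rw [quadOp_eq]
  refine Submodule.smul_mem _ _ (Submodule.sum_mem _ fun x _ => ?_)
  have := SetLike.mul_mem_graded (aPlus_mem_odd ε x) (annihilation_mem_odd ε (E x))
  rwa [show (1 : ZMod 2) + 1 = 0 by decide] at this

theorem exp_mem_even {K : Op I} (hK : K ∈ opGrade I 0) : NormedSpace.exp K ∈ opGrade I 0 := by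
  rw [mem_opGrade_zero] at *
  exact semiconjBy_exp hK

/-- A number operator in front of an operator commuting with the creation operator halves its trace:
the anticommutation relation and cyclicity express the trace through its complement. -/
theorem trace_number_mul {ε : ℝ} (hε : 0 < ε) {u w : I → ℂ} (h : u ⬝ᵥ w = 1) {X : Op I}
    (h1 : Commute X (creation ε w)) :
    (((ε : ℂ) • (creation ε w * annihilation ε u)) * X).trace = X.trace / 2 := by
  have e1 : (((ε : ℂ) • (creation ε w * annihilation ε u)) * X).trace =
      X.trace - (((ε : ℂ) • (creation ε w * annihilation ε u)) * X).trace := by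
    have h3 : (ε : ℂ) • (annihilation ε u * creation ε w) =
        1 - (ε : ℂ) • (creation ε w * annihilation ε u) := by
      rw [eq_sub_of_add_eq (annihilation_creation_anticomm hε u w), h, mul_one, smul_sub, smul_smul,
        mul_inv_cancel₀ (Complex.ofReal_ne_zero.2 hε.ne'), one_smul]
    have h4 : X.trace - (((ε : ℂ) • (creation ε w * annihilation ε u)) * X).trace =
        (((ε : ℂ) • (annihilation ε u * creation ε w)) * X).trace := by
      rw [h3, sub_mul, one_mul, Matrix.trace_sub]
    rw [h4, smul_mul_assoc, smul_mul_assoc, Matrix.trace_smul, Matrix.trace_smul, mul_assoc,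
      Matrix.trace_mul_comm, mul_assoc, mul_assoc, ← h1.eq]
  linear_combination (1 / 2 : ℂ) * e1

/-- The partition function of free fermions. In an eigenbasis of `E` the exponent is a sum of
commuting idempotents, the occupation numbers, whose exponentials are affine; the factors of the
trace are split off one at a time by `trace_number_mul`. -/
theorem trace_exp_quadOp {ε : ℝ} (hε : 0 < ε) {E : Matrix I I ℂ} (hE : E.IsHermitian) (z : ℂ) :
    (NormedSpace.exp (z • quadOp ε E)).trace = (1 + NormedSpace.exp (z • E)).det := by
  obtain ⟨U, d, h1, h2, hU⟩ := exists_spectral hE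
  set b : I → Op I := fun i => creation ε (U.col i) with hb
  set b' : I → Op I := fun i => annihilation ε (U.conjTranspose i) with hb'
  set num : I → Op I := fun i => (ε : ℂ) • (b i * b' i) with hnum
  have hdot : ∀ i j, U.conjTranspose i ⬝ᵥ U.col j = if i = j then 1 else 0 := by
    intro i j
    have := congrFun (congrFun h2 i) j
    rwa [Matrix.one_apply] at this
  have hbb : ∀ i j, b i * b j = -(b j * b i) := fun i j =>
    eq_neg_of_add_eq_zero_left (creation_anticomm ε _ _)
  have hb'b' : ∀ i j, b' i * b' j = -(b' j * b' i) := fun i j =>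
    eq_neg_of_add_eq_zero_left (annihilation_anticomm ε _ _)
  have hb'b : ∀ i j, i ≠ j → b' i * b j = -(b j * b' i) := by
    intro i j hij
    have := annihilation_creation_anticomm hε (U.conjTranspose i) (U.col j)
    rw [hdot, if_neg hij, mul_zero, zero_smul] at this
    exact eq_neg_of_add_eq_zero_left this
  have hcb : ∀ i j, i ≠ j → Commute (num i) (b j) := by
    intro i j hij
    refine Commute.smul_left ?_ _
    rw [Commute, SemiconjBy, mul_assoc, hb'b i j hij, mul_neg, ← mul_assoc, hbb i j, neg_mul,
      neg_neg, mul_assoc]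
  have hcb' : ∀ i j, i ≠ j → Commute (num i) (b' j) := by
    intro i j hij
    refine Commute.smul_left ?_ _
    rw [Commute, SemiconjBy, mul_assoc, hb'b' i j, mul_neg, ← mul_assoc,
      ← neg_eq_iff_eq_neg.2 (hb'b j i hij.symm), neg_mul, neg_neg, mul_assoc]
  have hcomm : ∀ i j, i ≠ j → Commute (num i) (num j) := fun i j hij =>
    ((hcb i j hij).mul_right (hcb' i j hij)).smul_right _
  have hid : ∀ i, num i * num i = num i := by
    intro i
    have h3 := annihilation_creation_anticomm hε (U.conjTranspose i) (U.col i)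
    rw [hdot, if_pos rfl, mul_one] at h3
    have h4 : b i * b i = 0 := by
      have := creation_anticomm ε (U.col i) (U.col i)
      rw [← two_smul ℂ] at this
      exact (smul_eq_zero.1 this).resolve_left two_ne_zero
    have h5 : b i * b' i * (b i * b' i) = ((ε : ℂ)⁻¹) • (b i * b' i) := by
      rw [mul_assoc, ← mul_assoc (b' i), eq_sub_of_add_eq h3, sub_mul, mul_sub,
        ← mul_assoc, ← mul_assoc, ← mul_assoc, h4]
      simp [hb, hb']
    simp only [hnum]
    rw [smul_mul_smul_comm, h5, smul_smul, mul_assoc,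
      mul_inv_cancel₀ (Complex.ofReal_ne_zero.2 hε.ne'), mul_one]
  have hK : quadOp ε E = ∑ i, (d i : ℂ) • num i := by
    have e1 : ∀ x, annihilation ε (E x) = ∑ i, (U x i * d i) • b' i := by
      intro x
      simp only [hb', ← map_smul]
      rw [← map_sum]
      congr 1
      ext y
      rw [hU, Matrix.mul_apply]
      simp only [Matrix.mul_diagonal, Finset.sum_apply, Pi.smul_apply, smul_eq_mul]
    rw [quadOp_eq]
    simp only [e1, hnum, hb, Finset.mul_sum, creation_apply, Finset.sum_mul, Finset.smul_sum]
    rw [Finset.sum_comm]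
    refine Finset.sum_congr rfl fun i _ => Finset.sum_congr rfl fun x _ => ?_
    simp only [Matrix.col_apply, smul_mul_assoc, mul_smul_comm, smul_smul]
    ring_nf
  have htr : ∀ s : Finset I, (NormedSpace.exp (∑ i ∈ s, (z * d i) • num i)).trace =
      2 ^ Fintype.card I * ∏ i ∈ s, (1 + Complex.exp (z * d i)) / 2 := by
    intro s
    induction s using Finset.induction_on with
    | empty => simp [NormedSpace.exp_zero, Matrix.trace_one]
    | insert a s ha ih =>
      have hc : Commute ((z * d a) • num a) (∑ i ∈ s, (z * d i) • num i) :=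
        Commute.sum_right _ _ _ fun i hi =>
          ((hcomm a i fun h => ha (h ▸ hi)).smul_left _).smul_right _
      have hc2 : Commute (NormedSpace.exp (∑ i ∈ s, (z * d i) • num i)) (b a) := by
        refine (semiconjBy_exp (Commute.sum_right _ _ _ fun i hi => ?_ : Commute (b a) _)).symm
        exact ((hcb i a fun h => ha (h ▸ hi)).symm).smul_right _
      rw [Finset.sum_insert ha, Matrix.exp_add_of_commute _ _ hc, exp_smul_idempotent (hid a),
        add_mul, one_mul, smul_mul_assoc, Matrix.trace_add, Matrix.trace_smul,
        trace_number_mul hε (by rw [hdot, if_pos rfl]) hc2, ih, Finset.prod_insert ha, smul_eq_mul]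
      ring
  have h3 : (1 + NormedSpace.exp (z • E)) =
      U * Matrix.diagonal (fun i => 1 + Complex.exp (z * d i)) * U.conjTranspose := by
    rw [hU, exp_spectral h1, ← Matrix.diagonal_add, mul_add, add_mul]
    congr 1
    rw [show Matrix.diagonal (fun _ => (1 : ℂ)) = (1 : Matrix I I ℂ) from Matrix.diagonal_one,
      mul_one, h1]
  rw [h3, Matrix.det_mul_right_comm, h1, one_mul, Matrix.det_diagonal, hK, Finset.smul_sum]
  simp_rw [smul_smul]
  rw [htr, Finset.prod_div_distrib, Finset.prod_const, Finset.card_univ]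
  field_simp

theorem isUnit_one_add_exp {E : Matrix I I ℂ} (hE : E.IsHermitian) (t : ℝ) :
    IsUnit (1 + NormedSpace.exp ((t : ℂ) • E)).det := by
  obtain ⟨U, d, h1, h2, hU⟩ := exists_spectral hE
  have h3 : (1 + NormedSpace.exp ((t : ℂ) • E)) =
      U * Matrix.diagonal (fun i => 1 + Complex.exp (t * d i)) * U.conjTranspose := by
    rw [hU, exp_spectral h1, ← Matrix.diagonal_add, mul_add, add_mul]
    congr 1
    rw [show Matrix.diagonal (fun _ => (1 : ℂ)) = (1 : Matrix I I ℂ) from Matrix.diagonal_one,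
      mul_one, h1]
  rw [h3, Matrix.det_mul_right_comm, h1, one_mul, Matrix.det_diagonal, isUnit_iff_ne_zero,
    Finset.prod_ne_zero_iff]
  intro i _
  rw [← Complex.ofReal_mul, ← Complex.ofReal_exp, ← Complex.ofReal_one, ← Complex.ofReal_add,
    Complex.ofReal_ne_zero]
  positivity

end Quadratic

/-! ### The Fermi function and the covariance -/

section Fermi

open scoped Matrix

variable {I : Type*} [LinearOrder I] [Fintype I] {E : Matrix I I ℂ}

theorem fermi_mul (hE : E.IsHermitian) (β : ℝ) :
    fermi β E * (1 + NormedSpace.exp ((β : ℂ) • E)) = 1 :=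
  Matrix.nonsing_inv_mul _ (isUnit_one_add_exp hE β)

theorem mul_fermi (hE : E.IsHermitian) (β : ℝ) :
    (1 + NormedSpace.exp ((β : ℂ) • E)) * fermi β E = 1 :=
  Matrix.mul_nonsing_inv _ (isUnit_one_add_exp hE β)

theorem fermi_neg_mul (hE : E.IsHermitian) (β : ℝ) :
    fermi β (-E) * (1 + NormedSpace.exp (-(β : ℂ) • E)) = 1 := by
  have := fermi_mul hE.neg β
  rwa [smul_neg, ← neg_smul] at this

theorem fermi_neg (hE : E.IsHermitian) (β : ℝ) : fermi β (-E) = 1 - fermi β E := by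
  refine Matrix.inv_eq_left_inv ?_
  have h := fermi_mul hE β
  have h2 := exp_smul_mul_exp_neg_smul (β : ℂ) E
  rw [mul_add, mul_one] at h
  rw [smul_neg, ← neg_smul, ← eq_sub_of_add_eq' h, mul_add, mul_one, mul_assoc, h2, mul_one,
    add_comm, h]

theorem commute_fermi_exp (hE : E.IsHermitian) (β : ℝ) (z : ℂ) :
    Commute (fermi β E) (NormedSpace.exp (z • E)) := by
  have h1 : Commute (1 + NormedSpace.exp ((β : ℂ) • E)) (NormedSpace.exp (z • E)) := by
    refine (Commute.one_left _).add_left ?_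
    rw [Commute, SemiconjBy, ← exp_smul_add, ← exp_smul_add, add_comm]
  rw [Commute, SemiconjBy]
  calc fermi β E * NormedSpace.exp (z • E)
      = fermi β E * (NormedSpace.exp (z • E) * (1 + NormedSpace.exp ((β : ℂ) • E))) *
          fermi β E := by rw [mul_assoc, mul_assoc, mul_fermi hE, mul_one]
    _ = NormedSpace.exp (z • E) * fermi β E := by
        rw [← h1.eq, ← mul_assoc, fermi_mul hE, one_mul]

theorem twoPoint_eq (hE : E.IsHermitian) (β τ : ℝ) : twoPoint β E τ =
    (fermi β E - if 0 < τ then 1 else 0) * NormedSpace.exp (-(τ : ℂ) • E) := by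
  rw [twoPoint, fermi_neg hE]
  split_ifs
  · rw [← neg_mul, neg_sub]
  · rw [sub_zero]

theorem time_pos_sub {β : ℝ} (hβ : 0 < β) {N : ℕ} (k l : Fin N) :
    0 < time β N k - time β N l ↔ l < k := by
  have hN : (0 : ℝ) < N := Nat.cast_pos.2 k.pos
  rw [time, time, ← sub_mul, add_sub_add_right_eq_sub, mul_pos_iff_of_pos_right (div_pos hβ hN),
    sub_pos, Nat.cast_lt, Fin.lt_def]

/-- After the blocks are multiplied by `exp (τ_m E)`, the covariance acts as `f_β(E)` on the total sum
minus the strict partial sums. -/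
theorem covR_mulVec (hE : E.IsHermitian) {β : ℝ} (hβ : 0 < β) (N : ℕ) (v : Fin N × I → ℂ)
    (m : Fin N) : NormedSpace.exp ((time β N m : ℂ) • E) *ᵥ (fun x => (covR β E N *ᵥ v) (m, x)) =
      fermi β E *ᵥ (∑ n, NormedSpace.exp ((time β N n : ℂ) • E) *ᵥ fun y => v (n, y)) -
        ∑ n with n < m, NormedSpace.exp ((time β N n : ℂ) • E) *ᵥ fun y => v (n, y) := by
  have h1 : (fun x => (covR β E N *ᵥ v) (m, x)) =
      ∑ n, twoPoint β E (time β N m - time β N n) *ᵥ fun y => v (n, y) := by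
    ext x
    simp [Matrix.mulVec, dotProduct, Fintype.sum_prod_type, covR]
  have h2 : ∀ n, NormedSpace.exp ((time β N m : ℂ) • E) *
      twoPoint β E (time β N m - time β N n) =
      (fermi β E - if n < m then 1 else 0) * NormedSpace.exp ((time β N n : ℂ) • E) := by
    intro n
    have h3 : Commute (NormedSpace.exp ((time β N m : ℂ) • E))
        (fermi β E - if n < m then 1 else 0) := by
      refine (commute_fermi_exp hE β _).symm.sub_right ?_
      split_ifs
      exacts [Commute.one_right _, Commute.zero_right _]
    simp only [twoPoint_eq hE, time_pos_sub hβ]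
    rw [← mul_assoc, h3.eq, mul_assoc, ← exp_smul_add]
    congr 3
    push_cast
    ring
  rw [h1, Matrix.mulVec_sum, Matrix.mulVec_sum, Finset.sum_filter, ← Finset.sum_sub_distrib]
  refine Finset.sum_congr rfl fun n _ => ?_
  rw [Matrix.mulVec_mulVec, h2, ← Matrix.mulVec_mulVec, Matrix.sub_mulVec]
  split_ifs <;> simp

theorem exp_mulVec_eq_zero {z : ℂ} {u : I → ℂ} (h : NormedSpace.exp (z • E) *ᵥ u = 0) :
    u = 0 := by
  rw [← Matrix.one_mulVec u, ← exp_neg_smul_mul_exp_smul z E, ← Matrix.mulVec_mulVec, h,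
    Matrix.mulVec_zero]

/-- The covariance is invertible: by `covR_mulVec`, a vector in its kernel has a vanishing total sum
(take the first time slice) and hence vanishing partial sums. -/
theorem isUnit_covR (hE : E.IsHermitian) {β : ℝ} (hβ : 0 < β) (N : ℕ) :
    IsUnit (covR β E N).det := by
  rw [← Matrix.isUnit_iff_isUnit_det, ← Matrix.mulVec_injective_iff_isUnit]
  have : Function.Injective (covR β E N).mulVecLin := by
    rw [injective_iff_map_eq_zero]
    intro v hv
    rw [Matrix.mulVecLin_apply] at hv
    set w : Fin N → I → ℂ := fun n => NormedSpace.exp ((time β N n : ℂ) • E) *ᵥ fun y => v (n, y)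
      with hw
    have h1 : ∀ m, fermi β E *ᵥ (∑ n, w n) - ∑ n with n < m, w n = 0 := by
      intro m
      rw [← covR_mulVec hE hβ N v m, hv]
      exact Matrix.mulVec_zero _
    have hS : ∀ m : Fin N, ∑ n, w n = 0 := by
      intro m
      have h2 := h1 ⟨0, m.pos⟩
      rw [Finset.filter_false_of_mem (fun n _ => by simp [Fin.lt_def]), Finset.sum_empty,
        sub_zero] at h2
      rw [← Matrix.one_mulVec (∑ n, w n), ← mul_fermi hE β, ← Matrix.mulVec_mulVec, h2,
        Matrix.mulVec_zero]
    have hpart : ∀ m : Fin N, ∑ n with n < m, w n = 0 := by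
      intro m
      have h2 := h1 m
      rw [hS m, Matrix.mulVec_zero, zero_sub, neg_eq_zero] at h2
      exact h2
    have hle : ∀ m : Fin N, ∑ n with n ≤ m, w n = 0 := by
      intro m
      by_cases hm : (m : ℕ) + 1 < N
      · rw [← hpart ⟨m + 1, hm⟩]
        refine Finset.sum_congr (Finset.filter_congr fun n _ => ?_) fun _ _ => rfl
        rw [Fin.lt_def, Fin.le_def]
        exact Nat.lt_succ_iff.symm
      · rw [← hS m, Finset.filter_true_of_mem]
        intro n _
        rw [Fin.le_def]
        omega
    have hw0 : ∀ m, w m = 0 := by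
      intro m
      have h3 : Finset.univ.filter (fun n => n ≤ m) =
          insert m (Finset.univ.filter fun n => n < m) := by
        ext n
        simp [le_iff_lt_or_eq, or_comm]
      have h4 := hle m
      rwa [h3, Finset.sum_insert (by simp), hpart, add_zero] at h4
    ext ⟨n, y⟩
    exact congrFun (exp_mulVec_eq_zero (hw0 n)) y
  exact this

end Fermi

/-! ### Exponentials of nilpotent elements -/

section NilExp

variable {A B : Type*} [Ring A] [Algebra ℂ A] [Ring B] [Algebra ℂ B]

theorem nilExp_eq_sum {a : A} {k : ℕ} (h : a ^ k = 0) :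
    nilExp a = ∑ n ∈ Finset.range k, ((n.factorial : ℂ)⁻¹) • a ^ n := by
  let : Module ℚ A := Module.compHom A (algebraMap ℚ ℂ)
  have e : ∀ (n : ℕ) (b : A), ((n.factorial : ℂ)⁻¹) • b = ((n.factorial : ℚ)⁻¹) • b := by
    intro n b
    change _ = ((algebraMap ℚ ℂ) ((n.factorial : ℚ)⁻¹)) • b
    simp
  have := IsNilpotent.exp_eq_sum h
  simp only [e]
  rw [← this, nilExp, IsNilpotent.exp]
  simp only [e]

theorem nilExp_add {a b : A} (h : Commute a b) (ha : IsNilpotent a) (hb : IsNilpotent b) :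
    nilExp (a + b) = nilExp a * nilExp b := by
  let : Module ℚ A := Module.compHom A (algebraMap ℚ ℂ)
  have e : ∀ c : A, nilExp c = IsNilpotent.exp c := by
    intro c
    rw [nilExp, IsNilpotent.exp]
    refine Finset.sum_congr rfl fun n _ => ?_
    change _ = ((algebraMap ℚ ℂ) ((n.factorial : ℚ)⁻¹)) • (c ^ n)
    simp
  simp only [e]
  exact IsNilpotent.exp_add_of_commute h ha hb

theorem nilExp_zero : nilExp (0 : A) = 1 := by
  rw [nilExp_eq_sum (k := 1) (by simp)]
  simp

theorem nilExp_mul_neg {a : A} (ha : IsNilpotent a) : nilExp a * nilExp (-a) = 1 := by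
  rw [← nilExp_add (Commute.refl a).neg_right ha ha.neg, add_neg_cancel, nilExp_zero]

theorem nilExp_neg_mul {a : A} (ha : IsNilpotent a) : nilExp (-a) * nilExp a = 1 := by
  rw [← nilExp_add (Commute.refl a).neg_left ha.neg ha, neg_add_cancel, nilExp_zero]

theorem map_nilExp {F : Type*} [FunLike F A B] [AlgHomClass F ℂ A B] (φ : F) {a : A}
    (ha : IsNilpotent a) : φ (nilExp a) = nilExp (φ a) := by
  obtain ⟨k, hk⟩ := ha
  rw [nilExp_eq_sum hk, nilExp_eq_sum (k := k) (a := φ a) (by rw [← map_pow, hk, map_zero]),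
    map_sum]
  simp

theorem commute_nilExp_right {a b : A} (h : Commute a b) : Commute a (nilExp b) :=
  Commute.sum_right _ _ _ fun _ _ => (h.pow_right _).smul_right _

theorem nilExp_mem (S : Subalgebra ℂ A) {a : A} (ha : a ∈ S) : nilExp a ∈ S :=
  Subalgebra.sum_mem _ fun _ _ => Subalgebra.smul_mem _ (Subalgebra.pow_mem _ ha _) _

theorem nilExp_sum {ι : Type*} [DecidableEq ι] (f : ι → A)
    (hc : ∀ i j, Commute (f i) (f j)) (hn : ∀ i, IsNilpotent (f i)) (l : List ι)
    (hl : l.Nodup) :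
    nilExp (∑ i ∈ l.toFinset, f i) = (l.map fun i => nilExp (f i)).prod := by
  induction l with
  | nil => simp [nilExp_zero]
  | cons i l ih =>
    rw [List.nodup_cons] at hl
    rw [List.toFinset_cons, Finset.sum_insert (by simpa using hl.1), nilExp_add
      (Commute.sum_right _ _ _ fun j _ => hc i j) (hn i)
      (Commute.isNilpotent_sum (fun j _ => hn j) fun j k _ _ => hc j k), List.map_cons,
      List.prod_cons, ih hl.2]

end NilExp

/-! ### Contraction of words -/

section Words

variable {ι M M' : Type*} [AddCommGroup M] [Module ℂ M] [AddCommGroup M'] [Module ℂ M']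

/-- The alternating sum `∑ j, (-1)^j • s (l j) • F (l without its j-th letter)` over the letters of
a word `l`, the result of moving an odd derivation with values `s` through the word. -/
def contractWord (s : ι → ℂ) : (List ι → M) → List ι → M
  | _, [] => 0
  | F, i :: l => s i • F l - contractWord s (fun l' => F (i :: l')) l

theorem map_contractWord (φ : M →ₗ[ℂ] M') (s : ι → ℂ) (F : List ι → M) (l : List ι) :
    φ (contractWord s F l) = contractWord s (fun l' => φ (F l')) l := by
  induction l generalizing F with
  | nil => simp [contractWord]
  | cons i l ih => simp [contractWord, ih]

theorem contractWord_congr {s s' : ι → ℂ} {F G : List ι → M} {l : List ι}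
    (hs : ∀ i ∈ l, s i = s' i)
    (h : ∀ l', l'.Sublist l → l'.length + 1 = l.length → F l' = G l') :
    contractWord s F l = contractWord s' G l := by
  induction l generalizing F G with
  | nil => rfl
  | cons i l ih =>
    rw [contractWord, contractWord, hs i (by simp), h l (List.sublist_cons_self _ _) (by simp),
      ih (fun j hj => hs j (by simp [hj]))]
    intro l' hl' hlen
    exact h _ (hl'.cons_cons i) (by simp [hlen])

theorem contractWord_zero (s : ι → ℂ) (l : List ι) :
    contractWord s (fun _ => (0 : M)) l = 0 := by
  induction l with
  | nil => rfl
  | cons i l ih => simp [contractWord, ih]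

/-- Moving `g`, whose anticommutators with the letters are scalars, through a word. -/
theorem mul_word_eq {A : Type*} [Ring A] [Algebra ℂ A] (g : A) (f : ι → A) (s : ι → ℂ)
    (l : List ι) (h : ∀ i ∈ l, g * f i = s i • 1 - f i * g) :
    g * (l.map f).prod = contractWord s (fun l' => (l'.map f).prod) l +
      (-1 : ℂ) ^ l.length • ((l.map f).prod * g) := by
  induction l with
  | nil => simp [contractWord]
  | cons i l ih =>
    have h2 := map_contractWord (LinearMap.mulLeft ℂ (f i)) s (fun l' => (l'.map f).prod) l
    simp only [LinearMap.mulLeft_apply] at h2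
    rw [List.map_cons, List.prod_cons, ← mul_assoc, h i (by simp), sub_mul, mul_assoc,
      ih fun j hj => h j (by simp [hj]), mul_add, h2, contractWord, List.length_cons, pow_succ]
    simp only [List.map_cons, List.prod_cons, smul_mul_assoc, one_mul, mul_smul_comm, mul_assoc,
      mul_neg, mul_one, neg_smul]
    abel

end Words

/-! ### Grassmann algebras -/

section Grassmann

variable {S T : Type*} [Fintype S] [DecidableEq S] [Fintype T] [DecidableEq T]

/-- Contraction of a Grassmann algebra element with a linear functional on the generators. -/
noncomputable abbrev contraction {S : Type*} (d : Module.Dual ℂ (S → ℂ)) :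
    Module.End ℂ (Gr S) :=
  CliffordAlgebra.contractLeft d

theorem contraction_ι_mul {S : Type*} (d : Module.Dual ℂ (S → ℂ)) (u : S → ℂ) (x : Gr S) :
    contraction d (ExteriorAlgebra.ι ℂ u * x) =
      d u • x - ExteriorAlgebra.ι ℂ u * contraction d x :=
  CliffordAlgebra.contractLeft_ι_mul d u x

theorem contraction_gen_mul (d : Module.Dual ℂ (S → ℂ)) (s : S) (x : Gr S) :
    contraction d (gen s * x) = d (Pi.single s 1) • x - gen s * contraction d x :=
  contraction_ι_mul d _ x

theorem contraction_one {S : Type*} (d : Module.Dual ℂ (S → ℂ)) : contraction d (1 : Gr S) = 0 :=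
  CliffordAlgebra.contractLeft_one _ d

theorem ι_eq_sum_gen (u : S → ℂ) : ExteriorAlgebra.ι ℂ u = ∑ s, u s • (gen s : Gr S) := by
  conv_lhs => rw [← Finset.univ_sum_single u]
  rw [map_sum]
  refine Finset.sum_congr rfl fun s _ => ?_
  rw [gen, ← map_smul, ← Pi.single_smul, smul_eq_mul, mul_one]

theorem gr_induction {P : Gr S → Prop} (one : P 1) (add : ∀ x y, P x → P y → P (x + y))
    (smul : ∀ (c : ℂ) x, P x → P (c • x)) (gen_mul : ∀ s x, P x → P (gen s * x)) (x : Gr S) :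
    P x := by
  induction x using CliffordAlgebra.left_induction with
  | algebraMap r =>
    have := smul r 1 one
    rwa [← Algebra.algebraMap_eq_smul_one] at this
  | add x y hx hy => exact add x y hx hy
  | ι_mul x m hx =>
    have h1 : (CliffordAlgebra.ι (0 : QuadraticForm ℂ (S → ℂ)) m) * x =
        ∑ s, m s • (gen s * x) := by
      have : CliffordAlgebra.ι (0 : QuadraticForm ℂ (S → ℂ)) m = ∑ s, m s • (gen s : Gr S) :=
        ι_eq_sum_gen m
      rw [this, Finset.sum_mul]
      simp only [smul_mul_assoc]
    rw [h1]
    have h0 : P 0 := by simpa using smul 0 1 one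
    exact Finset.sum_induction _ P add h0 fun s _ => smul _ _ (gen_mul s x hx)

theorem word_induction {P : Gr S → Prop} (add : ∀ x y, P x → P y → P (x + y))
    (smul : ∀ (c : ℂ) x, P x → P (c • x)) (word : ∀ l : List S, P (l.map gen).prod) (x : Gr S) :
    P x := by
  have h : x ∈ Submodule.span ℂ (Set.range fun l : List S => (l.map (gen : S → Gr S)).prod) := by
    induction x using gr_induction with
    | one => exact Submodule.subset_span ⟨[], rfl⟩
    | add x y hx hy => exact Submodule.add_mem _ hx hy
    | smul c x hx => exact Submodule.smul_mem _ c hx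
    | gen_mul s x hx =>
      induction hx using Submodule.span_induction with
      | mem x hx =>
        obtain ⟨l, rfl⟩ := hx
        exact Submodule.subset_span ⟨s :: l, by simp⟩
      | zero => simp
      | add x y _ _ hx hy => rw [mul_add]; exact Submodule.add_mem _ hx hy
      | smul c x _ hx => rw [mul_smul_comm]; exact Submodule.smul_mem _ c hx
  induction h using Submodule.span_induction with
  | mem x hx =>
    obtain ⟨l, rfl⟩ := hx
    exact word l
  | zero => simpa using smul 0 _ (word [])
  | add x y _ _ hx hy => exact add x y hx hy
  | smul c x _ hx => exact smul c x hx

theorem contraction_word (d : Module.Dual ℂ (S → ℂ)) (l : List S) :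
    contraction d (l.map (gen : S → Gr S)).prod =
      contractWord (fun s => d (Pi.single s 1)) (fun l' => (l'.map (gen : S → Gr S)).prod) l := by
  induction l with
  | nil => exact contraction_one d
  | cons s l ih =>
    have h2 := map_contractWord (LinearMap.mulLeft ℂ (gen s : Gr S))
      (fun s => d (Pi.single s 1)) (fun l' => (l'.map gen).prod) l
    simp only [LinearMap.mulLeft_apply] at h2
    rw [List.map_cons, List.prod_cons, contraction_gen_mul, ih, h2, contractWord]
    simp only [List.map_cons, List.prod_cons]

theorem subst_gen {T : Type*} (M : S → T → ℂ) (s : S) : subst M (gen s) = ExteriorAlgebra.ι ℂ (M s) := by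
  rw [subst, gen, ExteriorAlgebra.map_apply_ι, Fintype.linearCombination_apply_single, one_smul]

theorem subst_gen_single (f : S → T) (s : S) :
    subst (fun s => (Pi.single (f s) 1 : T → ℂ)) (gen s) = gen (f s) :=
  subst_gen _ s

theorem contraction_map {S T : Type*} (f : (S → ℂ) →ₗ[ℂ] (T → ℂ)) (d : Module.Dual ℂ (T → ℂ))
    (x : Gr S) : contraction d (ExteriorAlgebra.map f x) =
      ExteriorAlgebra.map f (contraction (d ∘ₗ f) x) := by
  induction x using CliffordAlgebra.left_induction with
  | algebraMap r =>
    rw [AlgHom.commutes]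
    have h1 := CliffordAlgebra.contractLeft_algebraMap (Q := (0 : QuadraticForm ℂ (T → ℂ))) d r
    have h2 := CliffordAlgebra.contractLeft_algebraMap (Q := (0 : QuadraticForm ℂ (S → ℂ)))
      (d ∘ₗ f) r
    rw [contraction, contraction, h2, map_zero]
    exact h1
  | add x y hx hy => rw [map_add, map_add, map_add, map_add, hx, hy]
  | ι_mul x m hx =>
    have h1 : ExteriorAlgebra.map f (CliffordAlgebra.ι 0 m * x) =
        ExteriorAlgebra.ι ℂ (f m) * ExteriorAlgebra.map f x := by
      rw [map_mul]
      congr 1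
      exact ExteriorAlgebra.map_apply_ι f m
    have h2 := contraction_ι_mul (d ∘ₗ f) m x
    rw [h1, contraction_ι_mul, hx]
    refine Eq.trans ?_ (congrArg _ h2.symm)
    rw [map_sub, map_smul, map_mul, ExteriorAlgebra.map_apply_ι]
    rfl

theorem gen_mul_gen (s t : S) : (gen s : Gr S) * gen t = -(gen t * gen s) :=
  eq_neg_of_add_eq_zero_left (ExteriorAlgebra.ι_add_mul_swap _ _)

/-- The even elements of a Grassmann algebra in the form in which they are used: central elements
through which contractions pass without a sign. -/
noncomputable def evenElements (S : Type*) : Subalgebra ℂ (Gr S) where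
  carrier := {q | (∀ x, q * x = x * q) ∧ ∀ (d : Module.Dual ℂ (S → ℂ)) (x : Gr S),
    contraction d (q * x) = contraction d q * x + q * contraction d x}
  mul_mem' {p q} hp hq := by
    refine ⟨fun x => by rw [mul_assoc, hq.1, ← mul_assoc, hp.1, mul_assoc], fun d x => ?_⟩
    rw [mul_assoc, hp.2, hq.2, hp.2]
    simp only [mul_add, add_mul, mul_assoc, add_assoc]
  add_mem' {p q} hp hq := by
    refine ⟨fun x => by rw [add_mul, mul_add, hp.1, hq.1], fun d x => ?_⟩
    rw [add_mul, map_add, hp.2, hq.2, map_add, add_mul, add_mul]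
    abel
  algebraMap_mem' r := by
    refine ⟨fun x => Algebra.commutes r x, fun d x => ?_⟩
    have h2 : contraction d (algebraMap ℂ (Gr S) r) = 0 :=
      CliffordAlgebra.contractLeft_algebraMap (Q := (0 : QuadraticForm ℂ (S → ℂ))) d r
    rw [h2, zero_mul, zero_add, Algebra.algebraMap_eq_smul_one, smul_mul_assoc, one_mul, map_smul,
      smul_mul_assoc, one_mul]

theorem ι_mul_ι_mem_evenElements {S : Type*} (u v : S → ℂ) :
    ExteriorAlgebra.ι ℂ u * ExteriorAlgebra.ι ℂ v ∈ evenElements S := by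
  have hanti : ∀ u v : S → ℂ, (ExteriorAlgebra.ι ℂ u * ExteriorAlgebra.ι ℂ v : Gr S) =
      -(ExteriorAlgebra.ι ℂ v * ExteriorAlgebra.ι ℂ u) := fun u v =>
    eq_neg_of_add_eq_zero_left (ExteriorAlgebra.ι_add_mul_swap _ _)
  refine ⟨fun x => ?_, fun d x => ?_⟩
  · induction x using CliffordAlgebra.left_induction with
    | algebraMap r => exact (Algebra.commutes r _).symm
    | add x y hx hy => rw [mul_add, add_mul, hx, hy]
    | ι_mul x m hx =>
      have h3 : (ExteriorAlgebra.ι ℂ u * ExteriorAlgebra.ι ℂ v * ExteriorAlgebra.ι ℂ m : Gr S) =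
          ExteriorAlgebra.ι ℂ m * (ExteriorAlgebra.ι ℂ u * ExteriorAlgebra.ι ℂ v) := by
        rw [mul_assoc, hanti v m, mul_neg, ← mul_assoc, hanti u m, neg_mul, neg_neg, mul_assoc]
      calc ExteriorAlgebra.ι ℂ u * ExteriorAlgebra.ι ℂ v * (ExteriorAlgebra.ι ℂ m * x)
          = ExteriorAlgebra.ι ℂ m * (ExteriorAlgebra.ι ℂ u * ExteriorAlgebra.ι ℂ v * x) := by
            rw [← mul_assoc, h3, mul_assoc]
        _ = ExteriorAlgebra.ι ℂ m * x * (ExteriorAlgebra.ι ℂ u * ExteriorAlgebra.ι ℂ v) := by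
            rw [hx, mul_assoc]
  · have h1 := contraction_ι_mul d u (ExteriorAlgebra.ι ℂ v)
    have h2 : contraction d (ExteriorAlgebra.ι ℂ v) = algebraMap ℂ (Gr S) (d v) :=
      CliffordAlgebra.contractLeft_ι _ d v
    rw [h2, ← Algebra.commutes, ← Algebra.smul_def] at h1
    rw [mul_assoc, contraction_ι_mul, contraction_ι_mul, h1]
    simp only [mul_sub, sub_mul, smul_mul_assoc, mul_smul_comm, mul_assoc]
    abel

theorem gen_mul_gen_mem_evenElements (s t : S) : (gen s : Gr S) * gen t ∈ evenElements S :=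
  ι_mul_ι_mem_evenElements _ _

/-- Words of even length are even elements. -/
theorem word_mem_evenElements (l : List S) (hl : Even l.length) :
    (l.map (gen : S → Gr S)).prod ∈ evenElements S := by
  obtain ⟨n, hn⟩ := hl
  induction n generalizing l with
  | zero =>
    have : l = [] := List.length_eq_zero_iff.1 (by omega)
    subst this
    simp
  | succ n ih =>
    match l, hn with
    | [], hn => simp at hn
    | [_], hn => simp at hn; omega
    | s :: t :: l, hn =>
      simp only [List.length_cons] at hn
      rw [List.map_cons, List.map_cons, List.prod_cons, List.prod_cons, ← mul_assoc]
      exact Subalgebra.mul_mem _ (gen_mul_gen_mem_evenElements s t) (ih l (by omega))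

/-- Chain rule for the exponential of an even nilpotent element. -/
theorem contraction_nilExp_mul {S : Type*} {q : Gr S} (hq : q ∈ evenElements S)
    (hn : IsNilpotent q) (d : Module.Dual ℂ (S → ℂ)) (x : Gr S) : contraction d (nilExp q * x) =
      contraction d q * (nilExp q * x) + nilExp q * contraction d x := by
  have hpow : ∀ n : ℕ, contraction d (q ^ (n + 1)) = ((n : ℂ) + 1) • (contraction d q * q ^ n) := by
    intro n
    induction n with
    | zero => simp
    | succ n ih =>
      rw [pow_succ', hq.2, ih, mul_smul_comm, ← mul_assoc, hq.1, mul_assoc, ← pow_succ']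
      push_cast
      rw [add_smul ((n : ℂ) + 1), one_smul, add_comm]
  have hE : contraction d (nilExp q) = contraction d q * nilExp q := by
    obtain ⟨k, hk⟩ := hn
    have h1 : q ^ (k + 1) = 0 := by rw [pow_succ, hk, zero_mul]
    have h2 : contraction d q * q ^ k = 0 := by rw [hk, mul_zero]
    conv_lhs => rw [nilExp_eq_sum h1]
    rw [nilExp_eq_sum hk, Finset.sum_range_succ', map_add, map_sum, Finset.mul_sum]
    simp only [pow_zero, map_smul, contraction_one, smul_zero, add_zero, hpow]
    refine Finset.sum_congr rfl fun n _ => ?_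
    rw [mul_smul_comm, smul_smul, Nat.factorial_succ]
    congr 1
    have : (n : ℂ) + 1 ≠ 0 := Nat.cast_add_one_ne_zero n
    push_cast
    field_simp
  rw [(nilExp_mem (evenElements S) hq).2, hE, mul_assoc]

theorem algebraMapInv_gen (s : S) : ExteriorAlgebra.algebraMapInv (gen s : Gr S) = 0 := by
  rw [gen, ExteriorAlgebra.algebraMapInv, ExteriorAlgebra.lift_ι_apply]
  rfl

theorem grExp_eq_nilExp {S : Type*} {a : Gr S} (h : ExteriorAlgebra.algebraMapInv a = 0) :
    grExp a = nilExp a := by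
  rw [grExp, h, Complex.exp_zero, one_smul, map_zero, sub_zero]

/-- Linear functionals that satisfy a homogeneous integration by parts formula vanish. -/
theorem eq_zero_of_contraction {M : Type*} [AddCommGroup M] [Module ℂ M] (j : Gr S →ₗ[ℂ] M)
    (h1 : j 1 = 0) (d : S → Module.Dual ℂ (S → ℂ))
    (h : ∀ s x, j (gen s * x) = j (contraction (d s) x)) (x : Gr S) : j x = 0 := by
  induction x using word_induction with
  | add x y hx hy => rw [map_add, hx, hy, add_zero]
  | smul c x hx => rw [map_smul, hx, smul_zero]
  | word l =>
    induction hn : l.length using Nat.strong_induction_on generalizing l with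
    | _ n ih =>
      match l, hn with
      | [], _ => exact h1
      | s :: l, hn =>
        rw [List.map_cons, List.prod_cons, h, contraction_word, map_contractWord]
        rw [contractWord_congr (s' := fun t => d s (Pi.single t 1)) (G := fun _ => (0 : M))
          (fun _ _ => rfl), contractWord_zero]
        intro l' hl' hlen
        exact ih l'.length (by simp at hn; omega) l' rfl

end Grassmann

/-! ### Integration by parts for Grassmann Gaussian integrals -/

section Berezin

variable {K T : Type*} [Fintype K] [DecidableEq K] [Fintype T] [DecidableEq T]

theorem grDeriv_mul_self {S : Type*} (s : S) : grDeriv s * grDeriv s = 0 :=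
  LinearMap.ext fun x => CliffordAlgebra.contractLeft_contractLeft _ x

theorem grDeriv_comm {S : Type*} (s t : S) (x : Gr S) :
    grDeriv s (grDeriv t x) = -grDeriv t (grDeriv s x) :=
  CliffordAlgebra.contractLeft_comm _ _ x

theorem commute_grDeriv_pair {S : Type*} (s t r : S) :
    Commute (grDeriv s * grDeriv t) (grDeriv r) := by
  refine LinearMap.ext fun x => ?_
  simp only [Module.End.mul_apply]
  rw [grDeriv_comm t r, map_neg, grDeriv_comm s r, neg_neg]

theorem list_prod_mul_eq_zero {R : Type*} [Ring R] (l : List R) (x : R)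
    (hc : ∀ y ∈ l, Commute y x) (h : ∃ y ∈ l, y * x = 0) : l.prod * x = 0 := by
  induction l with
  | nil => simp at h
  | cons y l ih =>
    obtain ⟨z, hz, hzx⟩ := h
    rw [List.prod_cons]
    rcases List.mem_cons.1 hz with rfl | hz
    · have : Commute l.prod x := Commute.list_prod_left _ _ fun w hw => hc w (by simp [hw])
      rw [mul_assoc, this.eq, ← mul_assoc, hzx, zero_mul]
    · rw [mul_assoc, ih (fun w hw => hc w (by simp [hw])) ⟨z, hz, hzx⟩, mul_zero]

/-- The Berezin integral of a derivative vanishes. -/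
theorem berezin_grDeriv (k : K ⊕ K) (G : Gr ((K ⊕ K) ⊕ T)) :
    berezin (grDeriv (Sum.inl k) G) = 0 := by
  have h := list_prod_mul_eq_zero ((Finset.univ : Finset K).toList.map fun i =>
      grDeriv (Sum.inl (Sum.inl i) : (K ⊕ K) ⊕ T) * grDeriv (Sum.inl (Sum.inr i)))
    (grDeriv (Sum.inl k))
    (by
      intro y hy
      simp only [List.mem_map] at hy
      obtain ⟨i, -, rfl⟩ := hy
      exact commute_grDeriv_pair _ _ _)
    (by
      rcases k with i | i
      · refine ⟨_, List.mem_map.2 ⟨i, by simp, rfl⟩, ?_⟩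
        refine LinearMap.ext fun x => ?_
        have h0 := LinearMap.congr_fun (grDeriv_mul_self (Sum.inl (Sum.inl i) : (K ⊕ K) ⊕ T))
          (grDeriv (Sum.inl (Sum.inr i)) x)
        simp only [Module.End.mul_apply] at h0 ⊢
        rw [grDeriv_comm (Sum.inl (Sum.inr i)), map_neg, h0]
        exact neg_zero
      · refine ⟨_, List.mem_map.2 ⟨i, by simp, rfl⟩, ?_⟩
        rw [mul_assoc, grDeriv_mul_self, mul_zero])
  rw [berezin, LinearMap.comp_apply]
  refine (congrArg _ (LinearMap.congr_fun h G)).trans ?_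
  exact map_zero _

theorem grDeriv_gen_mul {S : Type*} [DecidableEq S] (s t : S) (x : Gr S) :
    grDeriv s (gen t * x) = (if s = t then x else 0) - gen t * grDeriv s x := by
  have h := contraction_ι_mul (LinearMap.proj s) (Pi.single t 1) x
  refine Eq.trans h ?_
  congr 1
  by_cases hst : s = t
  · subst hst; simp
  · simp [hst]

theorem berezin_param_mul (t : T) (G : Gr ((K ⊕ K) ⊕ T)) :
    berezin (gen (Sum.inr t) * G) = gen t * berezin G := by
  have h : Commute ((Finset.univ : Finset K).toList.map fun i =>
      grDeriv (Sum.inl (Sum.inl i) : (K ⊕ K) ⊕ T) * grDeriv (Sum.inl (Sum.inr i))).prod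
      (LinearMap.mulLeft ℂ (gen (Sum.inr t))) := by
    refine Commute.list_prod_left _ _ fun y hy => ?_
    simp only [List.mem_map] at hy
    obtain ⟨i, -, rfl⟩ := hy
    refine LinearMap.ext fun x => ?_
    simp only [Module.End.mul_apply, LinearMap.mulLeft_apply]
    rw [grDeriv_gen_mul, if_neg (by simp), zero_sub, map_neg, grDeriv_gen_mul, if_neg (by simp),
      zero_sub, neg_neg]
  have h2 := LinearMap.congr_fun h.eq G
  simp only [Module.End.mul_apply, LinearMap.mulLeft_apply] at h2
  rw [berezin, LinearMap.comp_apply, h2, AlgHom.toLinearMap_apply, map_mul, subst_gen]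
  rfl

/-- The inclusion of the Grassmann algebra of the integration variables. -/
noncomputable def inclVars (K T : Type*) [Fintype K] [DecidableEq K] [DecidableEq T] :
    Gr (K ⊕ K) →ₐ[ℂ] Gr ((K ⊕ K) ⊕ T) :=
  subst fun s => Pi.single (Sum.inl s) 1

theorem inclVars_gen (s : K ⊕ K) : inclVars K T (gen s) = gen (Sum.inl s) :=
  subst_gen_single _ s

theorem contraction_inclVars (d : Module.Dual ℂ ((K ⊕ K) ⊕ T → ℂ)) (x : Gr (K ⊕ K)) :
    contraction d (inclVars K T x) = inclVars K T (contraction (d ∘ₗ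
      Fintype.linearCombination ℂ fun s => (Pi.single (Sum.inl s) 1 : (K ⊕ K) ⊕ T → ℂ)) x) :=
  contraction_map _ _ _

theorem berezin_inclVars (x : Gr (K ⊕ K)) :
    ∃ c : ℂ, berezin (inclVars K T x) = algebraMap ℂ (Gr T) c := by
  have h : ∀ (l : List (Module.End ℂ (Gr ((K ⊕ K) ⊕ T)))),
      (∀ y ∈ l, ∃ d d' : Module.Dual ℂ ((K ⊕ K) ⊕ T → ℂ), y = contraction d * contraction d') →
      ∃ x' : Gr (K ⊕ K), l.prod (inclVars K T x) = inclVars K T x' := by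
    intro l hl
    induction l with
    | nil => exact ⟨x, rfl⟩
    | cons y l ih =>
      obtain ⟨x', hx'⟩ := ih fun z hz => hl z (by simp [hz])
      obtain ⟨d, d', rfl⟩ := hl y (by simp)
      rw [List.prod_cons, Module.End.mul_apply, hx', Module.End.mul_apply, contraction_inclVars,
        contraction_inclVars]
      exact ⟨_, rfl⟩
  obtain ⟨x', hx'⟩ := h ((Finset.univ : Finset K).toList.map fun i =>
      grDeriv (Sum.inl (Sum.inl i) : (K ⊕ K) ⊕ T) * grDeriv (Sum.inl (Sum.inr i))) (by
    intro y hy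
    simp only [List.mem_map] at hy
    obtain ⟨i, -, rfl⟩ := hy
    exact ⟨_, _, rfl⟩)
  refine ⟨ExteriorAlgebra.algebraMapInv x', ?_⟩
  rw [berezin, LinearMap.comp_apply, hx', AlgHom.toLinearMap_apply]
  have h2 : (subst (Sum.elim (fun _ : K ⊕ K => (0 : T → ℂ)) fun t => Pi.single t 1)).comp
      (inclVars K T) = (Algebra.ofId ℂ (Gr T)).comp ExteriorAlgebra.algebraMapInv := by
    refine ExteriorAlgebra.hom_ext (LinearMap.pi_ext' fun s => LinearMap.ext_ring ?_)
    change subst _ (inclVars K T (gen s)) = algebraMap ℂ (Gr T) (ExteriorAlgebra.algebraMapInv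
      (gen s : Gr (K ⊕ K)))
    rw [inclVars_gen, subst_gen, algebraMapInv_gen, map_zero]
    exact map_zero _
  exact DFunLike.congr_fun h2 x'

/-- The Berezin integral does not vanish: it is one on the product of all `ψᵢ ψ̄ᵢ`. -/
theorem exists_berezin_eq_one :
    ∃ x : Gr (K ⊕ K), berezin (inclVars K T x) = (1 : Gr T) := by
  let dd : K → Module.End ℂ (Gr ((K ⊕ K) ⊕ T)) := fun i =>
    grDeriv (Sum.inl (Sum.inl i)) * grDeriv (Sum.inl (Sum.inr i))
  let pp : K → Gr (K ⊕ K) := fun i => gen (Sum.inr i) * gen (Sum.inl i)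
  have hpp : ∀ i, inclVars K T (pp i) = gen (Sum.inl (Sum.inr i)) * gen (Sum.inl (Sum.inl i)) := by
    intro i
    rw [map_mul, inclVars_gen, inclVars_gen]
  have hcomm : ∀ i j, i ≠ j → Commute (dd j) (LinearMap.mulLeft ℂ (inclVars K T (pp i))) := by
    intro i j hij
    have hji : j ≠ i := hij.symm
    rw [hpp]
    refine LinearMap.ext fun x => ?_
    simp only [dd, Module.End.mul_apply, LinearMap.mulLeft_apply, mul_assoc, grDeriv_gen_mul,
      Sum.inl.injEq, Sum.inr.injEq, hji, reduceCtorEq, if_false, zero_sub, mul_neg,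
      neg_neg]
  have hone : ∀ i, dd i (inclVars K T (pp i)) = 1 := by
    intro i
    rw [hpp, ← mul_one (gen (Sum.inl (Sum.inl i))), ← mul_assoc, mul_assoc]
    simp only [dd, Module.End.mul_apply, grDeriv_gen_mul]
    have h0 : ∀ s : (K ⊕ K) ⊕ T, grDeriv s (1 : Gr ((K ⊕ K) ⊕ T)) = 0 := fun s =>
      contraction_one _
    simp only [h0, mul_zero, sub_zero, reduceCtorEq, Sum.inl.injEq, if_false, if_true,
      grDeriv_gen_mul]
  have key : ∀ l : List K, l.Nodup → (l.map dd).prod (inclVars K T (l.map pp).prod) = 1 := by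
    intro l hl
    induction l with
    | nil => simp
    | cons i l ih =>
      rw [List.nodup_cons] at hl
      have hc : Commute (l.map dd).prod (LinearMap.mulLeft ℂ (inclVars K T (pp i))) := by
        refine Commute.list_prod_left _ _ fun y hy => ?_
        simp only [List.mem_map] at hy
        obtain ⟨j, hj, rfl⟩ := hy
        exact hcomm i j fun h => hl.1 (h ▸ hj)
      have h2 := LinearMap.congr_fun hc.eq (inclVars K T (l.map pp).prod)
      simp only [Module.End.mul_apply, LinearMap.mulLeft_apply] at h2
      rw [List.map_cons, List.map_cons, List.prod_cons, List.prod_cons, map_mul,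
        Module.End.mul_apply, h2, ih hl.2, mul_one, hone]
  refine ⟨((Finset.univ : Finset K).toList.map pp).prod, ?_⟩
  rw [berezin, LinearMap.comp_apply]
  refine (congrArg _ (key _ (Finset.nodup_toList _))).trans ?_
  exact map_one (subst _)

/-- The exponent `(ψ̄, M ψ)` of a Gaussian weight. -/
noncomputable def quadForm (ε : ℝ) (M : Matrix K K ℂ) : Gr (K ⊕ K) :=
  pairing ε (fun i => gen (Sum.inl i)) (matApply M fun i => gen (Sum.inr i))

theorem quadForm_eq (ε : ℝ) (M : Matrix K K ℂ) : quadForm ε M =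
    (ε : ℂ) • ∑ x, ∑ y, M x y • ((gen (Sum.inl x) : Gr (K ⊕ K)) * gen (Sum.inr y)) := by
  simp only [quadForm, pairing, matApply, Finset.mul_sum, mul_smul_comm]

theorem gen_mul_self {S : Type*} [DecidableEq S] (s : S) : (gen s : Gr S) * gen s = 0 :=
  ExteriorAlgebra.ι_sq_zero _

theorem isNilpotent_quadForm (ε : ℝ) (M : Matrix K K ℂ) : IsNilpotent (quadForm ε M) := by
  rw [quadForm_eq]
  refine IsNilpotent.smul (Commute.isNilpotent_sum (fun x _ => Commute.isNilpotent_sum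
    (fun y _ => IsNilpotent.smul ⟨2, ?_⟩ _) fun y y' _ _ => ?_) fun x x' _ _ => ?_) _
  · have h := (gen_mul_gen_mem_evenElements (Sum.inl x : K ⊕ K) (Sum.inr y)).1 (gen (Sum.inl x))
    rw [pow_two, ← mul_assoc, h, ← mul_assoc, gen_mul_self, zero_mul, zero_mul]
  · exact (Subalgebra.smul_mem _ (gen_mul_gen_mem_evenElements (S := K ⊕ K) _ _) _).1 _
  · exact (Subalgebra.sum_mem (evenElements (K ⊕ K)) fun y _ => Subalgebra.smul_mem _
      (gen_mul_gen_mem_evenElements (Sum.inl x : K ⊕ K) (Sum.inr y)) _).1 _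

theorem gaussWeight_eq (ε : ℝ) (C : Matrix K K ℂ) :
    gaussWeight (T := T) ε C = inclVars K T (nilExp (quadForm ε C⁻¹)) := by
  have h : pairing ε (fun i => gen (Sum.inl (Sum.inl i)))
      (matApply C⁻¹ fun i => gen (Sum.inl (Sum.inr i))) = inclVars K T (quadForm ε C⁻¹) := by
    simp only [quadForm, pairing, matApply, map_smul, map_sum, map_mul, inclVars_gen]
  rw [gaussWeight, h, map_nilExp _ (isNilpotent_quadForm ε _), grExp_eq_nilExp]
  rw [quadForm_eq, map_smul, map_smul, map_sum, map_sum, Finset.sum_eq_zero, smul_zero]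
  intro x _
  simp [inclVars_gen, algebraMapInv_gen]

/-- The unnormalised Gaussian integral. -/
noncomputable def gaussRaw (T : Type*) [Fintype T] [DecidableEq T] (ε : ℝ) (C : Matrix K K ℂ) :
    Gr ((K ⊕ K) ⊕ T) →ₗ[ℂ] Gr T :=
  berezin ∘ₗ LinearMap.mulLeft ℂ (gaussWeight ε C)

theorem gaussWeight_mem_even (ε : ℝ) (C : Matrix K K ℂ) :
    gaussWeight (T := T) ε C ∈ evenElements ((K ⊕ K) ⊕ T) := by
  rw [gaussWeight_eq, map_nilExp _ (isNilpotent_quadForm ε _)]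
  refine nilExp_mem _ ?_
  rw [quadForm_eq, map_smul, map_sum]
  refine Subalgebra.smul_mem _ (Subalgebra.sum_mem _ fun x _ => ?_) _
  rw [map_sum]
  refine Subalgebra.sum_mem _ fun y _ => ?_
  rw [map_smul, map_mul, inclVars_gen, inclVars_gen]
  exact Subalgebra.smul_mem _ (gen_mul_gen_mem_evenElements _ _) _

/-- Integration by parts: the Berezin integral of the derivative of the weight times `G` vanishes. -/
theorem gaussRaw_grDeriv (ε : ℝ) (C : Matrix K K ℂ) (k : K ⊕ K) (G : Gr ((K ⊕ K) ⊕ T)) :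
    gaussRaw T ε C (inclVars K T (grDeriv k (quadForm ε C⁻¹)) * G) =
      -gaussRaw T ε C (grDeriv (Sum.inl k) G) := by
  have h0 := berezin_grDeriv k (gaussWeight ε C * G)
  have hq : inclVars K T (quadForm ε C⁻¹) ∈ evenElements ((K ⊕ K) ⊕ T) := by
    rw [quadForm_eq, map_smul, map_sum]
    refine Subalgebra.smul_mem _ (Subalgebra.sum_mem _ fun x _ => ?_) _
    rw [map_sum]
    refine Subalgebra.sum_mem _ fun y _ => ?_
    rw [map_smul, map_mul, inclVars_gen, inclVars_gen]
    exact Subalgebra.smul_mem _ (gen_mul_gen_mem_evenElements _ _) _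
  have h1 := contraction_nilExp_mul hq ((isNilpotent_quadForm ε C⁻¹).map _)
    (LinearMap.proj (Sum.inl k)) G
  rw [← map_nilExp _ (isNilpotent_quadForm ε _), ← gaussWeight_eq, contraction_inclVars] at h1
  have hd : (LinearMap.proj (Sum.inl k) : Module.Dual ℂ ((K ⊕ K) ⊕ T → ℂ)) ∘ₗ
      (Fintype.linearCombination ℂ fun s => (Pi.single (Sum.inl s) 1 : (K ⊕ K) ⊕ T → ℂ)) =
      LinearMap.proj k := by
    refine LinearMap.pi_ext' fun s => LinearMap.ext_ring ?_
    simp only [LinearMap.comp_apply, LinearMap.single_apply,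
      Fintype.linearCombination_apply_single, one_smul, LinearMap.proj_apply]
    by_cases h : k = s
    · subst h; simp
    · simp [h]
  rw [hd] at h1
  have h2 : berezin (contraction (LinearMap.proj (Sum.inl k)) (gaussWeight ε C * G)) =
      (0 : Gr T) := h0
  rw [h1, map_add] at h2
  rw [gaussRaw, LinearMap.comp_apply, LinearMap.comp_apply, LinearMap.mulLeft_apply,
    LinearMap.mulLeft_apply, ← mul_assoc, (gaussWeight_mem_even ε C).1, mul_assoc]
  exact eq_neg_of_add_eq_zero_left h2

theorem grDeriv_bar_quadForm (ε : ℝ) (M : Matrix K K ℂ) (j : K) :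
    grDeriv (Sum.inl j) (quadForm ε M) = (ε : ℂ) • ∑ y, M j y • (gen (Sum.inr y) : Gr (K ⊕ K)) := by
  have h0 : ∀ s t : K ⊕ K, grDeriv s (gen t) = if s = t then (1 : Gr (K ⊕ K)) else 0 := by
    intro s t
    have := grDeriv_gen_mul s t (1 : Gr (K ⊕ K))
    have h1 : grDeriv s (1 : Gr (K ⊕ K)) = 0 := contraction_one _
    rwa [h1, mul_zero, sub_zero, mul_one] at this
  rw [quadForm_eq]
  simp only [map_smul, map_sum, grDeriv_gen_mul, h0]
  congr 1
  rw [Finset.sum_eq_single j]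
  · simp
  · intro x _ hx
    simp [hx.symm]
  · simp

theorem grDeriv_quadForm (ε : ℝ) (M : Matrix K K ℂ) (j : K) :
    grDeriv (Sum.inr j) (quadForm ε M) =
      -((ε : ℂ) • ∑ x, M x j • (gen (Sum.inl x) : Gr (K ⊕ K))) := by
  have h0 : ∀ s t : K ⊕ K, grDeriv s (gen t) = if s = t then (1 : Gr (K ⊕ K)) else 0 := by
    intro s t
    have := grDeriv_gen_mul s t (1 : Gr (K ⊕ K))
    have h1 : grDeriv s (1 : Gr (K ⊕ K)) = 0 := contraction_one _
    rwa [h1, mul_zero, sub_zero, mul_one] at this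
  rw [quadForm_eq]
  simp only [map_smul, map_sum, grDeriv_gen_mul, h0]
  rw [← smul_neg, ← Finset.sum_neg_distrib]
  congr 1
  refine Finset.sum_congr rfl fun x _ => ?_
  rw [Finset.sum_eq_single j]
  · simp
  · intro y _ hy
    simp [hy.symm]
  · simp

/-- The functional by which a variable contracts with the others, for covariance `C`. -/
noncomputable def covDual (ε : ℝ) (C : Matrix K K ℂ) : K ⊕ K → Module.Dual ℂ (K ⊕ K → ℂ)
  | Sum.inl p => (ε : ℂ)⁻¹ • ∑ q, C q p • LinearMap.proj (Sum.inr q)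
  | Sum.inr p => -((ε : ℂ)⁻¹ • ∑ q, C p q • LinearMap.proj (Sum.inl q))

theorem sum_smul_sum_smul {M : Type*} [AddCommGroup M] [Module ℂ M] {A B : Matrix K K ℂ}
    (h : B * A = 1) (J : K → M) (p : K) : ∑ q, A q p • ∑ x, B x q • J x = J p := by
  have h3 : ∀ x, ∑ q, A q p * B x q = if x = p then 1 else 0 := by
    intro x
    rw [← Matrix.one_apply, ← h, Matrix.mul_apply]
    simp only [mul_comm]
  simp only [Finset.smul_sum, smul_smul]
  rw [Finset.sum_comm]
  simp only [← Finset.sum_smul, h3]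
  simp

/-- Integration by parts for the variables. -/
theorem gaussRaw_gen_mul {ε : ℝ} (hε : 0 < ε) {C : Matrix K K ℂ} (hC : IsUnit C.det) (k : K ⊕ K)
    (G : Gr ((K ⊕ K) ⊕ T)) : gaussRaw T ε C (gen (Sum.inl k) * G) =
      gaussRaw T ε C (contraction (covDual ε C k ∘ₗ LinearMap.funLeft ℂ ℂ Sum.inl) G) := by
  have hε' : (ε : ℂ) ≠ 0 := Complex.ofReal_ne_zero.2 hε.ne'
  rcases k with p | p
  · have h1 : ∀ q, gaussRaw T ε C (grDeriv (Sum.inl (Sum.inr q)) G) =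
        (ε : ℂ) • ∑ x, C⁻¹ x q • gaussRaw T ε C (gen (Sum.inl (Sum.inl x)) * G) := by
      intro q
      have := gaussRaw_grDeriv ε C (Sum.inr q) G
      rw [grDeriv_quadForm, map_neg, neg_mul, map_neg, neg_inj, map_smul, map_sum, smul_mul_assoc,
        Finset.sum_mul, map_smul, map_sum] at this
      rw [← this]
      simp only [map_smul, smul_mul_assoc, inclVars_gen]
    have h4 : covDual ε C (Sum.inl p) ∘ₗ LinearMap.funLeft ℂ ℂ Sum.inl = (ε : ℂ)⁻¹ •
        ∑ q, C q p • (LinearMap.proj (Sum.inl (Sum.inr q)) :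
          Module.Dual ℂ ((K ⊕ K) ⊕ T → ℂ)) := by
      refine LinearMap.ext fun u => ?_
      simp [covDual]
    have h5 : contraction (covDual ε C (Sum.inl p) ∘ₗ LinearMap.funLeft ℂ ℂ Sum.inl) G =
        (ε : ℂ)⁻¹ • ∑ q, C q p • grDeriv (Sum.inl (Sum.inr q)) G := by
      rw [h4]
      simp only [contraction, map_smul, map_sum, LinearMap.smul_apply, LinearMap.sum_apply]
      rfl
    rw [h5, map_smul, map_sum]
    simp only [map_smul, h1, smul_comm _ (ε : ℂ)]
    rw [← Finset.smul_sum, smul_smul, inv_mul_cancel₀ hε', one_smul,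
      sum_smul_sum_smul (Matrix.nonsing_inv_mul C hC)
        (fun x => gaussRaw T ε C (gen (Sum.inl (Sum.inl x)) * G))]
  · have h1 : ∀ q, gaussRaw T ε C (grDeriv (Sum.inl (Sum.inl q)) G) =
        -((ε : ℂ) • ∑ x, C⁻¹ q x • gaussRaw T ε C (gen (Sum.inl (Sum.inr x)) * G)) := by
      intro q
      have := gaussRaw_grDeriv ε C (Sum.inl q) G
      rw [grDeriv_bar_quadForm, map_smul, map_sum, smul_mul_assoc,
        Finset.sum_mul, map_smul, map_sum] at this
      rw [← neg_eq_iff_eq_neg, ← this]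
      simp only [map_smul, smul_mul_assoc, inclVars_gen]
    have h4 : covDual ε C (Sum.inr p) ∘ₗ LinearMap.funLeft ℂ ℂ Sum.inl = -((ε : ℂ)⁻¹ •
        ∑ q, C p q • (LinearMap.proj (Sum.inl (Sum.inl q)) :
          Module.Dual ℂ ((K ⊕ K) ⊕ T → ℂ))) := by
      refine LinearMap.ext fun u => ?_
      simp [covDual]
    have h5 : contraction (covDual ε C (Sum.inr p) ∘ₗ LinearMap.funLeft ℂ ℂ Sum.inl) G =
        -((ε : ℂ)⁻¹ • ∑ q, C p q • grDeriv (Sum.inl (Sum.inl q)) G) := by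
      rw [h4]
      simp only [contraction, map_neg, map_smul, map_sum, LinearMap.neg_apply,
        LinearMap.smul_apply, LinearMap.sum_apply]
      rfl
    have h6 : (C⁻¹).transpose * C.transpose = 1 := by
      rw [← Matrix.transpose_mul, Matrix.mul_nonsing_inv C hC, Matrix.transpose_one]
    have h7 := sum_smul_sum_smul h6 (fun x => gaussRaw T ε C (gen (Sum.inl (Sum.inr x)) * G)) p
    simp only [Matrix.transpose_apply] at h7
    rw [h5, map_neg, map_smul, map_sum]
    simp only [map_smul, h1, smul_neg, Finset.sum_neg_distrib, neg_neg, smul_comm _ (ε : ℂ)]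
    rw [← Finset.smul_sum, smul_smul, inv_mul_cancel₀ hε', one_smul, h7]

theorem comp_funLeft_comp_single {K T : Type*} [Fintype K] [DecidableEq K] [DecidableEq T]
    (d : Module.Dual ℂ (K → ℂ)) (M : K → K ⊕ T → ℂ) (hM : ∀ s t, M s (Sum.inl t) = (Pi.single s 1 : K → ℂ) t) :
    (d ∘ₗ LinearMap.funLeft ℂ ℂ Sum.inl) ∘ₗ Fintype.linearCombination ℂ M = d := by
  refine LinearMap.pi_ext' fun s => LinearMap.ext_ring ?_
  simp only [LinearMap.comp_apply, LinearMap.single_apply, Fintype.linearCombination_apply_single,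
    one_smul]
  congr 1
  ext t
  exact hM s t

/-- The Gaussian weight has nonzero total mass: otherwise integration by parts would make the
integral of every polynomial vanish, and since the weight is invertible, so would the Berezin
integral. -/
theorem gauss_normalisation_ne_zero {ε : ℝ} (hε : 0 < ε) {C : Matrix K K ℂ} (hC : IsUnit C.det) :
    ExteriorAlgebra.algebraMapInv (berezin (gaussWeight (T := T) ε C)) ≠ 0 := by
  intro h0
  obtain ⟨c, hc⟩ := berezin_inclVars (T := T) (nilExp (quadForm ε C⁻¹))
  rw [← gaussWeight_eq] at hc
  have hc0 : c = 0 := by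
    rw [hc] at h0
    rwa [ExteriorAlgebra.algebraMap_leftInverse] at h0
  rw [hc0, map_zero] at hc
  have h1 := eq_zero_of_contraction (gaussRaw T ε C ∘ₗ (inclVars K T).toLinearMap)
    (by simpa [gaussRaw] using hc) (covDual ε C) (fun s x => by
      simp only [LinearMap.comp_apply, AlgHom.toLinearMap_apply]
      rw [map_mul, inclVars_gen, gaussRaw_gen_mul hε hC, contraction_inclVars,
        comp_funLeft_comp_single]
      intro s t
      by_cases hst : t = s
      · subst hst; simp
      · simp [hst])
  obtain ⟨x, hx⟩ := exists_berezin_eq_one (K := K) (T := T)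
  have h2 := h1 (nilExp (-quadForm ε C⁻¹) * x)
  simp only [LinearMap.comp_apply, AlgHom.toLinearMap_apply, gaussRaw, LinearMap.mulLeft_apply] at h2
  rw [gaussWeight_eq, ← map_mul, ← mul_assoc, nilExp_mul_neg (isNilpotent_quadForm ε _), one_mul,
    hx] at h2
  exact one_ne_zero h2

theorem gaussInt_one {ε : ℝ} (hε : 0 < ε) {C : Matrix K K ℂ} (hC : IsUnit C.det) :
    gaussInt ε C (1 : Gr ((K ⊕ K) ⊕ T)) = 1 := by
  have h0 := gauss_normalisation_ne_zero (T := T) hε hC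
  obtain ⟨c, hc⟩ := berezin_inclVars (T := T) (nilExp (quadForm ε C⁻¹))
  rw [← gaussWeight_eq] at hc
  rw [gaussInt, mul_one, hc]
  rw [hc, ExteriorAlgebra.algebraMap_leftInverse] at h0
  rw [ExteriorAlgebra.algebraMap_leftInverse, Algebra.algebraMap_eq_smul_one, smul_smul,
    inv_mul_cancel₀ h0, one_smul]

/-- The Gaussian convolution, evaluated at linear combinations `η` of generators, as a linear
map. -/
noncomputable def gaussEval {X : Type*} (ε : ℝ) (C : Matrix K K ℂ) (η : K ⊕ K → X → ℂ) :
    Gr (K ⊕ K) →ₗ[ℂ] Gr X :=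
  (subst η).toLinearMap ∘ₗ
    ((ExteriorAlgebra.algebraMapInv (berezin (gaussWeight (T := K ⊕ K) ε C)))⁻¹ •
      gaussRaw (K ⊕ K) ε C) ∘ₗ
    (subst (fun s : K ⊕ K =>
      (Pi.single (Sum.inl s) 1 + Pi.single (Sum.inr s) 1 : (K ⊕ K) ⊕ (K ⊕ K) → ℂ))).toLinearMap

theorem gaussEval_apply {X : Type*} (ε : ℝ) (C : Matrix K K ℂ) (η : K ⊕ K → X → ℂ)
    (F : Gr (K ⊕ K)) : gaussEval ε C η F = subst η (gaussConv ε C F) := rfl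

theorem gaussEval_one {X : Type*} {ε : ℝ} (hε : 0 < ε) {C : Matrix K K ℂ} (hC : IsUnit C.det)
    (η : K ⊕ K → X → ℂ) : gaussEval ε C η 1 = 1 := by
  rw [gaussEval_apply, gaussConv, map_one, gaussInt_one hε hC, map_one]

theorem gaussRaw_param_mul (ε : ℝ) (C : Matrix K K ℂ) (t : T) (G : Gr ((K ⊕ K) ⊕ T)) :
    gaussRaw T ε C (gen (Sum.inr t) * G) = gen t * gaussRaw T ε C G := by
  simp only [gaussRaw, LinearMap.comp_apply, LinearMap.mulLeft_apply]
  rw [← mul_assoc, (gaussWeight_mem_even ε C).1, mul_assoc, berezin_param_mul]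

/-- The recursion that determines Gaussian convolutions: a variable is either replaced by its shift
or contracted with another variable. -/
theorem gaussEval_gen_mul {X : Type*} {ε : ℝ} (hε : 0 < ε) {C : Matrix K K ℂ} (hC : IsUnit C.det)
    (η : K ⊕ K → X → ℂ) (s : K ⊕ K) (F : Gr (K ⊕ K)) : gaussEval ε C η (gen s * F) =
      ExteriorAlgebra.ι ℂ (η s) * gaussEval ε C η F +
        gaussEval ε C η (contraction (covDual ε C s) F) := by
  set M : K ⊕ K → (K ⊕ K) ⊕ (K ⊕ K) → ℂ := fun s =>
    Pi.single (Sum.inl s) 1 + Pi.single (Sum.inr s) 1 with hM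
  have h1 : subst M (gen s * F) =
      gen (Sum.inl s) * subst M F + gen (Sum.inr s) * subst M F := by
    rw [map_mul, subst_gen, hM, map_add, add_mul]
    rfl
  have h2 : contraction (covDual ε C s ∘ₗ LinearMap.funLeft ℂ ℂ Sum.inl) (subst M F) =
      subst M (contraction (covDual ε C s) F) := by
    rw [subst, contraction_map, comp_funLeft_comp_single]
    intro s t
    by_cases hst : t = s
    · subst hst; simp [hM]
    · simp [hM, hst]
  simp only [gaussEval, LinearMap.comp_apply, AlgHom.toLinearMap_apply, LinearMap.smul_apply]
  rw [h1, map_add, gaussRaw_gen_mul hε hC, gaussRaw_param_mul, h2, smul_add, map_add, add_comm,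
    ← mul_smul_comm, map_mul, subst_gen]

end Berezin

/-! ### Operators with Grassmann coefficients -/

section Source

variable {I : Type*} [LinearOrder I] [Fintype I]

/-- The parity grading of the Grassmann algebra of the sources. -/
noncomputable abbrev grGrade (I : Type*) : ZMod 2 → Submodule ℂ (Gr (I ⊕ I)) :=
  CliffordAlgebra.evenOdd (0 : QuadraticForm ℂ (I ⊕ I → ℂ))

/-- The pure tensor `c A`. -/
noncomputable def srcTmul (c : Gr (I ⊕ I)) (A : Op I) : SourceOp I :=
  GradedTensorProduct.tmul ℂ c A

/-- `srcOp` as an algebra homomorphism. -/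
noncomputable def srcHom (I : Type*) [LinearOrder I] [Fintype I] : Gr (I ⊕ I) →ₐ[ℂ] SourceOp I :=
  GradedTensorProduct.includeLeft (grGrade I) (opGrade I)

/-- `liftOp` as an algebra homomorphism. -/
noncomputable def liftHom (I : Type*) [LinearOrder I] [Fintype I] : Op I →ₐ[ℂ] SourceOp I :=
  GradedTensorProduct.includeRight (grGrade I) (opGrade I)

/-- `srcTrace` as a linear map. -/
noncomputable def srcTraceLin (I : Type*) [LinearOrder I] [Fintype I] :
    SourceOp I →ₗ[ℂ] Gr (I ⊕ I) :=
  (TensorProduct.rid ℂ (Gr (I ⊕ I))).toLinearMap ∘ₗ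
    (LinearMap.lTensor (Gr (I ⊕ I)) (Matrix.traceLinearMap (Finset I) ℂ ℂ)) ∘ₗ
      (GradedTensorProduct.of ℂ (grGrade I) (opGrade I)).symm.toLinearMap

theorem srcTrace_tmul (c : Gr (I ⊕ I)) (A : Op I) : srcTraceLin I (srcTmul c A) = A.trace • c := rfl

theorem srcHom_eq (c : Gr (I ⊕ I)) : srcHom I c = srcTmul c 1 := rfl

theorem liftHom_eq (A : Op I) : liftHom I A = srcTmul 1 A := rfl

theorem srcTmul_mul {i j : ZMod 2} (a₁ : Gr (I ⊕ I)) {b₁ : Op I} (hb : b₁ ∈ opGrade I j)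
    {a₂ : Gr (I ⊕ I)} (ha : a₂ ∈ grGrade I i) (b₂ : Op I) :
    srcTmul a₁ b₁ * srcTmul a₂ b₂ = (-1 : ℤˣ) ^ (j * i) • srcTmul (a₁ * a₂) (b₁ * b₂) :=
  GradedTensorProduct.tmul_coe_mul_coe_tmul (grGrade I) (opGrade I) a₁ ⟨b₁, hb⟩ ⟨a₂, ha⟩ b₂

theorem srcHom_mul_liftHom (c : Gr (I ⊕ I)) (A : Op I) : srcHom I c * liftHom I A = srcTmul c A :=
  GradedTensorProduct.tmul_one_mul_one_tmul (grGrade I) (opGrade I) c A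

theorem op_induction {P : Op I → Prop} (add : ∀ A B, P A → P B → P (A + B))
    (hom : ∀ j, ∀ A ∈ opGrade I j, P A) (A : Op I) : P A := by
  have h : A = evenPart A + oddPart A := by
    rw [evenPart_coe, oddPart_coe, ← smul_add, add_add_sub_cancel, ← two_smul ℂ A, smul_smul]
    norm_num
  rw [h]
  exact add _ _ (hom 0 _ (evenPart A).2) (hom 1 _ (oddPart A).2)

theorem source_induction {P : SourceOp I → Prop} (add : ∀ X Y, P X → P Y → P (X + Y))
    (tmul : ∀ i j, ∀ c ∈ grGrade I i, ∀ A ∈ opGrade I j, P (srcTmul c A)) (X : SourceOp I) :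
    P X := by
  have zero : P 0 := by
    have h := tmul 0 0 0 (Submodule.zero_mem _) 0 (Submodule.zero_mem _)
    have h0 : srcTmul (0 : Gr (I ⊕ I)) (0 : Op I) = 0 := TensorProduct.zero_tmul _ _
    rwa [h0] at h
  have h1 : ∀ (c : Gr (I ⊕ I)) (A : Op I), P (srcTmul c A) := by
    intro c A
    induction A using op_induction with
    | add A B hA hB =>
      have : srcTmul c (A + B) = srcTmul c A + srcTmul c B := TensorProduct.tmul_add _ _ _
      rw [this]
      exact add _ _ hA hB
    | hom j A hA =>
      induction c using DirectSum.Decomposition.inductionOn (grGrade I) with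
      | zero =>
        have h0 : srcTmul (0 : Gr (I ⊕ I)) A = 0 := TensorProduct.zero_tmul _ _
        rwa [h0]
      | homogeneous c => exact tmul _ j _ c.2 A hA
      | add c c' hc hc' =>
        have : srcTmul (c + c') A = srcTmul c A + srcTmul c' A := TensorProduct.add_tmul _ _ _
        rw [this]
        exact add _ _ hc hc'
  exact TensorProduct.induction_on (motive := P) X zero h1 add

theorem srcTrace_src_mul (c : Gr (I ⊕ I)) (X : SourceOp I) :
    srcTraceLin I (srcHom I c * X) = c * srcTraceLin I X := by
  induction X using source_induction with
  | add X Y hX hY => rw [mul_add, map_add, map_add, mul_add, hX, hY]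
  | tmul i j c' hc' A hA =>
    rw [← srcHom_mul_liftHom, ← mul_assoc, ← map_mul, srcHom_mul_liftHom, srcHom_mul_liftHom,
      srcTrace_tmul, srcTrace_tmul, mul_smul_comm]

theorem zmod_two_cases (i : ZMod 2) : i = 0 ∨ i = 1 := by
  revert i
  decide

theorem trace_odd {A : Op I} (hA : A ∈ opGrade I 1) : A.trace = 0 := by
  have h1 : A = -(parity I * (A * parity I)) := by
    rw [← mul_assoc, mem_opGrade_one.1 hA, neg_mul, mul_assoc, parity_mul_self, mul_one, neg_neg]
  have h2 : A.trace = -A.trace := by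
    conv_lhs => rw [h1, Matrix.trace_neg, Matrix.trace_mul_comm, mul_assoc, parity_mul_self, mul_one]
  linear_combination (1 / 2 : ℂ) * h2

/-- Elements of given total parity. -/
noncomputable def totalGrade (I : Type*) [LinearOrder I] [Fintype I] (p : ZMod 2) :
    Submodule ℂ (SourceOp I) :=
  Submodule.span ℂ {X | ∃ i j, i + j = p ∧ ∃ c ∈ grGrade I i, ∃ A ∈ opGrade I j, X = srcTmul c A}

theorem totalGrade_induction {p : ZMod 2} {P : SourceOp I → Prop}
    (add : ∀ X Y, P X → P Y → P (X + Y)) (smul : ∀ (c : ℂ) X, P X → P (c • X))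
    (tmul : ∀ i j, i + j = p → ∀ c ∈ grGrade I i, ∀ A ∈ opGrade I j, P (srcTmul c A))
    {X : SourceOp I} (hX : X ∈ totalGrade I p) : P X := by
  induction hX using Submodule.span_induction with
  | mem X hX =>
    obtain ⟨i, j, hij, c, hc, A, hA, rfl⟩ := hX
    exact tmul i j hij c hc A hA
  | zero =>
    have h := smul 0 _ (tmul 0 p (zero_add p) 0 (Submodule.zero_mem _) 0 (Submodule.zero_mem _))
    rwa [zero_smul] at h
  | add X Y _ _ hX hY => exact add X Y hX hY
  | smul c X _ hX => exact smul c X hX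

theorem srcTmul_mem {i j : ZMod 2} {c : Gr (I ⊕ I)} (hc : c ∈ grGrade I i) {A : Op I}
    (hA : A ∈ opGrade I j) : srcTmul c A ∈ totalGrade I (i + j) :=
  Submodule.subset_span ⟨i, j, rfl, c, hc, A, hA, rfl⟩

theorem one_mem_grGrade : (1 : Gr (I ⊕ I)) ∈ grGrade I 0 := SetLike.GradedOne.one_mem

theorem one_mem_opGrade : (1 : Op I) ∈ opGrade I 0 := SetLike.GradedOne.one_mem

theorem liftHom_mem {j : ZMod 2} {A : Op I} (hA : A ∈ opGrade I j) :
    liftHom I A ∈ totalGrade I j := by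
  have := srcTmul_mem one_mem_grGrade hA
  rwa [zero_add] at this

theorem srcHom_mem {i : ZMod 2} {c : Gr (I ⊕ I)} (hc : c ∈ grGrade I i) :
    srcHom I c ∈ totalGrade I i := by
  have := srcTmul_mem hc one_mem_opGrade
  rwa [add_zero] at this

theorem ι_mem_grGrade (u : I ⊕ I → ℂ) : ExteriorAlgebra.ι ℂ u ∈ grGrade I 1 :=
  CliffordAlgebra.ι_mem_evenOdd_one _ u

theorem neg_one_units_smul {M : Type*} [AddCommGroup M] (x : M) : (-1 : ℤˣ) • x = -x := by
  simp

theorem units_smul_mem (s : ℤˣ) {p : ZMod 2} {X : SourceOp I} (hX : X ∈ totalGrade I p) :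
    s • X ∈ totalGrade I p := by
  rcases Int.units_eq_one_or s with rfl | rfl
  · rwa [one_smul]
  · rw [neg_one_units_smul]
    exact Submodule.neg_mem _ hX

theorem totalGrade_mul {p q : ZMod 2} {X Y : SourceOp I} (hX : X ∈ totalGrade I p)
    (hY : Y ∈ totalGrade I q) : X * Y ∈ totalGrade I (p + q) := by
  refine totalGrade_induction (P := fun X => X * Y ∈ totalGrade I (p + q)) ?_ ?_ ?_ hX
  · intro X X' hX hX'
    rw [add_mul]
    exact Submodule.add_mem _ hX hX'
  · intro c X hX
    rw [smul_mul_assoc]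
    exact Submodule.smul_mem _ _ hX
  · intro i j hij c hc A hA
    refine totalGrade_induction (P := fun Y => srcTmul c A * Y ∈ totalGrade I (p + q)) ?_ ?_ ?_ hY
    · intro Y Y' hY hY'
      rw [mul_add]
      exact Submodule.add_mem _ hY hY'
    · intro c Y hY
      rw [mul_smul_comm]
      exact Submodule.smul_mem _ _ hY
    · intro i' j' hij' c' hc' A' hA'
      rw [srcTmul_mul c hA hc' A']
      refine units_smul_mem _ ?_
      have := srcTmul_mem (SetLike.mul_mem_graded hc hc') (SetLike.mul_mem_graded hA hA')
      rwa [show i + i' + (j + j') = p + q by rw [← hij, ← hij']; ring] at this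

theorem one_mem_totalGrade : (1 : SourceOp I) ∈ totalGrade I 0 := by
  rw [← map_one (liftHom I)]
  exact liftHom_mem one_mem_opGrade

theorem prod_mem_totalGrade (l : List (SourceOp I)) (hl : ∀ X ∈ l, X ∈ totalGrade I 1) :
    l.prod ∈ totalGrade I (l.length : ZMod 2) := by
  induction l with
  | nil => simpa using one_mem_totalGrade
  | cons X l ih =>
    rw [List.prod_cons, List.length_cons, Nat.cast_add, Nat.cast_one, add_comm]
    exact totalGrade_mul (hl X (by simp)) (ih fun Y hY => hl Y (by simp [hY]))

/-- The elements of total parity zero, as a subalgebra. -/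
noncomputable def evenSource (I : Type*) [LinearOrder I] [Fintype I] :
    Subalgebra ℂ (SourceOp I) where
  carrier := totalGrade I 0
  mul_mem' hX hY := by
    have := totalGrade_mul hX hY
    rwa [add_zero] at this
  add_mem' hX hY := Submodule.add_mem _ hX hY
  algebraMap_mem' r := by
    rw [Algebra.algebraMap_eq_smul_one]
    exact Submodule.smul_mem _ _ one_mem_totalGrade

theorem negOne_uzpow_cast (n : ℕ) : (-1 : ℤˣ) ^ (n : ZMod 2) = (-1) ^ n :=
  uzpow_natCast _ _

/-- Odd linear sources anticommute with odd elements and commute with even ones. -/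
theorem mul_srcHom_ι {n : ℕ} {X : SourceOp I} (hX : X ∈ totalGrade I (n : ZMod 2))
    (u : I ⊕ I → ℂ) : X * srcHom I (ExteriorAlgebra.ι ℂ u) =
      (-1 : ℂ) ^ n • (srcHom I (ExteriorAlgebra.ι ℂ u) * X) := by
  have hgr : ∀ i, ∀ c ∈ grGrade I i, (c * ExteriorAlgebra.ι ℂ u : Gr (I ⊕ I)) =
      (-1 : ℤˣ) ^ i • (ExteriorAlgebra.ι ℂ u * c) := by
    intro i c hc
    have hs : ∀ k (Y : Gr (I ⊕ I)), (-1 : ℤˣ) ^ (k + 1 : ZMod 2) • Y = -((-1 : ℤˣ) ^ k • Y) := by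
      intro k Y
      rw [uzpow_add, uzpow_one, mul_smul, neg_one_units_smul, smul_neg]
    refine CliffordAlgebra.evenOdd_induction (0 : QuadraticForm ℂ (I ⊕ I → ℂ)) i
      (motive := fun c _ => c * ExteriorAlgebra.ι ℂ u = (-1 : ℤˣ) ^ i • (ExteriorAlgebra.ι ℂ u * c))
      ?_ ?_ ?_ c hc
    · intro c hc
      rcases zmod_two_cases i with rfl | rfl
      · have : c ∈ LinearMap.range (CliffordAlgebra.ι (0 : QuadraticForm ℂ (I ⊕ I → ℂ))) ^ 0 := hc
        rw [pow_zero, Submodule.mem_one] at this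
        obtain ⟨r, rfl⟩ := this
        rw [uzpow_zero, one_smul, Algebra.commutes]
      · have : c ∈ LinearMap.range (CliffordAlgebra.ι (0 : QuadraticForm ℂ (I ⊕ I → ℂ))) ^ 1 := hc
        rw [pow_one] at this
        obtain ⟨v, rfl⟩ := this
        rw [uzpow_one, neg_one_units_smul]
        exact eq_neg_of_add_eq_zero_left (ExteriorAlgebra.ι_add_mul_swap v u)
    · intro x y _ _ hx hy
      rw [add_mul, mul_add, hx, hy, smul_add]
    · intro m₁ m₂ x _ hx
      have h := (ι_mul_ι_mem_evenElements (S := I ⊕ I) m₁ m₂).1 (ExteriorAlgebra.ι ℂ u)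
      calc _ = (ExteriorAlgebra.ι ℂ m₁ * ExteriorAlgebra.ι ℂ m₂) * (x * ExteriorAlgebra.ι ℂ u) :=
            mul_assoc _ _ _
        _ = (-1 : ℤˣ) ^ i • ((ExteriorAlgebra.ι ℂ m₁ * ExteriorAlgebra.ι ℂ m₂) *
              ExteriorAlgebra.ι ℂ u * x) := by rw [hx, mul_smul_comm, mul_assoc _ _ x]
        _ = _ := by rw [h, mul_assoc]
  refine totalGrade_induction (P := fun X => X * srcHom I (ExteriorAlgebra.ι ℂ u) =
      (-1 : ℂ) ^ n • (srcHom I (ExteriorAlgebra.ι ℂ u) * X)) ?_ ?_ ?_ hX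
  · intro X Y hX hY
    rw [add_mul, mul_add, hX, hY, smul_add]
  · intro c X hX
    rw [smul_mul_assoc, mul_smul_comm, hX, smul_comm]
  · intro i j hij c hc A hA
    rw [srcHom_eq, srcTmul_mul c hA (ι_mem_grGrade u), srcTmul_mul _ one_mem_opGrade hc, zero_mul,
      uzpow_zero, one_smul, mul_one, one_mul, mul_one, hgr i c hc]
    have h1 : srcTmul ((-1 : ℤˣ) ^ i • (ExteriorAlgebra.ι ℂ u * c)) A =
        (-1 : ℤˣ) ^ i • srcTmul (ExteriorAlgebra.ι ℂ u * c) A := by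
      rcases Int.units_eq_one_or ((-1 : ℤˣ) ^ i) with h | h
      · rw [h, one_smul, one_smul]
      · rw [h, neg_one_units_smul, neg_one_units_smul]
        exact TensorProduct.neg_tmul _ _
    rw [h1, smul_smul, ← uzpow_add, add_comm, hij, negOne_uzpow_cast]
    rcases Nat.even_or_odd n with h | h
    · rw [h.neg_one_pow, h.neg_one_pow, one_smul, one_smul]
    · rw [h.neg_one_pow, h.neg_one_pow, neg_one_units_smul, neg_smul, one_smul]

/-- Cyclicity of the trace for odd operators. The sign is that of moving `A` past the Grassmann
coefficient of `X`, because a trace that does not vanish requires an odd operator part. -/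
theorem srcTrace_odd_mul {n : ℕ} {X : SourceOp I} (hX : X ∈ totalGrade I (n : ZMod 2)) {A : Op I}
    (hA : A ∈ opGrade I 1) : srcTraceLin I (liftHom I A * X) =
      -((-1 : ℂ) ^ n • srcTraceLin I (X * liftHom I A)) := by
  refine totalGrade_induction (P := fun X => srcTraceLin I (liftHom I A * X) =
      -((-1 : ℂ) ^ n • srcTraceLin I (X * liftHom I A))) ?_ ?_ ?_ hX
  · intro X Y hX hY
    rw [add_mul, mul_add, map_add, map_add, hX, hY, smul_add, neg_add]
  · intro c X hX
    rw [smul_mul_assoc, mul_smul_comm, map_smul, map_smul, hX, smul_neg, smul_comm]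
  · intro i j hij c hc B hB
    rw [liftHom_eq, srcTmul_mul _ hA hc, srcTmul_mul _ hB one_mem_grGrade, mul_zero, uzpow_zero,
      one_smul, one_mul, mul_one, one_mul, srcTrace_tmul]
    have h1 : srcTraceLin I ((-1 : ℤˣ) ^ i • srcTmul c (A * B)) =
        (-1 : ℤˣ) ^ i • ((A * B).trace • c) := by
      rcases Int.units_eq_one_or ((-1 : ℤˣ) ^ i) with h | h
      · rw [h, one_smul, one_smul, srcTrace_tmul]
      · rw [h, neg_one_units_smul, neg_one_units_smul, map_neg, srcTrace_tmul]
    rw [h1, Matrix.trace_mul_comm B A]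
    rcases zmod_two_cases j with rfl | rfl
    · have : (A * B).trace = 0 := trace_odd (by simpa using SetLike.mul_mem_graded hA hB)
      rw [this, zero_smul, smul_zero, smul_zero, neg_zero]
    · have hi : i = (n : ZMod 2) + 1 := by
        rw [← hij, add_assoc, show (1 : ZMod 2) + 1 = 0 by decide, add_zero]
      rw [hi, uzpow_add, uzpow_one, negOne_uzpow_cast, mul_smul, neg_one_units_smul, smul_neg]
      rcases Nat.even_or_odd n with h | h
      · rw [h.neg_one_pow, h.neg_one_pow, one_smul, one_smul]
      · rw [h.neg_one_pow, h.neg_one_pow, neg_one_units_smul, neg_smul, one_smul]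

theorem commute_srcHom_even {q : Gr (I ⊕ I)} (hq : q ∈ evenElements (I ⊕ I))
    (hq' : q ∈ grGrade I 0) (X : SourceOp I) : Commute (srcHom I q) X := by
  induction X using source_induction with
  | add X Y hX hY => exact hX.add_right hY
  | tmul i j c hc A hA =>
    rw [Commute, SemiconjBy, srcHom_eq, srcTmul_mul _ one_mem_opGrade hc, srcTmul_mul _ hA hq',
      zero_mul, mul_zero, uzpow_zero, hq.1, one_mul, mul_one]

theorem commute_liftHom_srcHom {A : Op I} (hA : A ∈ opGrade I 0) (u : I ⊕ I → ℂ) :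
    Commute (liftHom I A) (srcHom I (ExteriorAlgebra.ι ℂ u)) := by
  have := mul_srcHom_ι (n := 0) (by simpa using liftHom_mem hA) u
  simpa [Commute, SemiconjBy] using this

/-- A source term that is moved around the trace past an even element changes its sign: where
the trace does not vanish, the odd operator passes an odd Grassmann coefficient of `Z`. -/
theorem srcTrace_source_mul {Z : SourceOp I} (hZ : Z ∈ totalGrade I 0) (u : I ⊕ I → ℂ) {A : Op I}
    (hA : A ∈ opGrade I 1) :
    srcTraceLin I (srcHom I (ExteriorAlgebra.ι ℂ u) * liftHom I A * Z) =
      -srcTraceLin I (Z * (srcHom I (ExteriorAlgebra.ι ℂ u) * liftHom I A)) := by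
  have h1 : Z * srcHom I (ExteriorAlgebra.ι ℂ u) ∈ totalGrade I ((1 : ℕ) : ZMod 2) := by
    have := totalGrade_mul hZ (srcHom_mem (ι_mem_grGrade u))
    simpa using this
  have h2 : liftHom I A * Z ∈ totalGrade I ((1 : ℕ) : ZMod 2) := by
    have := totalGrade_mul (liftHom_mem hA) hZ
    simpa using this
  have h3 := srcTrace_odd_mul h1 hA
  have h4 := mul_srcHom_ι h2 u
  rw [← mul_assoc, h4] at h3
  simp only [pow_one, neg_smul, one_smul, map_neg, neg_neg] at h3
  rw [mul_assoc, ← mul_assoc Z, ← h3, neg_neg]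

/-- The space of sums of source terms `c a`. -/
noncomputable def sourceTerms (I : Type*) [LinearOrder I] [Fintype I] :
    Submodule ℂ (SourceOp I) :=
  Submodule.span ℂ {Y | ∃ (u : I ⊕ I → ℂ), ∃ A ∈ opGrade I 1,
    Y = srcHom I (ExteriorAlgebra.ι ℂ u) * liftHom I A}

theorem sourceTerms_le : sourceTerms I ≤ totalGrade I 0 := by
  refine Submodule.span_le.2 ?_
  rintro Y ⟨u, A, hA, rfl⟩
  have := totalGrade_mul (srcHom_mem (ι_mem_grGrade u)) (liftHom_mem hA)
  rwa [show (1 : ZMod 2) + 1 = 0 by decide] at this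

/-- The sign that sources pick up when they are moved around a fermionic trace. -/
theorem srcTrace_nilExp_mul {Y : SourceOp I} (hY : Y ∈ sourceTerms I) (hn : IsNilpotent Y)
    {Z : SourceOp I} (hZ : Z ∈ totalGrade I 0) :
    srcTraceLin I (nilExp Y * Z) = srcTraceLin I (Z * nilExp (-Y)) := by
  have h1 : ∀ Z ∈ totalGrade I 0, srcTraceLin I (Y * Z) = -srcTraceLin I (Z * Y) := by
    intro Z hZ
    clear hn
    induction hY using Submodule.span_induction with
    | mem Y hY =>
      obtain ⟨u, A, hA, rfl⟩ := hY
      exact srcTrace_source_mul hZ u hA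
    | zero => simp
    | add Y Y' _ _ hY hY' => rw [add_mul, mul_add, map_add, map_add, hY, hY', neg_add]
    | smul c Y _ hY => rw [smul_mul_assoc, mul_smul_comm, map_smul, map_smul, hY, smul_neg]
  have h2 : ∀ (n : ℕ), ∀ Z ∈ totalGrade I 0,
      srcTraceLin I (Y ^ n * Z) = srcTraceLin I (Z * (-Y) ^ n) := by
    intro n
    induction n with
    | zero => simp
    | succ n ih =>
      intro Z hZ
      have h3 := ih Z hZ
      have hYn : Y ^ n * Z ∈ totalGrade I 0 := (evenSource I).mul_mem
        ((evenSource I).pow_mem (sourceTerms_le hY) n) hZ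
      have hZY : Z * Y ∈ totalGrade I 0 := (evenSource I).mul_mem hZ (sourceTerms_le hY)
      rw [pow_succ', mul_assoc, h1 _ hYn, mul_assoc, ih _ hZY, pow_succ', mul_assoc]
      simp
  obtain ⟨k, hk⟩ := hn
  rw [nilExp_eq_sum hk, nilExp_eq_sum (k := k) (by rw [neg_pow, hk, mul_zero]), Finset.sum_mul,
    Finset.mul_sum, map_sum, map_sum]
  refine Finset.sum_congr rfl fun n _ => ?_
  rw [smul_mul_assoc, mul_smul_comm, map_smul, map_smul, h2 n Z hZ]

theorem liftHom_mul_srcHom_ι {A : Op I} (hA : A ∈ opGrade I 1) (u : I ⊕ I → ℂ) :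
    liftHom I A * srcHom I (ExteriorAlgebra.ι ℂ u) =
      -(srcHom I (ExteriorAlgebra.ι ℂ u) * liftHom I A) := by
  have := mul_srcHom_ι (n := 1) (by simpa using liftHom_mem hA) u
  simpa using this

/-- The product of two source terms. -/
theorem sourceTerm_mul {A B : Op I} (hA : A ∈ opGrade I 1) (u w : I ⊕ I → ℂ) :
    srcHom I (ExteriorAlgebra.ι ℂ u) * liftHom I A * (srcHom I (ExteriorAlgebra.ι ℂ w) *
      liftHom I B) = -(srcHom I (ExteriorAlgebra.ι ℂ u * ExteriorAlgebra.ι ℂ w) *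
        liftHom I (A * B)) := by
  rw [mul_assoc, ← mul_assoc (liftHom I A), liftHom_mul_srcHom_ι hA, map_mul, map_mul]
  simp only [neg_mul, mul_neg, mul_assoc]

/-- The pairing of a family of odd sources with a family of operators. -/
noncomputable def srcPairing (ε : ℝ) (p : I → I ⊕ I → ℂ) (a : I → Op I) : SourceOp I :=
  (ε : ℂ) • ∑ x, srcHom I (ExteriorAlgebra.ι ℂ (p x)) * liftHom I (a x)

theorem srcPairing_mem {ε : ℝ} {a : I → Op I} (ha : ∀ x, a x ∈ opGrade I 1) (p : I → I ⊕ I → ℂ) :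
    srcPairing ε p a ∈ sourceTerms I :=
  Submodule.smul_mem _ _ (Submodule.sum_mem _ fun x _ =>
    Submodule.subset_span ⟨p x, a x, ha x, rfl⟩)

theorem commute_sourceTerm {A B : Op I} (hA : A ∈ opGrade I 1) (hB : B ∈ opGrade I 1)
    (h : A * B + B * A = 0) (u w : I ⊕ I → ℂ) :
    Commute (srcHom I (ExteriorAlgebra.ι ℂ u) * liftHom I A)
      (srcHom I (ExteriorAlgebra.ι ℂ w) * liftHom I B) := by
  rw [Commute, SemiconjBy, sourceTerm_mul hA, sourceTerm_mul hB,
    eq_neg_of_add_eq_zero_left (ExteriorAlgebra.ι_add_mul_swap u w),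
    eq_neg_of_add_eq_zero_left h, map_neg, map_neg, neg_mul_neg]

theorem commute_srcPairing {ε : ℝ} {a b : I → Op I} (ha : ∀ x, a x ∈ opGrade I 1)
    (hb : ∀ x, b x ∈ opGrade I 1) (h : ∀ x y, a x * b y + b y * a x = 0)
    (p q : I → I ⊕ I → ℂ) : Commute (srcPairing ε p a) (srcPairing ε q b) :=
  ((Commute.sum_left _ _ _ fun x _ => Commute.sum_right _ _ _ fun y _ =>
    commute_sourceTerm (ha x) (hb y) (h x y) _ _).smul_left _).smul_right _

theorem isNilpotent_srcPairing {ε : ℝ} {a : I → Op I} (ha : ∀ x, a x ∈ opGrade I 1)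
    (h : ∀ x y, a x * a y + a y * a x = 0) (p : I → I ⊕ I → ℂ) :
    IsNilpotent (srcPairing ε p a) := by
  refine IsNilpotent.smul (Commute.isNilpotent_sum (fun x _ => ⟨2, ?_⟩) fun x y _ _ =>
    commute_sourceTerm (ha x) (ha y) (h x y) _ _) _
  rw [pow_two, sourceTerm_mul (ha x), ExteriorAlgebra.ι_sq_zero, map_zero, zero_mul, neg_zero]

end Source

/-! ### Exponentials and central commutators -/

section BCH

variable {A : Type*} [Ring A] [Algebra ℂ A]

/-- If `Y b = b Y + c` with `c` commuting with `Y`, then `exp Y` shifts `b` by `c`. -/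
theorem nilExp_mul_eq_add_mul {Y b c : A} (hY : IsNilpotent Y) (h : Y * b = b * Y + c)
    (hc : Commute Y c) : nilExp Y * b = (b + c) * nilExp Y := by
  have hpow : ∀ n : ℕ, Y ^ (n + 1) * b = b * Y ^ (n + 1) + ((n : ℂ) + 1) • (c * Y ^ n) := by
    intro n
    induction n with
    | zero => simp [h]
    | succ n ih =>
      rw [pow_succ', mul_assoc, ih, mul_add, ← mul_assoc, h, mul_smul_comm, ← mul_assoc Y c,
        hc.eq, add_mul, mul_assoc, mul_assoc]
      simp only [← pow_succ']
      push_cast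
      rw [add_smul ((n : ℂ) + 1), one_smul]
      abel
  obtain ⟨k, hk⟩ := hY
  have h1 : Y ^ (k + 1) = 0 := by rw [pow_succ, hk, zero_mul]
  rw [add_mul]
  conv_lhs => rw [nilExp_eq_sum h1]
  conv_rhs =>
    arg 1
    rw [nilExp_eq_sum h1]
  rw [nilExp_eq_sum hk, Finset.sum_range_succ', add_mul, mul_add,
    Finset.sum_mul, Finset.mul_sum, Finset.mul_sum, add_right_comm, ← Finset.sum_add_distrib]
  congr 1
  · refine Finset.sum_congr rfl fun n _ => ?_
    rw [smul_mul_assoc, hpow, smul_add, mul_smul_comm, mul_smul_comm, smul_smul,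
      Nat.factorial_succ]
    congr 2
    have : (n : ℂ) + 1 ≠ 0 := Nat.cast_add_one_ne_zero n
    push_cast
    field_simp
  · simp

/-- The Weyl relation for exponentials with a central commutator. -/
theorem nilExp_mul_nilExp {P Q c : A} (hP : IsNilpotent P) (hQ : IsNilpotent Q)
    (hc : IsNilpotent c) (h : P * Q = Q * P + c) (hPc : Commute P c) (hQc : Commute Q c) :
    nilExp P * nilExp Q = nilExp Q * nilExp P * nilExp c := by
  have h1 := nilExp_mul_eq_add_mul hP h hPc
  have h2 : ∀ n : ℕ, nilExp P * Q ^ n = (Q + c) ^ n * nilExp P := by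
    intro n
    induction n with
    | zero => simp
    | succ n ih => rw [pow_succ, ← mul_assoc, ih, mul_assoc, h1, ← mul_assoc, ← pow_succ]
  have hQc' : IsNilpotent (Q + c) := Commute.isNilpotent_add hQc hQ hc
  obtain ⟨k, hk⟩ := hQ
  obtain ⟨m, hm⟩ := hQc'
  have hk' : Q ^ (k + m) = 0 := by rw [pow_add, hk, zero_mul]
  have hm' : (Q + c) ^ (k + m) = 0 := by rw [pow_add, hm, mul_zero]
  have h3 : nilExp P * nilExp Q = nilExp (Q + c) * nilExp P := by
    rw [nilExp_eq_sum hk', nilExp_eq_sum hm', Finset.mul_sum, Finset.sum_mul]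
    refine Finset.sum_congr rfl fun n _ => ?_
    rw [mul_smul_comm, smul_mul_assoc, h2]
  rw [h3, nilExp_add hQc ⟨k, hk⟩ hc, mul_assoc, mul_assoc,
    (commute_nilExp_right (commute_nilExp_right hPc.symm).symm).eq]

end BCH

/-! ### Finite dimensionality -/

section Finite

variable {S : Type*} [Fintype S] [DecidableEq S]

/-- The span of the products of generators in which the generators from `l` occur in the order of
`l`. -/
noncomputable def orderedSpan (l : List S) : Submodule ℂ (Gr S) :=
  (l.map fun s => Submodule.span ℂ {1, (gen s : Gr S)}).prod

theorem gen_mul_mem_orderedSpan (l : List S) {s : S} (hs : s ∈ l) {x : Gr S}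
    (hx : x ∈ orderedSpan l) : gen s * x ∈ orderedSpan l := by
  induction l generalizing x with
  | nil => simp at hs
  | cons t l ih =>
    rw [orderedSpan, List.map_cons, List.prod_cons] at hx ⊢
    induction hx using Submodule.mul_induction_on' with
    | mem_mul_mem m hm n hn =>
      obtain ⟨a, b, rfl⟩ := Submodule.mem_span_pair.1 hm
      by_cases hst : s = t
      · subst hst
        rw [← mul_assoc, mul_add, mul_smul_comm, mul_smul_comm, gen_mul_self, smul_zero, add_zero,
          mul_one]
        exact Submodule.mul_mem_mul (Submodule.smul_mem _ _ (Submodule.subset_span (by simp))) hn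
      · have hsl : s ∈ l := (List.mem_cons.1 hs).resolve_left hst
        have h1 : gen s * ((a • (1 : Gr S) + b • gen t) * n) =
            (a • (1 : Gr S) + -b • gen t) * (gen s * n) := by
          rw [← mul_assoc, ← mul_assoc, mul_add, add_mul _ _ (gen s), mul_smul_comm, mul_smul_comm,
            gen_mul_gen s t]
          simp
        rw [h1]
        exact Submodule.mul_mem_mul (Submodule.mem_span_pair.2 ⟨a, -b, rfl⟩) (ih hsl hn)
    | add x _ y _ hx hy => rw [mul_add]; exact Submodule.add_mem _ hx hy

theorem one_mem_orderedSpan (l : List S) : (1 : Gr S) ∈ orderedSpan l := by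
  induction l with
  | nil => simp [orderedSpan]
  | cons t l ih =>
    rw [orderedSpan, List.map_cons, List.prod_cons]
    have h := Submodule.mul_mem_mul
      (Submodule.subset_span (by simp) : (1 : Gr S) ∈ Submodule.span ℂ {1, (gen t : Gr S)}) ih
    rwa [mul_one] at h

instance finite_gr : Module.Finite ℂ (Gr S) := by
  have h1 : ∀ l : List S, (orderedSpan l).FG := by
    intro l
    induction l with
    | nil => exact ⟨{1}, by simp [orderedSpan, Submodule.one_eq_span]⟩
    | cons t l ih =>
      rw [orderedSpan, List.map_cons, List.prod_cons]
      exact Submodule.FG.mul (Submodule.fg_span (Set.toFinite _)) ih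
  have h2 : orderedSpan (Finset.univ : Finset S).toList = ⊤ := by
    rw [eq_top_iff]
    intro x _
    induction x using gr_induction with
    | one => exact one_mem_orderedSpan _
    | add x y hx hy => exact Submodule.add_mem _ (hx trivial) (hy trivial)
    | smul c x hx => exact Submodule.smul_mem _ _ (hx trivial)
    | gen_mul s x hx => exact gen_mul_mem_orderedSpan _ (by simp) (hx trivial)
  exact ⟨h2 ▸ h1 _⟩

instance finite_sourceOp {I : Type*} [LinearOrder I] [Fintype I] :
    Module.Finite ℂ (SourceOp I) :=
  Module.Finite.equiv (GradedTensorProduct.of ℂ (grGrade I) (opGrade I))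

end Finite

/-! ### The Wick theorem for time-ordered words -/

section Wick

open scoped Matrix

variable {I : Type*} [LinearOrder I] [Fintype I]

/-- If `ρ g = g' ρ` then the trace of a word behind `ρ (g + g')` reduces to the trace of the words in
which `g'` has been contracted with one letter. -/
theorem srcTrace_contract {ι : Type*} {ρ g g' : Op I} (hg' : g' ∈ opGrade I 1)
    (hρ : ρ ∈ opGrade I 0) (h : ρ * g = g' * ρ) (f : ι → SourceOp I)
    (hf : ∀ i, f i ∈ totalGrade I 1) (s : ι → ℂ) (l : List ι)
    (hs : ∀ i ∈ l, liftHom I g' * f i = s i • 1 - f i * liftHom I g') :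
    srcTraceLin I (liftHom I ρ * (liftHom I (g + g') * (l.map f).prod)) =
      contractWord s (fun l' => srcTraceLin I (liftHom I ρ * (l'.map f).prod)) l := by
  have h1 := mul_word_eq (liftHom I g') f s l hs
  have hX : liftHom I ρ * (l.map f).prod ∈ totalGrade I (l.length : ZMod 2) := by
    have := totalGrade_mul (liftHom_mem hρ) (prod_mem_totalGrade (l.map f) (by
      intro X hX
      obtain ⟨i, _, rfl⟩ := List.mem_map.1 hX
      exact hf i))
    rwa [zero_add, List.length_map] at this
  have h2 := srcTrace_odd_mul hX hg'
  have h3 : srcTraceLin I (liftHom I ρ * (liftHom I g * (l.map f).prod)) =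
      -((-1 : ℂ) ^ l.length • srcTraceLin I (liftHom I ρ * ((l.map f).prod * liftHom I g'))) := by
    rw [← mul_assoc, ← map_mul (liftHom I), h, map_mul (liftHom I), mul_assoc, h2, mul_assoc]
  have h4 := map_contractWord (srcTraceLin I ∘ₗ LinearMap.mulLeft ℂ (liftHom I ρ)) s
    (fun l' => (l'.map f).prod) l
  simp only [LinearMap.comp_apply, LinearMap.mulLeft_apply] at h4
  rw [map_add, add_mul, mul_add, map_add, h3, h1, mul_add, map_add, mul_smul_comm, map_smul, h4]
  abel

variable {N : ℕ}

/-- The creation and annihilation operators at the discrete times, in imaginary time evolution with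
respect to `(a⁺, E a⁻)`. -/
noncomputable def timeOp (ε β : ℝ) (E : Matrix I I ℂ) : (Fin N × I) ⊕ (Fin N × I) → Op I
  | Sum.inl p => creation ε (NormedSpace.exp ((time β N p.1 : ℂ) • E) *ᵥ Pi.single p.2 1)
  | Sum.inr p => annihilation ε (Pi.single p.2 1 ᵥ* NormedSpace.exp (-(time β N p.1 : ℂ) • E))

/-- The operators at the discrete times, shifted by sources. -/
noncomputable def shiftedOp (ε β : ℝ) (E : Matrix I I ℂ)
    (η : (Fin N × I) ⊕ (Fin N × I) → I ⊕ I → ℂ) (s : (Fin N × I) ⊕ (Fin N × I)) : SourceOp I :=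
  liftHom I (timeOp ε β E s) + srcHom I (ExteriorAlgebra.ι ℂ (η s))

/-- The pairs of letters that are time ordered, with later times to the left, and normal ordered at
equal times. Pairs of the same kind anticommute, so that their order is irrelevant. -/
def TimeOrdered : (Fin N × I) ⊕ (Fin N × I) → (Fin N × I) ⊕ (Fin N × I) → Prop
  | Sum.inl p, Sum.inr q => q.1 ≤ p.1
  | Sum.inr p, Sum.inl q => q.1 < p.1
  | _, _ => True

theorem timeOp_mem (ε β : ℝ) (E : Matrix I I ℂ) (s : (Fin N × I) ⊕ (Fin N × I)) :
    timeOp ε β E s ∈ opGrade I 1 := by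
  rcases s with p | p
  · exact creation_mem_odd _ _
  · exact annihilation_mem_odd _ _

theorem shiftedOp_mem (ε β : ℝ) (E : Matrix I I ℂ)
    (η : (Fin N × I) ⊕ (Fin N × I) → I ⊕ I → ℂ) (s : (Fin N × I) ⊕ (Fin N × I)) :
    shiftedOp ε β E η s ∈ totalGrade I 1 :=
  Submodule.add_mem _ (liftHom_mem (timeOp_mem ε β E s)) (srcHom_mem (ι_mem_grGrade _))

/-- An odd operator sees only the operator part of a shifted operator. -/
theorem liftHom_mul_shiftedOp {ε β : ℝ} {E : Matrix I I ℂ}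
    (η : (Fin N × I) ⊕ (Fin N × I) → I ⊕ I → ℂ) (s : (Fin N × I) ⊕ (Fin N × I)) {g : Op I}
    (hg : g ∈ opGrade I 1) {c : ℂ} (h : g * timeOp ε β E s + timeOp ε β E s * g = c • 1) :
    liftHom I g * shiftedOp ε β E η s = c • 1 - shiftedOp ε β E η s * liftHom I g := by
  rw [shiftedOp, mul_add, liftHom_mul_srcHom_ι hg, add_mul, ← map_mul, ← map_mul,
    eq_sub_of_add_eq h, map_sub, map_smul, map_one]
  abel

theorem fermi_neg_mul_exp {E : Matrix I I ℂ} (hE : E.IsHermitian) (β : ℝ) :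
    fermi β (-E) * NormedSpace.exp (-(β : ℂ) • E) = fermi β E := by
  rw [← add_right_inj (fermi β (-E)), ← mul_one_add, fermi_neg_mul hE, fermi_neg hE,
    sub_add_cancel]

theorem exp_mul_fermi_neg {E : Matrix I I ℂ} (hE : E.IsHermitian) (β : ℝ) :
    NormedSpace.exp (-(β : ℂ) • E) * fermi β (-E) = fermi β E := by
  rw [← fermi_neg_mul_exp hE, fermi_neg hE]
  exact ((Commute.one_right _).sub_right (commute_fermi_exp hE β _).symm).eq

theorem fermi_mul_exp {E : Matrix I I ℂ} (hE : E.IsHermitian) (β : ℝ) :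
    fermi β E * NormedSpace.exp ((β : ℂ) • E) = fermi β (-E) := by
  rw [← add_right_inj (fermi β E), ← mul_one_add, fermi_mul hE, fermi_neg hE, add_sub_cancel]

theorem exp_mul_fermi_mul_exp {E : Matrix I I ℂ} (hE : E.IsHermitian) (β : ℝ) {s t : ℝ}
    (h : ¬ 0 < s - t) : NormedSpace.exp (-(s : ℂ) • E) * (fermi β E *
      NormedSpace.exp ((t : ℂ) • E)) = twoPoint β E (s - t) := by
  rw [twoPoint, if_neg h, ← mul_assoc, ← (commute_fermi_exp hE β _).eq, mul_assoc, ← exp_smul_add]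
  congr 3
  push_cast
  ring

theorem exp_mul_fermi_neg_mul_exp {E : Matrix I I ℂ} (hE : E.IsHermitian) (β : ℝ) {s t : ℝ}
    (h : 0 < s - t) : NormedSpace.exp (-(s : ℂ) • E) * (fermi β (-E) *
      NormedSpace.exp ((t : ℂ) • E)) = -twoPoint β E (s - t) := by
  rw [twoPoint, if_pos h, neg_neg, ← mul_assoc]
  have h1 : Commute (fermi β (-E)) (NormedSpace.exp (-(s : ℂ) • E)) := by
    rw [fermi_neg hE]
    exact (Commute.one_left _).sub_left (commute_fermi_exp hE β _)
  rw [← h1.eq, mul_assoc, ← exp_smul_add]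
  congr 3
  push_cast
  ring

theorem vecMul_dotProduct_mulVec_single (M M' : Matrix I I ℂ) (x y : I) :
    (Pi.single x 1 ᵥ* M) ⬝ᵥ (M' *ᵥ Pi.single y 1) = (M * M') x y := by
  rw [Matrix.dotProduct_mulVec, Matrix.vecMul_vecMul]
  simp

theorem covDual_inl (ε : ℝ) {K : Type*} [Fintype K] [DecidableEq K] (C : Matrix K K ℂ) (p : K)
    (t : K ⊕ K) : covDual ε C (Sum.inl p) (Pi.single t 1) =
      Sum.elim (fun _ => 0) (fun q => (ε : ℂ)⁻¹ * C q p) t := by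
  rcases t with q | q
  · simp [covDual]
  · simp [covDual, Pi.single_apply]

theorem covDual_inr (ε : ℝ) {K : Type*} [Fintype K] [DecidableEq K] (C : Matrix K K ℂ) (p : K)
    (t : K ⊕ K) : covDual ε C (Sum.inr p) (Pi.single t 1) =
      Sum.elim (fun q => -((ε : ℂ)⁻¹ * C p q)) (fun _ => 0) t := by
  rcases t with q | q
  · simp [covDual, Pi.single_apply]
  · simp [covDual]

/-- The thermal contraction of one letter: the operator splits as `g + g'` with `ρ g = g' ρ`, and
the anticommutators of `g'` with the letters to its right are the entries of the covariance. -/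
theorem exists_thermal_split {ε β : ℝ} (hε : 0 < ε) (hβ : 0 < β) {E : Matrix I I ℂ}
    (hE : E.IsHermitian) (s : (Fin N × I) ⊕ (Fin N × I)) :
    ∃ g g' : Op I, timeOp ε β E s = g + g' ∧ g' ∈ opGrade I 1 ∧
      NormedSpace.exp (-(β : ℂ) • quadOp ε E) * g =
        g' * NormedSpace.exp (-(β : ℂ) • quadOp ε E) ∧
      ∀ t, TimeOrdered s t → g' * timeOp ε β E t + timeOp ε β E t * g' =
        covDual ε (covR β E N) s (Pi.single t 1) • 1 := by
  rcases s with p | p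
  · refine ⟨creation ε (fermi β (-E) *ᵥ (NormedSpace.exp ((time β N p.1 : ℂ) • E) *ᵥ
      Pi.single p.2 1)), creation ε (fermi β E *ᵥ (NormedSpace.exp ((time β N p.1 : ℂ) • E) *ᵥ
      Pi.single p.2 1)), ?_, creation_mem_odd _ _, ?_, ?_⟩
    · rw [timeOp, ← map_add, ← Matrix.add_mulVec, fermi_neg hE, sub_add_cancel, Matrix.one_mulVec]
    · rw [exp_quadOp_mul_creation hε hE, Matrix.mulVec_mulVec, exp_mul_fermi_neg hE]
    · intro t ht
      rw [covDual_inl]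
      rcases t with q | q
      · rw [timeOp, creation_anticomm, Sum.elim_inl, zero_smul]
      · have hqp : ¬ 0 < time β N q.1 - time β N p.1 := by
          rw [time_pos_sub hβ]
          exact not_lt.2 ht
        rw [timeOp, add_comm, annihilation_creation_anticomm hε, Sum.elim_inr, covR,
          Matrix.mulVec_mulVec, vecMul_dotProduct_mulVec_single, exp_mul_fermi_mul_exp hE β hqp]
  · refine ⟨annihilation ε ((Pi.single p.2 1 ᵥ* NormedSpace.exp (-(time β N p.1 : ℂ) • E)) ᵥ*
      fermi β E), annihilation ε ((Pi.single p.2 1 ᵥ* NormedSpace.exp (-(time β N p.1 : ℂ) • E)) ᵥ*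
      fermi β (-E)), ?_, annihilation_mem_odd _ _, ?_, ?_⟩
    · rw [timeOp, ← map_add, ← Matrix.vecMul_add, fermi_neg hE, add_sub_cancel, Matrix.vecMul_one]
    · rw [exp_quadOp_mul_annihilation hε hE, Matrix.vecMul_vecMul, neg_neg, fermi_mul_exp hE]
    · intro t ht
      rw [covDual_inr]
      rcases t with q | q
      · have hqp : 0 < time β N p.1 - time β N q.1 := by
          rw [time_pos_sub hβ]
          exact ht
        rw [timeOp, annihilation_creation_anticomm hε, Sum.elim_inl, covR,
          Matrix.vecMul_vecMul, vecMul_dotProduct_mulVec_single, mul_assoc,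
          exp_mul_fermi_neg_mul_exp hE β hqp, Matrix.neg_apply, mul_neg]
      · rw [timeOp, annihilation_anticomm, Sum.elim_inr, zero_smul]

/-- The Wick theorem: thermal expectation values of time-ordered words are Gaussian convolutions. -/
theorem srcTrace_timeOrdered_word {ε β : ℝ} (hε : 0 < ε) (hβ : 0 < β) {E : Matrix I I ℂ}
    (hE : E.IsHermitian) (η : (Fin N × I) ⊕ (Fin N × I) → I ⊕ I → ℂ)
    (l : List ((Fin N × I) ⊕ (Fin N × I))) (hl : l.Pairwise TimeOrdered) :
    srcTraceLin I (liftHom I (NormedSpace.exp (-(β : ℂ) • quadOp ε E)) *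
        (l.map (shiftedOp ε β E η)).prod) =
      (NormedSpace.exp (-(β : ℂ) • quadOp ε E)).trace •
        gaussEval ε (covR β E N) η (l.map gen).prod := by
  set ρ := NormedSpace.exp (-(β : ℂ) • quadOp ε E) with hρ
  have hρe : ρ ∈ opGrade I 0 := exp_mem_even (Submodule.smul_mem _ _ (commute_parity_quadOp ε E))
  have hC := isUnit_covR hE hβ N
  induction hn : l.length using Nat.strong_induction_on generalizing l with
  | _ n ih =>
    rcases l with _ | ⟨s, l⟩
    · rw [List.map_nil, List.prod_nil, mul_one, List.map_nil, List.prod_nil,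
        gaussEval_one hε hC, liftHom_eq, srcTrace_tmul]
    · obtain ⟨g, g', hgg, hg', hρg, hcov⟩ := exists_thermal_split (N := N) hε hβ hE s
      obtain ⟨hs, hl'⟩ := List.pairwise_cons.1 hl
      have h1 : srcTraceLin I (liftHom I ρ * (srcHom I (ExteriorAlgebra.ι ℂ (η s)) *
          (l.map (shiftedOp ε β E η)).prod)) = ExteriorAlgebra.ι ℂ (η s) *
            srcTraceLin I (liftHom I ρ * (l.map (shiftedOp ε β E η)).prod) := by
        rw [← mul_assoc, (commute_liftHom_srcHom hρe _).eq, mul_assoc, srcTrace_src_mul]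
      have h2 := srcTrace_contract hg' hρe hρg (shiftedOp ε β E η) (shiftedOp_mem ε β E η)
        (fun t => covDual ε (covR β E N) s (Pi.single t 1)) l
        (fun t ht => liftHom_mul_shiftedOp η t hg' (hcov t (hs t ht)))
      have h3 : contractWord (fun t => covDual ε (covR β E N) s (Pi.single t 1))
          (fun l' => srcTraceLin I (liftHom I ρ * (l'.map (shiftedOp ε β E η)).prod)) l =
          contractWord (fun t => covDual ε (covR β E N) s (Pi.single t 1))
          (fun l' => (ρ.trace • gaussEval ε (covR β E N) η) (l'.map gen).prod) l := by
        refine contractWord_congr (fun _ _ => rfl) fun l' hsub hlen => ?_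
        exact ih l'.length (by simp at hn; omega) l' (hl'.sublist hsub) rfl
      rw [← map_contractWord (ρ.trace • gaussEval ε (covR β E N) η), ← contraction_word] at h3
      rw [List.map_cons, List.prod_cons, List.map_cons, List.prod_cons, gaussEval_gen_mul hε hC,
        shiftedOp, add_mul, mul_add, map_add, h1, hgg, h2, h3,
        ih l.length (by simp at hn; omega) l hl' rfl, smul_add, mul_smul_comm, add_comm,
        LinearMap.smul_apply, add_comm]

/-! ### Normal ordered words -/

/-- The polynomial in `a` and `b` with coefficients `c`, in which a pair of words stands for the
product of the word in `a` and the word in `b`. -/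
noncomputable def wordPoly {A : Type*} [Ring A] [Algebra ℂ A] (a b : I → A) :
    (List I × List I →₀ ℂ) →ₗ[ℂ] A :=
  Finsupp.linearCombination ℂ fun w => (w.1.map a).prod * (w.2.map b).prod

theorem map_wordPoly {A B : Type*} [Ring A] [Algebra ℂ A] [Ring B] [Algebra ℂ B] (φ : A →ₐ[ℂ] B)
    (a b : I → A) (c : List I × List I →₀ ℂ) :
    φ (wordPoly a b c) = wordPoly (fun x => φ (a x)) (fun x => φ (b x)) c := by
  have := Finsupp.apply_linearCombination ℂ φ.toLinearMap
    (fun w : List I × List I => (w.1.map a).prod * (w.2.map b).prod) c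
  refine this.trans ?_
  congr 2
  ext w
  simp [map_list_prod, Function.comp_def]

/-- Products of normal ordered polynomials over decreasing times are combinations of time-ordered
words. -/
theorem prod_wordPoly_mem {A : Type*} [Ring A] [Algebra ℂ A] (f : (Fin N × I) ⊕ (Fin N × I) → A)
    (c : List I × List I →₀ ℂ) (ks : List (Fin N)) (hks : ks.Pairwise (· > ·)) :
    (ks.map fun k => wordPoly (fun x => f (Sum.inl (k, x))) (fun x => f (Sum.inr (k, x))) c).prod ∈
      Submodule.span ℂ {X | ∃ l : List ((Fin N × I) ⊕ (Fin N × I)), l.Pairwise TimeOrdered ∧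
        (∀ s ∈ l, Sum.elim Prod.fst Prod.fst s ∈ ks) ∧ X = (l.map f).prod} := by
  induction ks with
  | nil => exact Submodule.subset_span ⟨[], by simp⟩
  | cons k ks ih =>
    obtain ⟨hk, hks⟩ := List.pairwise_cons.1 hks
    rw [List.map_cons, List.prod_cons]
    have h1 : wordPoly (fun x => f (Sum.inl (k, x))) (fun x => f (Sum.inr (k, x))) c ∈
        Submodule.span ℂ {X | ∃ l : List ((Fin N × I) ⊕ (Fin N × I)), l.Pairwise TimeOrdered ∧
        (∀ s ∈ l, Sum.elim Prod.fst Prod.fst s = k) ∧ X = (l.map f).prod} := by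
      refine Submodule.sum_mem _ fun w _ => Submodule.smul_mem _ _ (Submodule.subset_span
        ⟨w.1.map (fun x => Sum.inl (k, x)) ++ w.2.map (fun x => Sum.inr (k, x)), ?_, ?_, ?_⟩)
      · rw [List.pairwise_append]
        refine ⟨List.pairwise_map.2 (List.Pairwise.imp (R := fun _ _ => True) (fun _ => trivial)
          (List.pairwise_of_forall fun _ _ => trivial)),
          List.pairwise_map.2 (List.Pairwise.imp (R := fun _ _ => True) (fun _ => trivial)
          (List.pairwise_of_forall fun _ _ => trivial)), ?_⟩
        intro s hs t ht
        obtain ⟨x, _, rfl⟩ := List.mem_map.1 hs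
        obtain ⟨y, _, rfl⟩ := List.mem_map.1 ht
        exact le_refl k
      · intro s hs
        rcases List.mem_append.1 hs with hs | hs
        · obtain ⟨x, _, rfl⟩ := List.mem_map.1 hs
          rfl
        · obtain ⟨x, _, rfl⟩ := List.mem_map.1 hs
          rfl
      · simp [Function.comp_def]
    have h2 := Submodule.mul_mem_mul h1 (ih hks)
    rw [Submodule.span_mul_span] at h2
    refine Submodule.span_mono ?_ h2
    rintro X ⟨Y, ⟨l, hl, hlk, rfl⟩, Z, ⟨l', hl', hlk', rfl⟩, rfl⟩
    refine ⟨l ++ l', List.pairwise_append.2 ⟨hl, hl', ?_⟩, ?_, by simp⟩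
    · intro s hs t ht
      have h3 := hk _ (hlk' t ht)
      rw [← hlk s hs] at h3
      rcases s with p | p <;> rcases t with q | q
      · trivial
      · exact h3.le
      · exact h3
      · trivial
    · intro s hs
      rcases List.mem_append.1 hs with hs | hs
      · rw [hlk s hs]
        exact List.mem_cons_self
      · exact List.mem_cons_of_mem _ (hlk' s hs)

/-- The Gaussian convolution of a product over the time slices is a thermal expectation value. -/
theorem srcTrace_prod_wordPoly {ε β : ℝ} (hε : 0 < ε) (hβ : 0 < β) {E : Matrix I I ℂ}
    (hE : E.IsHermitian) (η : (Fin N × I) ⊕ (Fin N × I) → I ⊕ I → ℂ)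
    (c : List I × List I →₀ ℂ) :
    srcTraceLin I (liftHom I (NormedSpace.exp (-(β : ℂ) • quadOp ε E)) *
        ((List.finRange N).reverse.map fun k => wordPoly
          (fun x => shiftedOp ε β E η (Sum.inl (k, x)))
          (fun x => shiftedOp ε β E η (Sum.inr (k, x))) c).prod) =
      (NormedSpace.exp (-(β : ℂ) • quadOp ε E)).trace •
        gaussEval ε (covR β E N) η ((List.finRange N).reverse.map fun k => wordPoly
          (fun x => gen (Sum.inl (k, x))) (fun x => gen (Sum.inr (k, x))) c).prod := by
  set ρ := NormedSpace.exp (-(β : ℂ) • quadOp ε E) with hρ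
  -- The letters of both sides are carried along as pairs.
  set f : (Fin N × I) ⊕ (Fin N × I) → Gr ((Fin N × I) ⊕ (Fin N × I)) × SourceOp I :=
    fun s => (gen s, shiftedOp ε β E η s) with hf
  have h1 := prod_wordPoly_mem f c (List.finRange N).reverse (by
    rw [List.pairwise_reverse]
    exact List.pairwise_lt_finRange N)
  have h2 : ∀ X ∈ Submodule.span ℂ {X | ∃ l : List ((Fin N × I) ⊕ (Fin N × I)),
      l.Pairwise TimeOrdered ∧ (∀ s ∈ l, Sum.elim Prod.fst Prod.fst s ∈
        (List.finRange N).reverse) ∧ X = (l.map f).prod},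
      srcTraceLin I (liftHom I ρ * X.2) = ρ.trace • gaussEval ε (covR β E N) η X.1 := by
    intro X hX
    induction hX using Submodule.span_induction with
    | mem X hX =>
      obtain ⟨l, hl, -, rfl⟩ := hX
      have h3 : ((l.map f).prod).1 = (l.map gen).prod := by
        have := map_list_prod (AlgHom.fst ℂ (Gr ((Fin N × I) ⊕ (Fin N × I))) (SourceOp I)) (l.map f)
        rwa [List.map_map] at this
      have h4 : ((l.map f).prod).2 = (l.map (shiftedOp ε β E η)).prod := by
        have := map_list_prod (AlgHom.snd ℂ (Gr ((Fin N × I) ⊕ (Fin N × I))) (SourceOp I)) (l.map f)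
        rwa [List.map_map] at this
      rw [h3, h4]
      exact srcTrace_timeOrdered_word hε hβ hE η l hl
    | zero => simp
    | add X Y _ _ hX hY =>
      rw [Prod.snd_add, Prod.fst_add, mul_add, map_add, map_add, smul_add, hX, hY]
    | smul a X _ hX =>
      rw [Prod.smul_snd, Prod.smul_fst, mul_smul_comm, map_smul, map_smul, hX, smul_comm]
  have h3 := h2 _ h1
  have h4 := map_list_prod (AlgHom.fst ℂ (Gr ((Fin N × I) ⊕ (Fin N × I))) (SourceOp I))
    ((List.finRange N).reverse.map fun k =>
      wordPoly (fun x => f (Sum.inl (k, x))) (fun x => f (Sum.inr (k, x))) c)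
  have h5 := map_list_prod (AlgHom.snd ℂ (Gr ((Fin N × I) ⊕ (Fin N × I))) (SourceOp I))
    ((List.finRange N).reverse.map fun k =>
      wordPoly (fun x => f (Sum.inl (k, x))) (fun x => f (Sum.inr (k, x))) c)
  rw [List.map_map] at h4 h5
  simp only [Function.comp_def, map_wordPoly] at h4 h5
  rw [AlgHom.fst_apply] at h4
  rw [AlgHom.snd_apply] at h5
  rw [h4, h5] at h3
  exact h3

end Wick

/-! ### The Boltzmann factor as a product over the time slices -/

section Slices

variable {I : Type*} [LinearOrder I] [Fintype I]

/-- The coefficients of a normal ordered polynomial. -/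
noncomputable def polyCoeff (v : Finset I → Finset I → ℂ) : List I × List I →₀ ℂ :=
  ∑ J : Finset I, ∑ L : Finset I, Finsupp.single (J.sort (· ≤ ·), L.sort (· ≤ ·)) (v J L)

variable {A : Type*} [Ring A] [Algebra ℂ A]

theorem wordPoly_single (a b : I → A) (w : List I × List I) (r : ℂ) :
    wordPoly a b (Finsupp.single w r) = r • ((w.1.map a).prod * (w.2.map b).prod) :=
  Finsupp.linearCombination_single _ _ _

theorem wordPoly_one (a b : I → A) : wordPoly a b (Finsupp.single ([], []) 1) = 1 := by
  simp [wordPoly_single]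

theorem wordPoly_polyCoeff (v : Finset I → Finset I → ℂ) (a b : I → A) :
    wordPoly a b (polyCoeff v) = normalPoly v a b := by
  simp only [polyCoeff, map_sum, wordPoly_single]
  rfl

theorem normalPoly_sub_const (v : Finset I → Finset I → ℂ) (a b : I → A) :
    normalPoly v a b - v ∅ ∅ • 1 = ∑ p ∈ (Finset.univ : Finset (Finset I × Finset I)).erase (∅, ∅),
      v p.1 p.2 • (orderedProd a p.1 * orderedProd b p.2) := by
  have h1 : normalPoly v a b = ∑ p : Finset I × Finset I,
      v p.1 p.2 • (orderedProd a p.1 * orderedProd b p.2) := by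
    rw [Fintype.sum_prod_type]
    rfl
  rw [h1, ← Finset.add_sum_erase _ _ (Finset.mem_univ (∅, ∅))]
  simp [orderedProd]

/-- Every element of the Grassmann algebra is a normal ordered polynomial. -/
theorem exists_wordPoly_eq (x : Gr (I ⊕ I)) : ∃ c : List I × List I →₀ ℂ,
    wordPoly (fun x => gen (Sum.inl x)) (fun x => gen (Sum.inr x)) c = x := by
  set P : (List I × List I →₀ ℂ) →ₗ[ℂ] Gr (I ⊕ I) :=
    wordPoly (fun x => gen (Sum.inl x)) (fun x => gen (Sum.inr x)) with hP
  have h : x ∈ LinearMap.range P := by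
    induction x using gr_induction with
    | one => exact ⟨Finsupp.single ([], []) 1, wordPoly_one _ _⟩
    | add x y hx hy => exact Submodule.add_mem _ hx hy
    | smul c x hx => exact Submodule.smul_mem _ c hx
    | gen_mul s x hx =>
      obtain ⟨c, rfl⟩ := hx
      induction c using Finsupp.induction_linear with
      | zero => rw [map_zero, mul_zero]; exact Submodule.zero_mem _
      | add c d hc hd => rw [map_add, mul_add]; exact Submodule.add_mem _ hc hd
      | single w r =>
        rw [hP, wordPoly_single, mul_smul_comm]
        refine Submodule.smul_mem _ _ ?_
        rcases s with x | y
        · refine ⟨Finsupp.single (x :: w.1, w.2) 1, ?_⟩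
          rw [wordPoly_single, one_smul, List.map_cons, List.prod_cons, mul_assoc]
        · have h1 : ∀ l : List I, (gen (Sum.inr y) : Gr (I ⊕ I)) *
              (l.map fun x => (gen (Sum.inl x) : Gr (I ⊕ I))).prod = (-1 : ℂ) ^ l.length •
                ((l.map fun x => (gen (Sum.inl x) : Gr (I ⊕ I))).prod * gen (Sum.inr y)) := by
            intro l
            induction l with
            | nil => simp
            | cons z l ih =>
              rw [List.map_cons, List.prod_cons, ← mul_assoc, gen_mul_gen, neg_mul, mul_assoc, ih,
                mul_smul_comm, List.length_cons, pow_succ, mul_neg_one, neg_smul, mul_assoc]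
          refine ⟨Finsupp.single (w.1, y :: w.2) ((-1 : ℂ) ^ w.1.length), ?_⟩
          rw [wordPoly_single, ← mul_assoc, h1, smul_mul_assoc, List.map_cons, List.prod_cons,
            mul_assoc]
  exact h

variable {S : Type*} [Fintype S] [DecidableEq S]

theorem isNilpotent_word (l : List S) (hl : Even l.length) (hne : l ≠ []) :
    IsNilpotent (l.map (gen : S → Gr S)).prod := by
  refine ⟨2, ?_⟩
  have h := (word_mem_evenElements l hl).1
  obtain ⟨s, l, rfl⟩ := List.exists_cons_of_ne_nil hne
  rw [pow_two]
  rw [List.map_cons, List.prod_cons] at h ⊢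
  rw [← mul_assoc, h, ← mul_assoc, gen_mul_self, zero_mul, zero_mul]

theorem orderedProd_mul_eq_word (f g : I → S) (J L : Finset I) :
    (orderedProd (fun x => (gen (f x) : Gr S)) J * orderedProd (fun x => gen (g x)) L) =
      (((J.sort (· ≤ ·)).map f ++ (L.sort (· ≤ ·)).map g).map (gen : S → Gr S)).prod := by
  simp [orderedProd, Function.comp_def]

theorem word_ne_nil (f g : I → S) {p : Finset I × Finset I} (hp : p ≠ (∅, ∅)) :
    (p.1.sort (· ≤ ·)).map f ++ (p.2.sort (· ≤ ·)).map g ≠ [] := by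
  intro h
  apply hp
  have h1 := congrArg List.length h
  simp only [List.length_append, List.length_map, Finset.length_sort, List.length_nil] at h1
  rw [Prod.ext_iff]
  exact ⟨Finset.card_eq_zero.1 (by omega), Finset.card_eq_zero.1 (by omega)⟩

theorem normalPoly_sub_const_mem_even {v : Finset I → Finset I → ℂ}
    (hv : ∀ J L, v J L ≠ 0 → Even (J.card + L.card)) (f g : I → S) :
    normalPoly v (fun x => (gen (f x) : Gr S)) (fun x => gen (g x)) - v ∅ ∅ • 1 ∈
      evenElements S := by
  rw [normalPoly_sub_const]
  refine Subalgebra.sum_mem _ fun p _ => ?_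
  by_cases h : v p.1 p.2 = 0
  · rw [h, zero_smul]
    exact Subalgebra.zero_mem _
  · rw [orderedProd_mul_eq_word]
    exact Subalgebra.smul_mem _ (word_mem_evenElements _ (by simpa using hv _ _ h)) _

theorem isNilpotent_normalPoly_sub_const {v : Finset I → Finset I → ℂ}
    (hv : ∀ J L, v J L ≠ 0 → Even (J.card + L.card)) (f g : I → S) :
    IsNilpotent (normalPoly v (fun x => (gen (f x) : Gr S)) (fun x => gen (g x)) - v ∅ ∅ • 1) := by
  rw [normalPoly_sub_const]
  refine Commute.isNilpotent_sum (fun p hp => ?_) fun p q _ _ => ?_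
  · by_cases h : v p.1 p.2 = 0
    · rw [h, zero_smul]
      exact IsNilpotent.zero
    · rw [orderedProd_mul_eq_word]
      exact (isNilpotent_word _ (by simpa using hv _ _ h)
        (word_ne_nil f g (Finset.ne_of_mem_erase hp))).smul _
  · by_cases h : v p.1 p.2 = 0
    · rw [h, zero_smul]
      exact Commute.zero_left _
    · rw [orderedProd_mul_eq_word]
      exact Commute.smul_left ((word_mem_evenElements _ (by simpa using hv _ _ h)).1 _) _

theorem algebraMapInv_normalPoly_sub_const (v : Finset I → Finset I → ℂ) (f g : I → S) :
    ExteriorAlgebra.algebraMapInv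
      (normalPoly v (fun x => (gen (f x) : Gr S)) (fun x => gen (g x)) - v ∅ ∅ • 1) = 0 := by
  rw [normalPoly_sub_const, map_sum]
  refine Finset.sum_eq_zero fun p hp => ?_
  obtain ⟨s, l, hl⟩ := List.exists_cons_of_ne_nil (word_ne_nil f g (Finset.ne_of_mem_erase hp))
  rw [orderedProd_mul_eq_word, hl, List.map_cons, List.prod_cons, map_smul, map_mul,
    algebraMapInv_gen, zero_mul, smul_zero]

/-- The coefficients of the truncated exponential series `exp (-δ v₀) ∑ n, (-δ)ⁿ / n! uₙ`. -/
noncomputable def sliceCoeff (u : ℕ → List I × List I →₀ ℂ) (m : ℕ) (v₀ δ : ℂ) :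
    List I × List I →₀ ℂ :=
  Complex.exp (-δ * v₀) • ∑ n ∈ Finset.range m, ((n.factorial : ℂ)⁻¹ * (-δ) ^ n) • u n

/-- The Boltzmann factor of the interaction is the product over the time slices of one and the same
normal ordered polynomial, which depends analytically on the length `β / N` of a slice. -/
theorem exists_sliceCoeff {v : Finset I → Finset I → ℂ}
    (hv : ∀ J L, v J L ≠ 0 → Even (J.card + L.card)) :
    ∃ (m : ℕ) (u : ℕ → List I × List I →₀ ℂ), 2 ≤ m ∧ u 0 = Finsupp.single ([], []) 1 ∧
      u 1 = polyCoeff v - v ∅ ∅ • Finsupp.single ([], []) 1 ∧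
      ∀ (β : ℝ) (N : ℕ), grExp (-interaction β v N) = ((List.finRange N).reverse.map fun k =>
        wordPoly (fun x => gen (Sum.inl (k, x))) (fun x => gen (Sum.inr (k, x)))
          (sliceCoeff u m (v ∅ ∅) ((β / N : ℝ) : ℂ))).prod := by
  set x : Gr (I ⊕ I) :=
    normalPoly v (fun x => gen (Sum.inl x)) (fun x => gen (Sum.inr x)) - v ∅ ∅ • 1 with hx
  obtain ⟨m, hm⟩ := isNilpotent_normalPoly_sub_const hv (Sum.inl : I → I ⊕ I) Sum.inr
  have hm' : x ^ m = 0 := hm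
  choose c hc using fun n : ℕ => exists_wordPoly_eq (x ^ n)
  set u : ℕ → List I × List I →₀ ℂ := fun n => if n = 0 then Finsupp.single ([], []) 1 else
    if n = 1 then polyCoeff v - v ∅ ∅ • Finsupp.single ([], []) 1 else c n with hu
  have hux : ∀ n, wordPoly (fun x => gen (Sum.inl x)) (fun x => gen (Sum.inr x)) (u n) = x ^ n := by
    intro n
    rw [hu]
    dsimp only
    split_ifs with h0 h1
    · rw [h0, pow_zero, wordPoly_one]
    · rw [h1, pow_one, map_sub, map_smul, wordPoly_one, wordPoly_polyCoeff]
    · exact hc n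
  refine ⟨m + 2, u, by omega, rfl, rfl, fun β N => ?_⟩
  set δ : ℂ := ((β / N : ℝ) : ℂ) with hδ
  set X : Fin N → Gr ((Fin N × I) ⊕ (Fin N × I)) := fun k =>
    normalPoly v (fun x => gen (Sum.inl (k, x))) (fun x => gen (Sum.inr (k, x))) - v ∅ ∅ • 1
    with hX
  have hXn : ∀ k, IsNilpotent (-δ • X k) := fun k =>
    (isNilpotent_normalPoly_sub_const hv (fun x => Sum.inl (k, x)) fun x => Sum.inr (k, x)).smul _
  have hXc : ∀ k l, Commute (-δ • X k) (-δ • X l) := fun k l =>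
    (Commute.smul_left ((normalPoly_sub_const_mem_even hv (fun x => Sum.inl (k, x))
      fun x => Sum.inr (k, x)).1 _) _)
  have hX0 : ∀ k, ExteriorAlgebra.algebraMapInv (X k) = 0 := fun k =>
    algebraMapInv_normalPoly_sub_const v (fun x => Sum.inl (k, x)) fun x => Sum.inr (k, x)
  have h1 : -interaction β v N = algebraMap ℂ _ (N * (-δ * v ∅ ∅)) + ∑ k, -δ • X k := by
    rw [interaction, ← Finset.smul_sum, hX, Finset.sum_sub_distrib, smul_sub, Finset.sum_const,
      Finset.card_univ, Fintype.card_fin, Algebra.algebraMap_eq_smul_one, neg_smul, neg_smul,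
      ← Nat.cast_smul_eq_nsmul ℂ, smul_smul, smul_smul]
    rw [sub_neg_eq_add, add_comm, add_assoc, ← add_smul]
    rw [show δ * N * v ∅ ∅ + N * (-δ * v ∅ ∅) = 0 by ring, zero_smul, add_zero]
  have h2 : ExteriorAlgebra.algebraMapInv (-interaction β v N) = N * (-δ * v ∅ ∅) := by
    rw [h1, map_add, ExteriorAlgebra.algebraMap_leftInverse, map_sum]
    simp [hX0]
  have h3 : ∀ k, wordPoly (fun x => gen (Sum.inl (k, x))) (fun x => gen (Sum.inr (k, x)))
      (sliceCoeff u (m + 2) (v ∅ ∅) δ) = Complex.exp (-δ * v ∅ ∅) • nilExp (-δ • X k) := by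
    intro k
    have hφ : ∀ s : I ⊕ I, subst (fun s : I ⊕ I =>
        (Pi.single (Sum.map (fun x => (k, x)) (fun x => (k, x)) s) 1 :
          (Fin N × I) ⊕ (Fin N × I) → ℂ)) (gen s) =
        gen (Sum.map (fun x => (k, x)) (fun x => (k, x)) s) := fun s => subst_gen_single _ s
    have h7 : subst (fun s : I ⊕ I =>
        (Pi.single (Sum.map (fun x => (k, x)) (fun x => (k, x)) s) 1 :
          (Fin N × I) ⊕ (Fin N × I) → ℂ)) x = X k := by
      rw [hx, map_sub, map_smul, map_one, ← wordPoly_polyCoeff, map_wordPoly]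
      simp only [hφ, Sum.map_inl, Sum.map_inr, wordPoly_polyCoeff, hX]
    have h4 : ∀ n, wordPoly (fun x => gen (Sum.inl (k, x))) (fun x => gen (Sum.inr (k, x))) (u n) =
        X k ^ n := by
      intro n
      have h5 := fun w => map_wordPoly (subst (fun s : I ⊕ I =>
        (Pi.single (Sum.map (fun x => (k, x)) (fun x => (k, x)) s) 1 :
          (Fin N × I) ⊕ (Fin N × I) → ℂ))) (fun x => gen (Sum.inl x)) (fun x => gen (Sum.inr x)) w
      simp only [hφ, Sum.map_inl, Sum.map_inr] at h5
      rw [← h5, hux, map_pow, h7]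
    have h5 : (-δ • X k) ^ (m + 2) = 0 := by
      rw [smul_pow, ← h7, ← map_pow, pow_add x, hm', zero_mul, map_zero, smul_zero]
    rw [sliceCoeff, map_smul, map_sum, nilExp_eq_sum h5]
    congr 1
    refine Finset.sum_congr rfl fun n _ => ?_
    rw [map_smul, h4, smul_pow, smul_smul]
  rw [grExp, h2, h1, add_sub_cancel_left]
  have h6 : (∑ k, -δ • X k) = ∑ k ∈ (List.finRange N).reverse.toFinset, -δ • X k := by
    congr 1
    ext k
    simp
  rw [h6, nilExp_sum _ hXc hXn _ (List.nodup_reverse.2 (List.nodup_finRange N)), Complex.exp_nat_mul]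
  simp only [h3]
  rw [prod_map_smul]
  simp

end Slices

/-! ### Powers that converge to an exponential -/

section PowExp

variable {A : Type*} [NormedRing A] [NormedAlgebra ℂ A] [NormOneClass A]

theorem norm_pow_sub_pow_le {a b : A} {M : ℝ} (hM : 1 ≤ M) (ha : ‖a‖ ≤ M) (hb : ‖b‖ ≤ M) (n : ℕ) :
    ‖a ^ n - b ^ n‖ ≤ n * M ^ n * ‖a - b‖ := by
  induction n with
  | zero => simp
  | succ n ih =>
    have h1 : a ^ (n + 1) - b ^ (n + 1) = a ^ n * (a - b) + (a ^ n - b ^ n) * b := by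
      rw [mul_sub, sub_mul, pow_succ, pow_succ]
      abel
    have h2 : ‖a ^ n‖ ≤ M ^ n := (norm_pow_le a n).trans (pow_le_pow_left₀ (norm_nonneg _) ha n)
    have h3 : M ^ n ≤ M ^ (n + 1) := pow_le_pow_right₀ hM n.le_succ
    calc ‖a ^ (n + 1) - b ^ (n + 1)‖ ≤ ‖a ^ n‖ * ‖a - b‖ + ‖a ^ n - b ^ n‖ * ‖b‖ := by
          rw [h1]
          exact (norm_add_le _ _).trans (add_le_add (norm_mul_le _ _) (norm_mul_le _ _))
      _ ≤ M ^ (n + 1) * ‖a - b‖ + (n * M ^ n * ‖a - b‖) * M := by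
          gcongr
          exact h2.trans h3
      _ = _ := by
          push_cast
          ring

theorem exists_norm_le_exp {P : ℂ → A} {D : A} (h0 : P 0 = 1) (hP : HasDerivAt P D 0) :
    ∀ᶠ δ in 𝓝 (0 : ℂ), ‖P δ‖ ≤ Real.exp ((1 + ‖D‖) * ‖δ‖) := by
  have h1 := (hasDerivAt_iff_isLittleO.1 hP).def one_pos
  filter_upwards [h1] with δ hδ
  rw [h0, sub_zero, one_mul] at hδ
  calc ‖P δ‖ = ‖(P δ - 1 - δ • D) + (1 + δ • D)‖ := by
        congr 1
        abel
    _ ≤ ‖δ‖ + (1 + ‖δ‖ * ‖D‖) := by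
        refine (norm_add_le _ _).trans (add_le_add hδ ((norm_add_le _ _).trans ?_))
        rw [norm_one, norm_smul]
    _ = (1 + ‖D‖) * ‖δ‖ + 1 := by ring
    _ ≤ _ := Real.add_one_le_exp _

variable [CompleteSpace A]

/-- A curve through `1` with velocity `D`, iterated `n` times with time steps `t / (n + 2)`, converges
to `exp (t D)`. -/
theorem tendsto_pow_exp {P : ℂ → A} {D : A} (h0 : P 0 = 1) (hP : HasDerivAt P D 0) (t : ℂ) :
    Tendsto (fun n : ℕ => P (t / ((n : ℂ) + 2)) ^ n) atTop (𝓝 (NormedSpace.exp (t • D))) := by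
  let : NormedAlgebra ℚ A := NormedAlgebra.restrictScalars ℚ ℂ _
  set Q : ℂ → A := fun δ => NormedSpace.exp (δ • D) with hQ
  have hQ0 : Q 0 = 1 := by simp [hQ]
  have hQ' : HasDerivAt Q D 0 := by
    have := hasDerivAt_exp_smul_const (𝕂 := ℂ) D (0 : ℂ)
    rwa [zero_smul, NormedSpace.exp_zero, one_mul] at this
  have hn2 : ∀ n : ℕ, (n : ℂ) + 2 ≠ 0 := fun n => by
    exact_mod_cast (by omega : n + 2 ≠ 0)
  have hδ : Tendsto (fun n : ℕ => t / ((n : ℂ) + 2)) atTop (𝓝 0) := by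
    have h1 : Tendsto (fun n : ℕ => t / ((n : ℂ))) atTop (𝓝 0) := tendsto_const_div_atTop_nhds_zero_nat t
    have h2 := h1.comp (tendsto_add_atTop_nat 2)
    refine h2.congr fun n => ?_
    simp
  have h1 : Tendsto (fun n : ℕ => ((n : ℂ) + 2) • (P (t / ((n : ℂ) + 2)) - Q (t / ((n : ℂ) + 2))))
      atTop (𝓝 0) := by
    have h2 : (fun δ => P δ - Q δ) =o[𝓝 0] fun δ : ℂ => δ := by
      have := hasDerivAt_iff_isLittleO.1 (hP.sub hQ')
      simpa [h0, hQ0] using this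
    have h3 := h2.comp_tendsto hδ
    have h4 := (Asymptotics.isBigO_refl (fun n : ℕ => (n : ℂ) + 2) atTop).smul_isLittleO h3
    rw [← Asymptotics.isLittleO_one_iff ℂ]
    refine h4.trans_isBigO ?_
    have h5 : (fun n : ℕ => ((n : ℂ) + 2) • ((fun δ : ℂ => δ) ∘ fun n : ℕ => t / ((n : ℂ) + 2)) n) =
        fun _ => t := by
      funext n
      simp only [Function.comp, smul_eq_mul]
      rw [mul_div_cancel₀ _ (hn2 n)]
    rw [h5]
    exact Asymptotics.isBigO_const_const t one_ne_zero atTop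
  have h2 : Tendsto (fun n : ℕ => P (t / ((n : ℂ) + 2)) ^ n - Q (t / ((n : ℂ) + 2)) ^ n) atTop
      (𝓝 0) := by
    have h3 : Tendsto (fun n : ℕ => Real.exp ((1 + ‖D‖) * ‖t‖) *
        ‖((n : ℂ) + 2) • (P (t / ((n : ℂ) + 2)) - Q (t / ((n : ℂ) + 2)))‖) atTop (𝓝 0) := by
      have := (h1.norm).const_mul (Real.exp ((1 + ‖D‖) * ‖t‖))
      rwa [norm_zero, mul_zero] at this
    refine squeeze_zero_norm' ?_ h3
    filter_upwards [hδ.eventually (exists_norm_le_exp h0 hP),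
      hδ.eventually (exists_norm_le_exp hQ0 hQ')] with n hn hn'
    have hnorm : ‖(n : ℂ) + 2‖ = (n : ℝ) + 2 := by
      have : (n : ℂ) + 2 = ((n + 2 : ℕ) : ℂ) := by push_cast; rfl
      rw [this, Complex.norm_natCast]
      push_cast
      rfl
    have hnp : (0 : ℝ) < (n : ℝ) + 2 := by positivity
    refine (norm_pow_sub_pow_le (Real.one_le_exp (by positivity)) hn hn' n).trans ?_
    rw [norm_smul, hnorm, ← Real.exp_nat_mul, norm_div, hnorm]
    have h4 : (n : ℝ) * ((1 + ‖D‖) * (‖t‖ / ((n : ℝ) + 2))) ≤ (1 + ‖D‖) * ‖t‖ := by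
      have h5 : (n : ℝ) * (‖t‖ / ((n : ℝ) + 2)) ≤ ‖t‖ := by
        rw [← mul_div_assoc, div_le_iff₀ hnp]
        nlinarith [norm_nonneg t]
      calc (n : ℝ) * ((1 + ‖D‖) * (‖t‖ / ((n : ℝ) + 2)))
          = (1 + ‖D‖) * ((n : ℝ) * (‖t‖ / ((n : ℝ) + 2))) := by ring
        _ ≤ _ := by gcongr
    calc (n : ℝ) * Real.exp ((n : ℝ) * ((1 + ‖D‖) * (‖t‖ / ((n : ℝ) + 2)))) *
          ‖P (t / ((n : ℂ) + 2)) - Q (t / ((n : ℂ) + 2))‖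
        ≤ ((n : ℝ) + 2) * Real.exp ((1 + ‖D‖) * ‖t‖) *
          ‖P (t / ((n : ℂ) + 2)) - Q (t / ((n : ℂ) + 2))‖ := by
          gcongr
          linarith
      _ = _ := by ring
  have h3 : Tendsto (fun n : ℕ => Q (t / ((n : ℂ) + 2)) ^ n) atTop (𝓝 (NormedSpace.exp (t • D))) := by
    have h4 : Tendsto (fun n : ℕ => t - 2 * (t / ((n : ℂ) + 2))) atTop (𝓝 t) := by
      have := (hδ.const_mul 2).const_sub t
      rwa [mul_zero, sub_zero] at this
    have h5 := (NormedSpace.exp_continuous.tendsto (t • D)).comp (h4.smul_const D)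
    refine h5.congr fun n => ?_
    simp only [Function.comp, hQ]
    rw [← NormedSpace.exp_nsmul, ← Nat.cast_smul_eq_nsmul ℂ, smul_smul]
    congr 2
    have := hn2 n
    field_simp
    ring
  have h4 := h2.add h3
  rw [zero_add] at h4
  exact h4.congr fun n => sub_add_cancel _ _

end PowExp

/-! ### Shifts of the fermions by sources -/

section Shift

variable {I : Type*} [LinearOrder I] [Fintype I]

theorem wordPoly_conj {A : Type*} [Ring A] [Algebra ℂ A] {X Y : A} (hYX : Y * X = 1)
    (hXY : X * Y = 1) (a b : I → A) (c : List I × List I →₀ ℂ) :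
    wordPoly (fun x => X * a x * Y) (fun x => X * b x * Y) c = X * wordPoly a b c * Y := by
  have h : ∀ (a : I → A) (l : List I), (l.map fun x => X * a x * Y).prod = X * (l.map a).prod * Y := by
    intro a l
    induction l with
    | nil => simp [hXY]
    | cons x l ih =>
      rw [List.map_cons, List.prod_cons, ih, List.map_cons, List.prod_cons]
      calc X * a x * Y * (X * (l.map a).prod * Y) = X * a x * (Y * X) * (l.map a).prod * Y := by
            simp only [mul_assoc]
        _ = _ := by rw [hYX, mul_one, mul_assoc X]
  induction c using Finsupp.induction_linear with
  | zero => simp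
  | add c d hc hd => rw [map_add, map_add, hc, hd, mul_add, add_mul]
  | single w r =>
    rw [wordPoly_single, wordPoly_single, h, h, mul_smul_comm, smul_mul_assoc]
    congr 1
    calc X * (w.1.map a).prod * Y * (X * (w.2.map b).prod * Y) =
          X * (w.1.map a).prod * (Y * X) * (w.2.map b).prod * Y := by simp only [mul_assoc]
      _ = _ := by rw [hYX, mul_one, mul_assoc X]

/-- The telescoping product of interaction pictures. -/
theorem prod_interaction_picture {A : Type*} [Ring A] {U U' h h' : A} (hU : U' * U = 1)
    (hU' : U * U' = 1) (hh : h' * h = 1) (hh' : h * h' = 1) (W : A) (n : ℕ) :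
    ((List.finRange n).reverse.map fun j : Fin n =>
      U * (h ^ ((j : ℕ) + 2) * W * h' ^ ((j : ℕ) + 2)) * U').prod =
      U * (h ^ (n + 1) * (W * h') ^ n * h') * U' := by
  have hpow : ∀ n : ℕ, h' ^ n * h ^ n = 1 := by
    intro n
    induction n with
    | zero => simp
    | succ n ih => rw [pow_succ, pow_succ', mul_assoc, ← mul_assoc h', hh, one_mul, ih]
  induction n with
  | zero => simp [hh', hU']
  | succ n ih =>
    rw [List.finRange_succ_last, List.reverse_append, List.map_append, List.prod_append,
      ← List.map_reverse, List.map_map]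
    have h1 : ((fun j : Fin (n + 1) => U * (h ^ ((j : ℕ) + 2) * W * h' ^ ((j : ℕ) + 2)) * U') ∘
        Fin.castSucc) = fun j : Fin n => U * (h ^ ((j : ℕ) + 2) * W * h' ^ ((j : ℕ) + 2)) * U' := rfl
    rw [h1, ih]
    simp only [List.reverse_singleton, List.map_cons, List.map_nil, List.prod_cons, List.prod_nil,
      mul_one, Fin.val_last]
    calc U * (h ^ (n + 2) * W * h' ^ (n + 2)) * U' * (U * (h ^ (n + 1) * (W * h') ^ n * h') * U')
        = U * (h ^ (n + 2) * W * h' ^ (n + 2)) * (U' * U) *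
            (h ^ (n + 1) * (W * h') ^ n * h') * U' := by simp only [mul_assoc]
      _ = U * (h ^ (n + 2) * W * h' * (h' ^ (n + 1) * h ^ (n + 1)) * (W * h') ^ n * h') * U' := by
          rw [hU, mul_one, pow_succ' h' (n + 1)]
          simp only [mul_assoc]
      _ = _ := by
          rw [hpow, mul_one, pow_succ' (W * h')]
          simp only [mul_assoc]

theorem isNilpotent_srcPairing_aPlus (ε : ℝ) (p : I → I ⊕ I → ℂ) :
    IsNilpotent (srcPairing ε p (aPlus ε)) :=
  isNilpotent_srcPairing (aPlus_mem_odd ε) (aPlus_anticomm ε) p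

theorem isNilpotent_srcPairing_aMinus (ε : ℝ) (p : I → I ⊕ I → ℂ) :
    IsNilpotent (srcPairing ε p (aMinus ε)) :=
  isNilpotent_srcPairing (aMinus_mem_odd ε) (aMinus_anticomm ε) p

theorem commute_srcPairing_source {ε : ℝ} {a : I → Op I} (ha : ∀ x, a x ∈ opGrade I 1)
    (p : I → I ⊕ I → ℂ) (u : I ⊕ I → ℂ) :
    Commute (srcPairing ε p a) (srcHom I (ExteriorAlgebra.ι ℂ u)) := by
  have h := mul_srcHom_ι (n := 0) (X := srcPairing ε p a)
    (by simpa using sourceTerms_le (srcPairing_mem ha p)) u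
  simpa [Commute, SemiconjBy] using h

/-- The exponential of a source term shifts the operators by sources. -/
theorem nilExp_srcPairing_mul {ε : ℝ} (hε : 0 < ε) {a : I → Op I} (ha : ∀ x, a x ∈ opGrade I 1)
    {p : I → I ⊕ I → ℂ} (hn : IsNilpotent (srcPairing ε p a)) {b : Op I} (hb : b ∈ opGrade I 1)
    {s : I → ℂ} (h : ∀ x, a x * b + b * a x = ((ε : ℂ)⁻¹ * s x) • 1) :
    nilExp (srcPairing ε p a) * liftHom I b =
      (liftHom I b + srcHom I (ExteriorAlgebra.ι ℂ (∑ x, s x • p x))) *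
        nilExp (srcPairing ε p a) := by
  refine nilExp_mul_eq_add_mul hn ?_ (commute_srcPairing_source ha p _)
  have hε' : (ε : ℂ) ≠ 0 := Complex.ofReal_ne_zero.2 hε.ne'
  have h1 : ∀ x, srcHom I (ExteriorAlgebra.ι ℂ (p x)) * liftHom I (a x) * liftHom I b =
      liftHom I b * (srcHom I (ExteriorAlgebra.ι ℂ (p x)) * liftHom I (a x)) +
        ((ε : ℂ)⁻¹ * s x) • srcHom I (ExteriorAlgebra.ι ℂ (p x)) := by
    intro x
    rw [mul_assoc, ← map_mul (liftHom I), eq_sub_of_add_eq (h x), map_sub, map_smul, map_one,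
      mul_sub, mul_smul_comm, mul_one, map_mul, ← mul_assoc, ← mul_assoc,
      liftHom_mul_srcHom_ι hb, neg_mul]
    abel
  rw [srcPairing, smul_mul_assoc, Finset.sum_mul, Finset.sum_congr rfl fun x _ => h1 x,
    Finset.sum_add_distrib, smul_add, mul_smul_comm, Finset.mul_sum]
  congr 1
  rw [map_sum, map_sum, Finset.smul_sum]
  refine Finset.sum_congr rfl fun x _ => ?_
  rw [smul_smul, mul_inv_cancel_left₀ hε', map_smul, map_smul]

theorem aMinus_creation_anticomm {ε : ℝ} (hε : 0 < ε) (x : I) (u : I → ℂ) :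
    aMinus ε x * creation ε u + creation ε u * aMinus ε x = ((ε : ℂ)⁻¹ * u x) • 1 := by
  have := annihilation_creation_anticomm hε (Pi.single x 1) u
  rwa [annihilation_single, single_one_dotProduct] at this

theorem aPlus_annihilation_anticomm {ε : ℝ} (hε : 0 < ε) (x : I) (u : I → ℂ) :
    aPlus ε x * annihilation ε u + annihilation ε u * aPlus ε x = ((ε : ℂ)⁻¹ * u x) • 1 := by
  have := annihilation_creation_anticomm hε u (Pi.single x 1)
  rwa [creation_single, dotProduct_single_one, add_comm] at this

theorem aMinus_annihilation_anticomm (ε : ℝ) (x : I) (u : I → ℂ) :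
    aMinus ε x * annihilation ε u + annihilation ε u * aMinus ε x = 0 := by
  have := annihilation_anticomm ε (Pi.single x 1) u
  rwa [annihilation_single] at this

theorem aPlus_creation_anticomm (ε : ℝ) (x : I) (u : I → ℂ) :
    aPlus ε x * creation ε u + creation ε u * aPlus ε x = 0 := by
  have := creation_anticomm ε (Pi.single x 1) u
  rwa [creation_single] at this

theorem nilExp_aMinus_mul_creation {ε : ℝ} (hε : 0 < ε) (p : I → I ⊕ I → ℂ) (u : I → ℂ) :
    nilExp (srcPairing ε p (aMinus ε)) * liftHom I (creation ε u) =
      (liftHom I (creation ε u) + srcHom I (ExteriorAlgebra.ι ℂ (∑ x, u x • p x))) *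
        nilExp (srcPairing ε p (aMinus ε)) :=
  nilExp_srcPairing_mul hε (aMinus_mem_odd ε) (isNilpotent_srcPairing_aMinus ε p)
    (creation_mem_odd ε u) fun x => aMinus_creation_anticomm hε x u

theorem nilExp_aPlus_mul_annihilation {ε : ℝ} (hε : 0 < ε) (p : I → I ⊕ I → ℂ) (u : I → ℂ) :
    nilExp (srcPairing ε p (aPlus ε)) * liftHom I (annihilation ε u) =
      (liftHom I (annihilation ε u) + srcHom I (ExteriorAlgebra.ι ℂ (∑ x, u x • p x))) *
        nilExp (srcPairing ε p (aPlus ε)) :=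
  nilExp_srcPairing_mul hε (aPlus_mem_odd ε) (isNilpotent_srcPairing_aPlus ε p)
    (annihilation_mem_odd ε u) fun x => aPlus_annihilation_anticomm hε x u

theorem nilExp_aMinus_mul_annihilation {ε : ℝ} (hε : 0 < ε) (p : I → I ⊕ I → ℂ) (u : I → ℂ) :
    nilExp (srcPairing ε p (aMinus ε)) * liftHom I (annihilation ε u) =
      liftHom I (annihilation ε u) * nilExp (srcPairing ε p (aMinus ε)) := by
  have := nilExp_srcPairing_mul hε (aMinus_mem_odd ε) (isNilpotent_srcPairing_aMinus ε p)
    (annihilation_mem_odd ε u) (s := 0) fun x => by simp [aMinus_annihilation_anticomm ε x u]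
  simpa using this

theorem nilExp_aPlus_mul_creation {ε : ℝ} (hε : 0 < ε) (p : I → I ⊕ I → ℂ) (u : I → ℂ) :
    nilExp (srcPairing ε p (aPlus ε)) * liftHom I (creation ε u) =
      liftHom I (creation ε u) * nilExp (srcPairing ε p (aPlus ε)) := by
  have := nilExp_srcPairing_mul hε (aPlus_mem_odd ε) (isNilpotent_srcPairing_aPlus ε p)
    (creation_mem_odd ε u) (s := 0) fun x => by simp [aPlus_creation_anticomm ε x u]
  simpa using this

end Shift

/-! ### The operator form of the time slices -/

section OperatorSlices

open scoped Matrix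

variable {I : Type*} [LinearOrder I] [Fintype I]

/-- The imaginary time evolution `exp (z (a⁺, E a⁻))`. -/
noncomputable def heat (ε : ℝ) (E : Matrix I I ℂ) (z : ℂ) : SourceOp I :=
  liftHom I (NormedSpace.exp (z • quadOp ε E))

theorem heat_mul_heat_neg (ε : ℝ) (E : Matrix I I ℂ) (z : ℂ) : heat ε E z * heat ε E (-z) = 1 := by
  rw [heat, heat, ← map_mul (liftHom I), exp_smul_mul_exp_neg_smul, map_one]

theorem heat_neg_mul_heat (ε : ℝ) (E : Matrix I I ℂ) (z : ℂ) : heat ε E (-z) * heat ε E z = 1 := by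
  rw [heat, heat, ← map_mul (liftHom I), exp_neg_smul_mul_exp_smul, map_one]

theorem heat_pow (ε : ℝ) (E : Matrix I I ℂ) (z : ℂ) (n : ℕ) :
    heat ε E z ^ n = heat ε E (n * z) := by
  rw [heat, heat, ← map_pow, ← Matrix.exp_nsmul, ← Nat.cast_smul_eq_nsmul ℂ, smul_smul]

theorem heat_mul_source (ε : ℝ) (E : Matrix I I ℂ) (z : ℂ) (u : I ⊕ I → ℂ) :
    heat ε E z * srcHom I (ExteriorAlgebra.ι ℂ u) = srcHom I (ExteriorAlgebra.ι ℂ u) * heat ε E z :=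
  commute_liftHom_srcHom (exp_mem_even (Submodule.smul_mem _ _ (commute_parity_quadOp ε E))) u

theorem heat_mul_creation {ε : ℝ} (hε : 0 < ε) {E : Matrix I I ℂ} (hE : E.IsHermitian) (z : ℂ)
    (u : I → ℂ) : heat ε E z * liftHom I (creation ε u) =
      liftHom I (creation ε (NormedSpace.exp (z • E) *ᵥ u)) * heat ε E z := by
  rw [heat, ← map_mul (liftHom I), exp_quadOp_mul_creation hε hE, map_mul]

theorem heat_mul_annihilation {ε : ℝ} (hε : 0 < ε) {E : Matrix I I ℂ} (hE : E.IsHermitian) (z : ℂ)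
    (u : I → ℂ) : heat ε E z * liftHom I (annihilation ε u) =
      liftHom I (annihilation ε (u ᵥ* NormedSpace.exp (-z • E))) * heat ε E z := by
  rw [heat, ← map_mul (liftHom I), exp_quadOp_mul_annihilation hε hE, map_mul]

/-- The shift `-f_β(E)ᵀ c⁻` of the creation operators at the times before `β`. -/
noncomputable def barShift (β : ℝ) (E : Matrix I I ℂ) (x : I) : I ⊕ I → ℂ :=
  Sum.elim (fun y => -fermi β E y x) fun _ => 0

/-- The shift `-f_β(-E) c⁺` of the annihilation operators at the times after the first one, up to
time evolution by one step. -/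
noncomputable def psiShift (β : ℝ) (E : Matrix I I ℂ) (x : I) : I ⊕ I → ℂ :=
  Sum.elim (fun _ => 0) fun y => -fermi β (-E) x y

/-- The operator that implements the shift of the fermions by sources at intermediate times. -/
noncomputable def shiftOp (ε β : ℝ) (E : Matrix I I ℂ) (δ : ℂ) : SourceOp I :=
  nilExp (srcPairing ε (barShift β E) (aMinus ε)) *
    (heat ε E δ * nilExp (srcPairing ε (psiShift β E) (aPlus ε)) * heat ε E (-δ))

/-- The inverse of `shiftOp`. -/
noncomputable def shiftInv (ε β : ℝ) (E : Matrix I I ℂ) (δ : ℂ) : SourceOp I :=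
  heat ε E δ * nilExp (-srcPairing ε (psiShift β E) (aPlus ε)) * heat ε E (-δ) *
    nilExp (-srcPairing ε (barShift β E) (aMinus ε))

theorem shiftOp_mul_shiftInv (ε β : ℝ) (E : Matrix I I ℂ) (δ : ℂ) :
    shiftOp ε β E δ * shiftInv ε β E δ = 1 := by
  have h1 := nilExp_mul_neg (isNilpotent_srcPairing_aPlus ε (psiShift β E))
  have h2 := nilExp_mul_neg (isNilpotent_srcPairing_aMinus ε (barShift β E))
  set B := nilExp (srcPairing ε (psiShift β E) (aPlus ε))
  set B' := nilExp (-srcPairing ε (psiShift β E) (aPlus ε))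
  set A := nilExp (srcPairing ε (barShift β E) (aMinus ε))
  set A' := nilExp (-srcPairing ε (barShift β E) (aMinus ε))
  calc A * (heat ε E δ * B * heat ε E (-δ)) * (heat ε E δ * B' * heat ε E (-δ) * A')
      = A * (heat ε E δ * (B * (heat ε E (-δ) * heat ε E δ) * B') * heat ε E (-δ)) * A' := by
        simp only [mul_assoc]
    _ = 1 := by rw [heat_neg_mul_heat, mul_one, h1, mul_one, heat_mul_heat_neg, mul_one, h2]

theorem shiftInv_mul_shiftOp (ε β : ℝ) (E : Matrix I I ℂ) (δ : ℂ) :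
    shiftInv ε β E δ * shiftOp ε β E δ = 1 := by
  have h1 := nilExp_neg_mul (isNilpotent_srcPairing_aPlus ε (psiShift β E))
  have h2 := nilExp_neg_mul (isNilpotent_srcPairing_aMinus ε (barShift β E))
  set B := nilExp (srcPairing ε (psiShift β E) (aPlus ε))
  set B' := nilExp (-srcPairing ε (psiShift β E) (aPlus ε))
  set A := nilExp (srcPairing ε (barShift β E) (aMinus ε))
  set A' := nilExp (-srcPairing ε (barShift β E) (aMinus ε))
  calc heat ε E δ * B' * heat ε E (-δ) * A' * (A * (heat ε E δ * B * heat ε E (-δ)))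
      = heat ε E δ * (B' * (heat ε E (-δ) * (A' * A) * heat ε E δ) * B) * heat ε E (-δ) := by
        simp only [mul_assoc]
    _ = 1 := by
        rw [h2, mul_one, heat_neg_mul_heat, mul_one, h1, mul_one, heat_mul_heat_neg]

theorem shiftOp_mul_creation {ε : ℝ} (hε : 0 < ε) (β : ℝ) {E : Matrix I I ℂ} (hE : E.IsHermitian)
    (δ : ℂ) (u : I → ℂ) : shiftOp ε β E δ * liftHom I (creation ε u) * shiftInv ε β E δ =
      liftHom I (creation ε u) +
        srcHom I (ExteriorAlgebra.ι ℂ (∑ x, u x • barShift β E x)) := by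
  suffices h : shiftOp ε β E δ * liftHom I (creation ε u) = (liftHom I (creation ε u) +
      srcHom I (ExteriorAlgebra.ι ℂ (∑ x, u x • barShift β E x))) * shiftOp ε β E δ by
    rw [h, mul_assoc, shiftOp_mul_shiftInv, mul_one]
  have h1 := heat_mul_creation hε hE (-δ) u
  have h2 := nilExp_aPlus_mul_creation hε (psiShift β E) (NormedSpace.exp (-δ • E) *ᵥ u)
  have h3 := heat_mul_creation hε hE δ (NormedSpace.exp (-δ • E) *ᵥ u)
  rw [Matrix.mulVec_mulVec, exp_smul_mul_exp_neg_smul, Matrix.one_mulVec] at h3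
  have h4 := nilExp_aMinus_mul_creation hε (barShift β E) u
  rw [shiftOp, mul_assoc, mul_assoc _ _ (liftHom I (creation ε u)), h1, mul_assoc,
    ← mul_assoc (nilExp _) (liftHom I _), h2, ← mul_assoc (heat ε E δ),
    ← mul_assoc (heat ε E δ), h3, mul_assoc, mul_assoc, ← mul_assoc (nilExp _), h4]
  simp only [mul_assoc]

theorem shiftOp_mul_annihilation {ε : ℝ} (hε : 0 < ε) (β : ℝ) {E : Matrix I I ℂ}
    (hE : E.IsHermitian) (δ : ℂ) (u : I → ℂ) :
    shiftOp ε β E δ * liftHom I (annihilation ε u) * shiftInv ε β E δ =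
      liftHom I (annihilation ε u) + srcHom I (ExteriorAlgebra.ι ℂ
        (∑ x, (u ᵥ* NormedSpace.exp (δ • E)) x • psiShift β E x)) := by
  set w := u ᵥ* NormedSpace.exp (δ • E) with hw
  set c := srcHom I (ExteriorAlgebra.ι ℂ (∑ x, w x • psiShift β E x)) with hc
  suffices h : shiftOp ε β E δ * liftHom I (annihilation ε u) = (liftHom I (annihilation ε u) +
      c) * shiftOp ε β E δ by
    rw [h, mul_assoc, shiftOp_mul_shiftInv, mul_one]
  have h1 := heat_mul_annihilation hε hE (-δ) u
  rw [neg_neg, ← hw] at h1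
  have h2 := nilExp_aPlus_mul_annihilation hε (psiShift β E) w
  have h3 : heat ε E δ * (liftHom I (annihilation ε w) + c) =
      (liftHom I (annihilation ε u) + c) * heat ε E δ := by
    rw [mul_add, add_mul, heat_mul_annihilation hε hE, hc, heat_mul_source, hw,
      Matrix.vecMul_vecMul, exp_smul_mul_exp_neg_smul, Matrix.vecMul_one]
  have h4 : nilExp (srcPairing ε (barShift β E) (aMinus ε)) * (liftHom I (annihilation ε u) + c) =
      (liftHom I (annihilation ε u) + c) * nilExp (srcPairing ε (barShift β E) (aMinus ε)) := by
    rw [mul_add, add_mul, nilExp_aMinus_mul_annihilation hε,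
      (commute_nilExp_right (commute_srcPairing_source (aMinus_mem_odd ε) (barShift β E)
        (∑ x, w x • psiShift β E x)).symm).eq]
  rw [shiftOp, mul_assoc, mul_assoc _ _ (liftHom I (annihilation ε u)), h1, mul_assoc,
    ← mul_assoc (nilExp _) (liftHom I _), h2, ← hc, ← mul_assoc (heat ε E δ),
    ← mul_assoc (heat ε E δ), h3, mul_assoc, mul_assoc, ← mul_assoc (nilExp _), h4]
  simp only [mul_assoc]

variable {N : ℕ}

theorem liftHom_timeOp_inl {ε : ℝ} (hε : 0 < ε) (β : ℝ) {E : Matrix I I ℂ} (hE : E.IsHermitian)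
    (k : Fin N) (x : I) : liftHom I (timeOp ε β E (Sum.inl (k, x))) =
      heat ε E (time β N k) * liftHom I (aPlus ε x) * heat ε E (-(time β N k : ℂ)) := by
  rw [← creation_single, heat_mul_creation hε hE, mul_assoc, heat_mul_heat_neg, mul_one]
  rfl

theorem liftHom_timeOp_inr {ε : ℝ} (hε : 0 < ε) (β : ℝ) {E : Matrix I I ℂ} (hE : E.IsHermitian)
    (k : Fin N) (x : I) : liftHom I (timeOp ε β E (Sum.inr (k, x))) =
      heat ε E (time β N k) * liftHom I (aMinus ε x) * heat ε E (-(time β N k : ℂ)) := by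
  rw [← annihilation_single, heat_mul_annihilation hε hE, mul_assoc, heat_mul_heat_neg, mul_one]
  rfl

theorem etaBar_eq {β : ℝ} (hβ : 0 < β) {E : Matrix I I ℂ} (hE : E.IsHermitian) {k : Fin N}
    (hk : (k : ℕ) + 1 < N) (x : I) : etaBar β E N (k, x) =
      ∑ z, (NormedSpace.exp ((time β N k : ℂ) • E) *ᵥ Pi.single x 1) z • barShift β E z := by
  have hN : (0 : ℝ) < N := Nat.cast_pos.2 k.pos
  have h0 : 0 < β - time β N k := by
    rw [time, sub_pos, mul_div_assoc', div_lt_iff₀ hN, mul_comm]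
    gcongr
    exact_mod_cast hk
  have h1 : fermi β (-E) * NormedSpace.exp (-((β - time β N k : ℝ) : ℂ) • E) =
      fermi β E * NormedSpace.exp ((time β N k : ℂ) • E) := by
    rw [← fermi_neg_mul_exp hE, mul_assoc, ← exp_smul_add]
    congr 3
    push_cast
    ring
  funext s
  rw [Finset.sum_apply]
  rcases s with y | y
  · simp only [etaBar, twoPoint, if_pos h0, h1, barShift, Sum.elim_inl, Pi.smul_apply,
      Matrix.transpose_apply, Matrix.neg_apply, Matrix.mul_apply, smul_eq_mul,
      Matrix.mulVec_single_one, Matrix.col_apply]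
    rw [← Finset.sum_neg_distrib]
    exact Finset.sum_congr rfl fun z _ => by ring
  · simp [etaBar, barShift]

theorem eta_eq {β : ℝ} (hβ : 0 < β) {E : Matrix I I ℂ} (hE : E.IsHermitian) {k : Fin N}
    (hk : 0 < (k : ℕ)) (x : I) : eta β E N (k, x) =
      ∑ z, ((Pi.single x 1 ᵥ* NormedSpace.exp (-(time β N k : ℂ) • E)) ᵥ*
        NormedSpace.exp (((β / N : ℝ) : ℂ) • E)) z • psiShift β E z := by
  have hN : (0 : ℝ) < N := Nat.cast_pos.2 k.pos
  have h0 : 0 < time β N k - β / N := by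
    rw [time, add_mul, one_mul, add_sub_cancel_right]
    exact mul_pos (Nat.cast_pos.2 hk) (div_pos hβ hN)
  have h1 : NormedSpace.exp (-(time β N k : ℂ) • E) * NormedSpace.exp (((β / N : ℝ) : ℂ) • E) *
      fermi β (-E) = fermi β (-E) *
        NormedSpace.exp (-((time β N k - β / N : ℝ) : ℂ) • E) := by
    have h2 : Commute (fermi β (-E)) (NormedSpace.exp (-((time β N k - β / N : ℝ) : ℂ) • E)) := by
      rw [fermi_neg hE]
      exact (Commute.one_left _).sub_left (commute_fermi_exp hE β _)
    rw [h2.eq, ← exp_smul_add]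
    congr 3
    push_cast
    ring
  funext s
  rw [Finset.sum_apply, Matrix.vecMul_vecMul]
  rcases s with y | y
  · simp [eta, psiShift]
  · simp only [eta, twoPoint, if_pos h0, ← h1, psiShift, Sum.elim_inr, Pi.smul_apply,
      Matrix.neg_apply, smul_eq_mul, Matrix.single_one_vecMul, Matrix.row_apply]
    rw [Matrix.mul_apply, ← Finset.sum_neg_distrib]
    exact Finset.sum_congr rfl fun z _ => by ring

/-- Before the time `β`, the source in a creation operator is produced by conjugation. -/
theorem shiftedOp_inl {ε β : ℝ} (hε : 0 < ε) (hβ : 0 < β) {E : Matrix I I ℂ} (hE : E.IsHermitian)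
    {k : Fin N} (hk : (k : ℕ) + 1 < N) (x : I) :
    shiftedOp ε β E (Sum.elim (etaBar β E N) (eta β E N)) (Sum.inl (k, x)) =
      shiftOp ε β E ((β / N : ℝ) : ℂ) * (heat ε E (time β N k) * liftHom I (aPlus ε x) *
        heat ε E (-(time β N k : ℂ))) * shiftInv ε β E ((β / N : ℝ) : ℂ) := by
  rw [← liftHom_timeOp_inl hε β hE, shiftedOp, Sum.elim_inl, etaBar_eq hβ hE hk, timeOp,
    shiftOp_mul_creation hε β hE]

/-- After the first time, the source in an annihilation operator is produced by conjugation. -/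
theorem shiftedOp_inr {ε β : ℝ} (hε : 0 < ε) (hβ : 0 < β) {E : Matrix I I ℂ} (hE : E.IsHermitian)
    {k : Fin N} (hk : 0 < (k : ℕ)) (x : I) :
    shiftedOp ε β E (Sum.elim (etaBar β E N) (eta β E N)) (Sum.inr (k, x)) =
      shiftOp ε β E ((β / N : ℝ) : ℂ) * (heat ε E (time β N k) * liftHom I (aMinus ε x) *
        heat ε E (-(time β N k : ℂ))) * shiftInv ε β E ((β / N : ℝ) : ℂ) := by
  rw [← liftHom_timeOp_inr hε β hE, shiftedOp, Sum.elim_inr, eta_eq hβ hE hk, timeOp,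
    shiftOp_mul_annihilation hε β hE]

/-- The polynomial `c` in the shifted operators of one time slice. -/
noncomputable def sliceOp (ε β : ℝ) (E : Matrix I I ℂ) (c : List I × List I →₀ ℂ) (k : Fin N) :
    SourceOp I :=
  wordPoly (fun x => shiftedOp ε β E (Sum.elim (etaBar β E N) (eta β E N)) (Sum.inl (k, x)))
    (fun x => shiftedOp ε β E (Sum.elim (etaBar β E N) (eta β E N)) (Sum.inr (k, x))) c

theorem sliceOp_eq {ε β : ℝ} (hε : 0 < ε) (hβ : 0 < β) {E : Matrix I I ℂ} (hE : E.IsHermitian)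
    (c : List I × List I →₀ ℂ) {k : Fin N} (hk : 0 < (k : ℕ)) (hk' : (k : ℕ) + 1 < N) :
    sliceOp ε β E c k = shiftOp ε β E ((β / N : ℝ) : ℂ) * (heat ε E (time β N k) *
      liftHom I (wordPoly (aPlus ε) (aMinus ε) c) * heat ε E (-(time β N k : ℂ))) *
        shiftInv ε β E ((β / N : ℝ) : ℂ) := by
  rw [sliceOp]
  simp only [shiftedOp_inl hε hβ hE hk', shiftedOp_inr hε hβ hE hk]
  rw [wordPoly_conj (shiftInv_mul_shiftOp _ _ _ _) (shiftOp_mul_shiftInv _ _ _ _),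
    wordPoly_conj (heat_neg_mul_heat _ _ _) (heat_mul_heat_neg _ _ _), ← map_wordPoly]

/-- The product over all time slices, written with powers of the transfer operator. -/
theorem prod_sliceOp {ε β : ℝ} (hε : 0 < ε) (hβ : 0 < β) {E : Matrix I I ℂ} (hE : E.IsHermitian)
    (c : List I × List I →₀ ℂ) {n : ℕ} {δ : ℂ} (hδ : δ = ((β / (n + 2 : ℕ) : ℝ) : ℂ)) :
    ((List.finRange (n + 2)).reverse.map (sliceOp ε β E c)).prod =
      sliceOp ε β E c (Fin.last (n + 1)) * (shiftOp ε β E δ * (heat ε E ((n + 1 : ℕ) * δ) *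
        (liftHom I (wordPoly (aPlus ε) (aMinus ε) c) * heat ε E (-δ)) ^ n * heat ε E (-δ)) *
          shiftInv ε β E δ) * sliceOp ε β E c (0 : Fin (n + 2)) := by
  have h0 : (List.finRange (n + 2)).reverse = Fin.last (n + 1) ::
      ((List.finRange n).reverse.map (Fin.castSucc ∘ Fin.succ) ++ [(0 : Fin (n + 2))]) := by
    rw [List.finRange_succ_last, List.finRange_succ, List.map_cons, List.map_map,
      List.reverse_append, List.reverse_cons, List.reverse_cons, List.map_reverse]
    rfl
  rw [h0, List.map_cons, List.prod_cons, List.map_append, List.prod_append, List.map_map]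
  have h1 : ∀ j : Fin n, sliceOp ε β E c (Fin.castSucc (Fin.succ j)) = shiftOp ε β E δ *
      (heat ε E δ ^ ((j : ℕ) + 2) * liftHom I (wordPoly (aPlus ε) (aMinus ε) c) *
        heat ε E (-δ) ^ ((j : ℕ) + 2)) * shiftInv ε β E δ := by
    intro j
    have h2 : (time β (n + 2) (Fin.castSucc (Fin.succ j)) : ℂ) = ((j : ℕ) + 2 : ℕ) * δ := by
      rw [hδ, time]
      simp only [Fin.val_castSucc, Fin.val_succ]
      push_cast
      ring
    rw [sliceOp_eq hε hβ hE c (by simp) (by simp), h2, ← hδ, ← mul_neg, ← heat_pow, ← heat_pow]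
  have h3 : (sliceOp ε β E c ∘ (Fin.castSucc ∘ Fin.succ) : Fin n → SourceOp I) = fun j : Fin n =>
      shiftOp ε β E δ * (heat ε E δ ^ ((j : ℕ) + 2) * liftHom I (wordPoly (aPlus ε) (aMinus ε) c) *
        heat ε E (-δ) ^ ((j : ℕ) + 2)) * shiftInv ε β E δ := funext h1
  rw [h3, prod_interaction_picture (shiftInv_mul_shiftOp _ _ _ _) (shiftOp_mul_shiftInv _ _ _ _)
    (heat_neg_mul_heat _ _ _) (heat_mul_heat_neg _ _ _), heat_pow]
  simp [mul_assoc]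

end OperatorSlices

/-! ### The limit of small time steps -/

section Limit

open scoped Matrix.Norms.Operator

variable {I : Type*} [LinearOrder I] [Fintype I]

/-- The canonical topology of the finite dimensional space of operators with Grassmann
coefficients. -/
noncomputable instance sourceOp_topologicalSpace : TopologicalSpace (SourceOp I) :=
  moduleTopology ℂ (SourceOp I)

instance sourceOp_isModuleTopology : IsModuleTopology ℂ (SourceOp I) := ⟨rfl⟩

instance sourceOp_isTopologicalRing : IsTopologicalRing (SourceOp I) :=
  IsModuleTopology.isTopologicalRing ℂ (SourceOp I)

theorem continuous_liftHom : Continuous (liftHom I) :=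
  LinearMap.continuous_of_finiteDimensional (liftHom I).toLinearMap

theorem continuous_heat (ε : ℝ) (E : Matrix I I ℂ) : Continuous (heat ε E) := by
  let : NormedAlgebra ℚ (Op I) := NormedAlgebra.restrictScalars ℚ ℂ _
  exact continuous_liftHom.comp (NormedSpace.exp_continuous.comp
    (continuous_id.smul continuous_const))

theorem heat_zero (ε : ℝ) (E : Matrix I I ℂ) : heat ε E 0 = 1 := by
  rw [heat, zero_smul, NormedSpace.exp_zero, map_one]

theorem continuous_shiftOp (ε β : ℝ) (E : Matrix I I ℂ) : Continuous (shiftOp ε β E) :=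
  continuous_const.mul (((continuous_heat ε E).mul continuous_const).mul
    ((continuous_heat ε E).comp continuous_neg))

theorem continuous_shiftInv (ε β : ℝ) (E : Matrix I I ℂ) : Continuous (shiftInv ε β E) :=
  (((continuous_heat ε E).mul continuous_const).mul
    ((continuous_heat ε E).comp continuous_neg)).mul continuous_const

theorem wordPoly_sliceCoeff {A : Type*} [Ring A] [Algebra ℂ A] (a b : I → A)
    (u : ℕ → List I × List I →₀ ℂ) (m : ℕ) (v₀ δ : ℂ) : wordPoly a b (sliceCoeff u m v₀ δ) =
      Complex.exp (-δ * v₀) • ∑ n ∈ Finset.range m,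
        ((n.factorial : ℂ)⁻¹ * (-δ) ^ n) • wordPoly a b (u n) := by
  simp only [sliceCoeff, map_smul, map_sum]

/-- The Boltzmann factor of a single time slice converges to one. -/
theorem tendsto_wordPoly_sliceCoeff {a b : ℕ → I → SourceOp I} {a' b' : I → SourceOp I}
    (ha : ∀ x, Tendsto (fun n => a n x) atTop (𝓝 (a' x)))
    (hb : ∀ x, Tendsto (fun n => b n x) atTop (𝓝 (b' x))) {u : ℕ → List I × List I →₀ ℂ} {m : ℕ}
    (hm : 2 ≤ m) (hu : u 0 = Finsupp.single ([], []) 1) (v₀ : ℂ) {δ : ℕ → ℂ}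
    (hδ : Tendsto δ atTop (𝓝 0)) :
    Tendsto (fun n => wordPoly (a n) (b n) (sliceCoeff u m v₀ (δ n))) atTop (𝓝 1) := by
  have h1 : ∀ c : List I × List I →₀ ℂ, Tendsto (fun n => wordPoly (a n) (b n) c) atTop
      (𝓝 (wordPoly a' b' c)) := by
    intro c
    refine tendsto_finsetSum _ fun w _ => Tendsto.const_smul (Tendsto.mul ?_ ?_) _
    · exact tendsto_list_prod _ fun x _ => ha x
    · exact tendsto_list_prod _ fun x _ => hb x
  have h2 : Tendsto (fun n => wordPoly (a n) (b n) (sliceCoeff u m v₀ (δ n))) atTop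
      (𝓝 (wordPoly a' b' (sliceCoeff u m v₀ 0))) := by
    simp only [wordPoly_sliceCoeff]
    refine Tendsto.smul ?_ (tendsto_finsetSum _ fun k _ => Tendsto.smul ?_ (h1 _))
    · exact (Complex.continuous_exp.tendsto _).comp (hδ.neg.mul_const _)
    · exact (hδ.neg.pow k).const_mul _
  have h3 : wordPoly a' b' (sliceCoeff u m v₀ 0) = 1 := by
    rw [wordPoly_sliceCoeff, Finset.sum_eq_single_of_mem 0 (by simp; omega)]
    · simp [hu, wordPoly_one]
    · intro k _ hk
      simp [hk]
  rwa [h3] at h2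

theorem hasDerivAt_series_term (n : ℕ) : HasDerivAt (fun z : ℂ => (n.factorial : ℂ)⁻¹ * (-z) ^ n)
    (if n = 1 then -1 else 0) 0 := by
  have h := (((hasDerivAt_neg (0 : ℂ)).fun_pow n).const_mul (n.factorial : ℂ)⁻¹)
  refine h.congr_deriv ?_
  rcases n with _ | _ | n
  · simp
  · simp
  · simp

/-- The transfer operator of one time step is the identity up to first order, with velocity
`-(V + (a⁺, E a⁻))`. -/
theorem hasDerivAt_transfer (ε : ℝ) (E : Matrix I I ℂ) {v : Finset I → Finset I → ℂ} {V : Op I}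
    (hvV : normalPoly v (aPlus ε) (aMinus ε) = V) {u : ℕ → List I × List I →₀ ℂ} {m : ℕ}
    (hm : 2 ≤ m) (hu : u 0 = Finsupp.single ([], []) 1)
    (hu1 : u 1 = polyCoeff v - v ∅ ∅ • Finsupp.single ([], []) 1) :
    HasDerivAt (fun z : ℂ => wordPoly (aPlus ε) (aMinus ε) (sliceCoeff u m (v ∅ ∅) z) *
      NormedSpace.exp (-z • quadOp ε E)) (-(quadOp ε E + V)) 0 := by
  set W : ℕ → Op I := fun n => wordPoly (aPlus ε) (aMinus ε) (u n) with hW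
  have hW0 : W 0 = 1 := by rw [hW]; dsimp only; rw [hu, wordPoly_one]
  have hW1 : W 1 = V - v ∅ ∅ • 1 := by
    rw [hW]
    dsimp only
    rw [hu1, map_sub, map_smul, wordPoly_one, wordPoly_polyCoeff, hvV]
  have h1 : HasDerivAt (fun z : ℂ => ∑ n ∈ Finset.range m,
      ((n.factorial : ℂ)⁻¹ * (-z) ^ n) • W n) (-W 1) 0 := by
    have h2 : HasDerivAt (fun z : ℂ => ∑ n ∈ Finset.range m,
        ((n.factorial : ℂ)⁻¹ * (-z) ^ n) • W n)
        (∑ n ∈ Finset.range m, (if n = 1 then (-1 : ℂ) else 0) • W n) 0 :=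
      HasDerivAt.fun_sum fun n _ => (hasDerivAt_series_term n).smul_const (W n)
    rw [Finset.sum_eq_single_of_mem 1 (by simp; omega)] at h2
    · simpa using h2
    · intro n _ hn
      rw [if_neg hn, zero_smul]
  have h2 : HasDerivAt (fun z : ℂ => Complex.exp (-z * v ∅ ∅)) (-v ∅ ∅) 0 := by
    have := ((hasDerivAt_neg (0 : ℂ)).mul_const (v ∅ ∅)).cexp
    simpa using this
  have h3 := h2.smul h1
  have h4 : HasDerivAt (fun z : ℂ => NormedSpace.exp (-z • quadOp ε E)) (-quadOp ε E) 0 := by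
    have := hasDerivAt_exp_smul_const (𝕂 := ℂ) (-quadOp ε E) (0 : ℂ)
    rw [zero_smul, NormedSpace.exp_zero, one_mul] at this
    have e : (fun z : ℂ => NormedSpace.exp (-z • quadOp ε E)) =
        fun z : ℂ => NormedSpace.exp (z • -quadOp ε E) := by
      funext z
      rw [smul_neg, neg_smul]
    rw [e]
    exact this
  have h5 : ∑ n ∈ Finset.range m, ((n.factorial : ℂ)⁻¹ * (-0) ^ n) • W n = 1 := by
    rw [Finset.sum_eq_single_of_mem 0 (by simp; omega)]
    · simp [hW0]
    · intro k _ hk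
      simp [hk]
  have h6 := h3.mul h4
  simp only [wordPoly_sliceCoeff]
  refine h6.congr_deriv ?_
  simp only [Pi.smul_apply', h5, hW1]
  simp
  abel

theorem transfer_zero (ε : ℝ) (E : Matrix I I ℂ) {u : ℕ → List I × List I →₀ ℂ} {m : ℕ}
    (hm : 2 ≤ m) (hu : u 0 = Finsupp.single ([], []) 1) (v₀ : ℂ) :
    wordPoly (aPlus ε) (aMinus ε) (sliceCoeff u m v₀ 0) *
      NormedSpace.exp (-(0 : ℂ) • quadOp ε E) = 1 := by
  rw [wordPoly_sliceCoeff, Finset.sum_eq_single_of_mem 0 (by simp; omega)]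
  · simp [hu, wordPoly_one]
  · intro k _ hk
    simp [hk]

/-- The product over the time slices converges to the Boltzmann operator of the interacting system
in the interaction picture, conjugated with the shift by the sources. -/
theorem tendsto_prod_sliceOp {ε β : ℝ} (hε : 0 < ε) (hβ : 0 < β) {E : Matrix I I ℂ}
    (hE : E.IsHermitian) {v : Finset I → Finset I → ℂ} {V : Op I}
    (hvV : normalPoly v (aPlus ε) (aMinus ε) = V) {u : ℕ → List I × List I →₀ ℂ} {m : ℕ}
    (hm : 2 ≤ m) (hu : u 0 = Finsupp.single ([], []) 1)
    (hu1 : u 1 = polyCoeff v - v ∅ ∅ • Finsupp.single ([], []) 1) :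
    Tendsto (fun N : ℕ => ((List.finRange N).reverse.map (sliceOp ε β E
      (sliceCoeff u m (v ∅ ∅) ((β / N : ℝ) : ℂ)))).prod) atTop
      (𝓝 (shiftOp ε β E 0 * (heat ε E β * liftHom I (NormedSpace.exp (-(β : ℂ) • (quadOp ε E + V)))) *
        shiftInv ε β E 0)) := by
  rw [← tendsto_add_atTop_iff_nat 2]
  set δ : ℕ → ℂ := fun n => ((β / (n + 2 : ℕ) : ℝ) : ℂ) with hδ
  have hn2 : ∀ n : ℕ, (n : ℂ) + 2 ≠ 0 := fun n => by
    exact_mod_cast (by omega : n + 2 ≠ 0)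
  have hδ' : ∀ n, δ n = (β : ℂ) / ((n : ℂ) + 2) := by
    intro n
    rw [hδ]
    push_cast
    rfl
  have hδ0 : Tendsto δ atTop (𝓝 0) := by
    have h1 := (tendsto_const_div_atTop_nhds_zero_nat (β : ℂ)).comp (tendsto_add_atTop_nat 2)
    refine h1.congr fun n => ?_
    rw [hδ']
    simp
  have hh : ∀ {f : ℕ → ℂ} {z : ℂ}, Tendsto f atTop (𝓝 z) →
      Tendsto (fun n => heat ε E (f n)) atTop (𝓝 (heat ε E z)) := fun h =>
    ((continuous_heat ε E).tendsto _).comp h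
  have hU : Tendsto (fun n => shiftOp ε β E (δ n)) atTop (𝓝 (shiftOp ε β E 0)) :=
    ((continuous_shiftOp ε β E).tendsto _).comp hδ0
  have hU' : Tendsto (fun n => shiftInv ε β E (δ n)) atTop (𝓝 (shiftInv ε β E 0)) :=
    ((continuous_shiftInv ε β E).tendsto _).comp hδ0
  have htl : ∀ n, time β (n + 2) (Fin.last (n + 1)) = β := by
    intro n
    rw [time, Fin.val_last]
    push_cast
    field_simp
    ring
  have ht0 : ∀ n, (time β (n + 2) (0 : Fin (n + 2)) : ℂ) = δ n := by
    intro n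
    rw [hδ, time]
    simp
  have hmid : Tendsto (fun n : ℕ => (liftHom I (wordPoly (aPlus ε) (aMinus ε)
      (sliceCoeff u m (v ∅ ∅) (δ n))) * heat ε E (-δ n)) ^ n) atTop
      (𝓝 (liftHom I (NormedSpace.exp (-(β : ℂ) • (quadOp ε E + V))))) := by
    have h1 := tendsto_pow_exp (transfer_zero ε E hm hu (v ∅ ∅))
      (hasDerivAt_transfer ε E hvV hm hu hu1) (β : ℂ)
    rw [smul_neg, ← neg_smul] at h1
    refine ((continuous_liftHom.tendsto _).comp h1).congr fun n => ?_
    simp only [Function.comp, map_pow, map_mul, hδ']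
    rfl
  have hlast : Tendsto (fun n : ℕ => sliceOp ε β E (sliceCoeff u m (v ∅ ∅) (δ n))
      (Fin.last (n + 1))) atTop (𝓝 1) := by
    refine tendsto_wordPoly_sliceCoeff (a' := fun x => heat ε E β * liftHom I (aPlus ε x) *
      heat ε E (-(β : ℂ)) + srcHom I (ExteriorAlgebra.ι ℂ (Sum.elim
        (fun y => (twoPoint β E 0).transpose x y) fun _ => 0)))
      (b' := fun x => shiftOp ε β E 0 * (heat ε E β * liftHom I (aMinus ε x) *
        heat ε E (-(β : ℂ))) * shiftInv ε β E 0) (fun x => ?_) (fun x => ?_) hm hu (v ∅ ∅) hδ0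
    · refine tendsto_const_nhds.congr fun n => ?_
      rw [shiftedOp, liftHom_timeOp_inl hε β hE, htl, Sum.elim_inl]
      have h1 : etaBar β E (n + 2) (Fin.last (n + 1), x) = Sum.elim
          (fun y => (twoPoint β E 0).transpose x y) fun _ => 0 := by
        unfold etaBar
        rw [htl, sub_self]
      rw [h1]
    · refine ((hU.mul_const _).mul hU').congr fun n => ?_
      rw [shiftedOp_inr hε hβ hE (by simp), htl]
  have hfirst : Tendsto (fun n : ℕ => sliceOp ε β E (sliceCoeff u m (v ∅ ∅) (δ n))
      (0 : Fin (n + 2))) atTop (𝓝 1) := by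
    refine tendsto_wordPoly_sliceCoeff (a' := fun x => shiftOp ε β E 0 * (heat ε E 0 *
        liftHom I (aPlus ε x) * heat ε E (-0)) * shiftInv ε β E 0)
      (b' := fun x => heat ε E 0 * liftHom I (aMinus ε x) * heat ε E (-0) +
        srcHom I (ExteriorAlgebra.ι ℂ (Sum.elim (fun _ => 0) fun y => twoPoint β E 0 x y)))
      (fun x => ?_) (fun x => ?_) hm hu (v ∅ ∅) hδ0
    · refine ((hU.mul (((hh hδ0).mul_const _).mul (hh hδ0.neg))).mul hU').congr fun n => ?_
      rw [shiftedOp_inl hε hβ hE (by simp), ht0]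
    · refine ((((hh hδ0).mul_const _).mul (hh hδ0.neg)).add_const _).congr fun n => ?_
      rw [shiftedOp, liftHom_timeOp_inr hε β hE, ht0, Sum.elim_inr]
      have h1 : eta β E (n + 2) ((0 : Fin (n + 2)), x) = Sum.elim (fun _ => 0)
          fun y => twoPoint β E 0 x y := by
        unfold eta
        have h2 : time β (n + 2) (0 : Fin (n + 2)) - β / (n + 2 : ℕ) = 0 := by
          rw [time]
          simp
        rw [h2]
      rw [h1]
  have hβ' : Tendsto (fun n : ℕ => ((n + 1 : ℕ) : ℂ) * δ n) atTop (𝓝 (β : ℂ)) := by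
    have h1 := hδ0.const_sub (β : ℂ)
    rw [sub_zero] at h1
    refine h1.congr fun n => ?_
    have := hn2 n
    rw [hδ']
    push_cast
    field_simp
    ring
  have hall := (hlast.mul ((hU.mul (((hh hβ').mul hmid).mul (hh hδ0.neg))).mul hU')).mul hfirst
  rw [one_mul, mul_one, neg_zero, heat_zero, mul_one] at hall
  refine hall.congr fun n => ?_
  exact (prod_sliceOp hε hβ hE _ (hδ ▸ rfl)).symm

end Limit

/-! ### The trace of the limit -/

section Reduction

open scoped Matrix

variable {I : Type*} [LinearOrder I] [Fintype I]

theorem nilExp_semiconj {A : Type*} [Ring A] [Algebra ℂ A] {X Y Y' : A} (h : SemiconjBy X Y Y')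
    (hY : IsNilpotent Y) (hY' : IsNilpotent Y') : X * nilExp Y = nilExp Y' * X := by
  obtain ⟨k, hk⟩ := hY
  obtain ⟨m, hm⟩ := hY'
  rw [nilExp_eq_sum (k := k + m) (a := Y) (by rw [pow_add, hk, zero_mul]),
    nilExp_eq_sum (k := k + m) (a := Y') (by rw [pow_add, hm, mul_zero]), Finset.mul_sum,
    Finset.sum_mul]
  refine Finset.sum_congr rfl fun n _ => ?_
  rw [mul_smul_comm, smul_mul_assoc, (h.pow_right n).eq]

theorem srcPairing_add (ε : ℝ) (p q : I → I ⊕ I → ℂ) (a : I → Op I) :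
    srcPairing ε p a + srcPairing ε q a = srcPairing ε (p + q) a := by
  simp only [srcPairing, ← smul_add, ← Finset.sum_add_distrib, Pi.add_apply, map_add, add_mul]

theorem srcPairing_neg (ε : ℝ) (p : I → I ⊕ I → ℂ) (a : I → Op I) :
    -srcPairing ε p a = srcPairing ε (-p) a := by
  simp only [srcPairing, ← smul_neg, ← Finset.sum_neg_distrib, Pi.neg_apply, map_neg, neg_mul]

/-- Linear combinations of the operators in a source term can be moved to the sources. -/
theorem srcPairing_linear (ε : ℝ) (p : I → I ⊕ I → ℂ) (a : I → Op I) (M : Matrix I I ℂ) :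
    srcPairing ε p (fun x => ∑ y, M x y • a y) = srcPairing ε (fun y => ∑ x, M x y • p x) a := by
  rw [srcPairing, srcPairing]
  congr 1
  simp only [map_sum, map_smul, Finset.mul_sum, Finset.sum_mul, mul_smul_comm, smul_mul_assoc]
  exact Finset.sum_comm

theorem heat_mul_srcPairing {ε : ℝ} {E : Matrix I I ℂ} {z : ℂ} {a b : I → Op I}
    (h : ∀ x, heat ε E z * liftHom I (a x) = liftHom I (b x) * heat ε E z) (p : I → I ⊕ I → ℂ) :
    SemiconjBy (heat ε E z) (srcPairing ε p a) (srcPairing ε p b) := by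
  rw [SemiconjBy, srcPairing, srcPairing, mul_smul_comm, smul_mul_assoc, Finset.mul_sum,
    Finset.sum_mul]
  congr 1
  refine Finset.sum_congr rfl fun x _ => ?_
  rw [← mul_assoc, heat_mul_source, mul_assoc, h, mul_assoc]

theorem heat_mul_nilExp_aMinus {ε : ℝ} (hε : 0 < ε) {E : Matrix I I ℂ} (hE : E.IsHermitian)
    (z : ℂ) (p : I → I ⊕ I → ℂ) : heat ε E z * nilExp (srcPairing ε p (aMinus ε)) =
      nilExp (srcPairing ε (fun y => ∑ x, NormedSpace.exp (-z • E) x y • p x) (aMinus ε)) *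
        heat ε E z := by
  refine nilExp_semiconj ?_ (isNilpotent_srcPairing_aMinus ε _) (isNilpotent_srcPairing_aMinus ε _)
  rw [← srcPairing_linear]
  refine heat_mul_srcPairing (fun x => ?_) p
  have h := heat_mul_annihilation hε hE z (Pi.single x 1)
  rw [annihilation_single, Matrix.single_one_vecMul] at h
  exact h

theorem heat_mul_nilExp_aPlus {ε : ℝ} (hε : 0 < ε) {E : Matrix I I ℂ} (hE : E.IsHermitian)
    (z : ℂ) (p : I → I ⊕ I → ℂ) : heat ε E z * nilExp (srcPairing ε p (aPlus ε)) =
      nilExp (srcPairing ε (fun y => ∑ x, NormedSpace.exp (z • E) y x • p x) (aPlus ε)) *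
        heat ε E z := by
  refine nilExp_semiconj ?_ (isNilpotent_srcPairing_aPlus ε _) (isNilpotent_srcPairing_aPlus ε _)
  have h1 := srcPairing_linear ε p (aPlus ε) (NormedSpace.exp (z • E)).transpose
  simp only [Matrix.transpose_apply] at h1
  rw [← h1]
  refine heat_mul_srcPairing (fun x => ?_) p
  have h := heat_mul_creation hε hE z (Pi.single x 1)
  rw [creation_single, Matrix.mulVec_single_one] at h
  exact h

theorem matApply_cPlus (M : Matrix I I ℂ) (x : I) :
    matApply M (cPlus (I := I)) x = ExteriorAlgebra.ι ℂ (Sum.elim (fun _ => 0) (M x)) := by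
  rw [ι_eq_sum_gen, Fintype.sum_sum_type]
  simp [matApply, cPlus]

theorem pairing_cMinus_eq (ε : ℝ) (M : Matrix I I ℂ) : pairing ε cMinus (matApply M cPlus) =
    (ε : ℂ) • ∑ x : I, ExteriorAlgebra.ι ℂ (Pi.single (Sum.inl x) 1 : I ⊕ I → ℂ) *
      ExteriorAlgebra.ι ℂ (Sum.elim (fun _ => 0) (M x)) := by
  simp only [pairing, matApply_cPlus]
  rfl

theorem isNilpotent_pairing (ε : ℝ) (M : Matrix I I ℂ) :
    IsNilpotent (pairing ε cMinus (matApply M cPlus) : Gr (I ⊕ I)) := by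
  rw [pairing_cMinus_eq]
  refine IsNilpotent.smul (Commute.isNilpotent_sum (fun x _ => ⟨2, ?_⟩) fun x y _ _ =>
    (ι_mul_ι_mem_evenElements _ _).1 _) _
  have h := (ι_mul_ι_mem_evenElements (Pi.single (Sum.inl x) 1 : I ⊕ I → ℂ)
    (Sum.elim (fun _ => 0) (M x))).1 (ExteriorAlgebra.ι ℂ (Pi.single (Sum.inl x) 1))
  rw [pow_two, ← mul_assoc, h, ← mul_assoc, ExteriorAlgebra.ι_sq_zero, zero_mul, zero_mul]

theorem commute_srcHom_pairing (ε : ℝ) (M : Matrix I I ℂ) (X : SourceOp I) :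
    Commute (srcHom I (pairing ε cMinus (matApply M cPlus))) X := by
  rw [pairing_cMinus_eq]
  refine commute_srcHom_even (Subalgebra.smul_mem _ (Subalgebra.sum_mem _ fun x _ =>
    ι_mul_ι_mem_evenElements _ _) _) (Submodule.smul_mem _ _ (Submodule.sum_mem _ fun x _ => ?_)) X
  have := SetLike.mul_mem_graded (ι_mem_grGrade (Pi.single (Sum.inl x) 1 : I ⊕ I → ℂ))
    (ι_mem_grGrade (Sum.elim (fun _ => 0) (M x)))
  rwa [show (1 : ZMod 2) + 1 = 0 by decide] at this

theorem algebraMapInv_pairing (ε : ℝ) (M : Matrix I I ℂ) :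
    ExteriorAlgebra.algebraMapInv (pairing ε cMinus (matApply M cPlus) : Gr (I ⊕ I)) = 0 := by
  rw [pairing, map_smul, map_sum, Finset.sum_eq_zero, smul_zero]
  intro x _
  rw [map_mul, cMinus, algebraMapInv_gen, zero_mul]

/-- The commutator of two source terms with conjugate operators is a product of sources. -/
theorem srcPairing_mul_srcPairing {ε : ℝ} (hε : 0 < ε) (p q : I → I ⊕ I → ℂ) :
    srcPairing ε p (aMinus ε) * srcPairing ε q (aPlus ε) =
      srcPairing ε q (aPlus ε) * srcPairing ε p (aMinus ε) +
        srcHom I (-((ε : ℂ) • ∑ x, ExteriorAlgebra.ι ℂ (p x) * ExteriorAlgebra.ι ℂ (q x))) := by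
  have hε' : (ε : ℂ) ≠ 0 := Complex.ofReal_ne_zero.2 hε.ne'
  have h1 : ∀ x y, srcHom I (ExteriorAlgebra.ι ℂ (p x)) * liftHom I (aMinus ε x) *
      (srcHom I (ExteriorAlgebra.ι ℂ (q y)) * liftHom I (aPlus ε y)) =
      srcHom I (ExteriorAlgebra.ι ℂ (q y)) * liftHom I (aPlus ε y) *
        (srcHom I (ExteriorAlgebra.ι ℂ (p x)) * liftHom I (aMinus ε x)) -
      (if x = y then (ε : ℂ)⁻¹ else 0) •
        srcHom I (ExteriorAlgebra.ι ℂ (p x) * ExteriorAlgebra.ι ℂ (q y)) := by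
    intro x y
    rw [sourceTerm_mul (aMinus_mem_odd ε x), sourceTerm_mul (aPlus_mem_odd ε y),
      eq_neg_of_add_eq_zero_left (ExteriorAlgebra.ι_add_mul_swap (q y) (p x)),
      eq_sub_of_add_eq (aMinus_aPlus_anticomm hε x y), map_sub, map_neg, neg_mul, neg_neg, mul_sub]
    split_ifs
    · rw [map_smul, map_one, mul_smul_comm, mul_one, neg_sub]
    · rw [map_zero, mul_zero, zero_smul, zero_sub, neg_neg, sub_zero]
  have h2 : ∀ a b : I → SourceOp I, ((ε : ℂ) • ∑ x, a x) * ((ε : ℂ) • ∑ y, b y) =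
      (ε : ℂ) • (ε : ℂ) • ∑ x, ∑ y, a x * b y := by
    intro a b
    rw [smul_mul_assoc, mul_smul_comm, Finset.sum_mul_sum]
  rw [srcPairing, srcPairing, h2, h2]
  simp only [h1, Finset.sum_sub_distrib, ite_smul, zero_smul, Finset.sum_ite_eq, Finset.mem_univ,
    if_true]
  rw [smul_sub, smul_sub, sub_eq_add_neg]
  congr 1
  · rw [Finset.sum_comm]
  · rw [← Finset.smul_sum, smul_inv_smul₀ hε', map_neg, map_smul, map_sum]

/-- The thermal trace of the limiting operator reproduces the generating function, up to the Gaussian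
factor that is produced by the reordering of the source terms. -/
theorem srcTrace_limit {ε β : ℝ} (hε : 0 < ε) {E : Matrix I I ℂ} (hE : E.IsHermitian) {V : Op I}
    (hV : parity I * V = V * parity I) :
    srcTraceLin I (heat ε E (-(β : ℂ)) * (shiftOp ε β E 0 * (heat ε E β *
      liftHom I (NormedSpace.exp (-(β : ℂ) • (quadOp ε E + V)))) * shiftInv ε β E 0)) =
      nilExp (-pairing ε cMinus (matApply (fermi β E) cPlus)) * genFun ε β (quadOp ε E + V) := by
  set ρ := liftHom I (NormedSpace.exp (-(β : ℂ) • (quadOp ε E + V))) with hρ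
  set q : Gr (I ⊕ I) := pairing ε cMinus (matApply (fermi β E) cPlus) with hq
  -- The source terms after conjugation with the free Boltzmann factor.
  set bar : I → I ⊕ I → ℂ := fun y => Sum.elim (fun w => -fermi β (-E) w y) fun _ => 0 with hbar
  set psi : I → I ⊕ I → ℂ := fun y => Sum.elim (fun _ => 0) fun w => -fermi β E y w with hpsi
  have hb : (fun y => ∑ x, NormedSpace.exp (-(-(β : ℂ)) • E) x y • barShift β E x) = bar := by
    funext y s
    rw [Finset.sum_apply]
    rcases s with w | w
    · simp only [hbar, Sum.elim_inl, barShift, Pi.smul_apply, smul_eq_mul, neg_neg,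
        ← fermi_mul_exp hE, Matrix.mul_apply]
      rw [← Finset.sum_neg_distrib]
      exact Finset.sum_congr rfl fun x _ => by ring
    · simp [hbar, barShift]
  have hp : (fun y => ∑ x, NormedSpace.exp (-(β : ℂ) • E) y x • psiShift β E x) = psi := by
    funext y s
    rw [Finset.sum_apply]
    rcases s with w | w
    · simp [hpsi, psiShift]
    · simp only [hpsi, Sum.elim_inr, psiShift, Pi.smul_apply, smul_eq_mul,
        ← exp_mul_fermi_neg hE, Matrix.mul_apply]
      rw [← Finset.sum_neg_distrib]
      exact Finset.sum_congr rfl fun x _ => by ring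
  have hA := heat_mul_nilExp_aMinus hε hE (-(β : ℂ)) (barShift β E)
  have hB := heat_mul_nilExp_aPlus hε hE (-(β : ℂ)) (psiShift β E)
  rw [hb] at hA
  rw [hp] at hB
  have hK : ρ ∈ evenSource I := liftHom_mem (exp_mem_even (Submodule.smul_mem _ _
    (Submodule.add_mem _ (commute_parity_quadOp ε E) (mem_opGrade_zero.2 hV))))
  have hmemM : ∀ p : I → I ⊕ I → ℂ, nilExp (srcPairing ε p (aMinus ε)) ∈ evenSource I := fun p =>
    nilExp_mem _ (sourceTerms_le (srcPairing_mem (aMinus_mem_odd ε) p))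
  have hmemP : ∀ p : I → I ⊕ I → ℂ, nilExp (srcPairing ε p (aPlus ε)) ∈ evenSource I := fun p =>
    nilExp_mem _ (sourceTerms_le (srcPairing_mem (aPlus_mem_odd ε) p))
  have h1 : heat ε E (-(β : ℂ)) * (shiftOp ε β E 0 * (heat ε E β * ρ) * shiftInv ε β E 0) =
      nilExp (srcPairing ε bar (aMinus ε)) * (nilExp (srcPairing ε psi (aPlus ε)) *
        (ρ * nilExp (srcPairing ε (-psiShift β E) (aPlus ε)) *
          nilExp (srcPairing ε (-barShift β E) (aMinus ε)))) := by
    rw [shiftOp, shiftInv, neg_zero, heat_zero, one_mul, mul_one, one_mul, mul_one,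
      srcPairing_neg, srcPairing_neg]
    calc _ = (heat ε E (-(β : ℂ)) * nilExp (srcPairing ε (barShift β E) (aMinus ε))) *
          nilExp (srcPairing ε (psiShift β E) (aPlus ε)) * heat ε E β * (ρ *
          nilExp (srcPairing ε (-psiShift β E) (aPlus ε)) *
          nilExp (srcPairing ε (-barShift β E) (aMinus ε))) := by simp only [mul_assoc]
      _ = nilExp (srcPairing ε bar (aMinus ε)) * (nilExp (srcPairing ε psi (aPlus ε)) *
          (heat ε E (-(β : ℂ)) * heat ε E β)) * (ρ *
          nilExp (srcPairing ε (-psiShift β E) (aPlus ε)) *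
          nilExp (srcPairing ε (-barShift β E) (aMinus ε))) := by
          rw [hA, mul_assoc (nilExp _), hB]
          simp only [mul_assoc]
      _ = _ := by
          rw [heat_neg_mul_heat, mul_one, mul_assoc]
  have hs1 : srcPairing ε (-barShift β E) (aMinus ε) + srcPairing ε (-bar) (aMinus ε) =
      srcPairing ε (fun x => Pi.single (Sum.inl x) 1) (aMinus ε) := by
    rw [srcPairing_add]
    congr 1
    funext y s
    rcases s with w | w
    · simp [hbar, barShift, fermi_neg hE, Matrix.one_apply, Pi.single_apply]
    · simp [hbar, barShift]
  have hs2 : srcPairing ε (-psiShift β E) (aPlus ε) + srcPairing ε (-psi) (aPlus ε) =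
      srcPairing ε (fun x => Pi.single (Sum.inr x) 1) (aPlus ε) := by
    rw [srcPairing_add]
    congr 1
    funext y s
    rcases s with w | w
    · simp [hpsi, psiShift]
    · simp [hpsi, psiShift, fermi_neg hE, Matrix.one_apply, Pi.single_apply, eq_comm]
  have hcM : ∀ p p' : I → I ⊕ I → ℂ, nilExp (srcPairing ε p (aMinus ε)) *
      nilExp (srcPairing ε p' (aMinus ε)) =
      nilExp (srcPairing ε p (aMinus ε) + srcPairing ε p' (aMinus ε)) := fun p p' =>
    (nilExp_add (commute_srcPairing (aMinus_mem_odd ε) (aMinus_mem_odd ε) (aMinus_anticomm ε) p p')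
      (isNilpotent_srcPairing_aMinus ε p) (isNilpotent_srcPairing_aMinus ε p')).symm
  have hcP : ∀ p p' : I → I ⊕ I → ℂ, nilExp (srcPairing ε p (aPlus ε)) *
      nilExp (srcPairing ε p' (aPlus ε)) =
      nilExp (srcPairing ε p (aPlus ε) + srcPairing ε p' (aPlus ε)) := fun p p' =>
    (nilExp_add (commute_srcPairing (aPlus_mem_odd ε) (aPlus_mem_odd ε) (aPlus_anticomm ε) p p')
      (isNilpotent_srcPairing_aPlus ε p) (isNilpotent_srcPairing_aPlus ε p')).symm
  have hcomm : srcPairing ε (fun x => Pi.single (Sum.inl x) 1) (aMinus ε) *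
      srcPairing ε (-psi) (aPlus ε) = srcPairing ε (-psi) (aPlus ε) *
        srcPairing ε (fun x => Pi.single (Sum.inl x) 1) (aMinus ε) + srcHom I (-q) := by
    rw [srcPairing_mul_srcPairing hε, hq, pairing_cMinus_eq]
    congr 6
    funext x
    congr 2
    funext s
    rcases s with w | w <;> simp [hpsi]
  have hqn : IsNilpotent (-q) := (isNilpotent_pairing ε _).neg
  have hqc : ∀ X : SourceOp I, Commute X (srcHom I (-q)) := fun X => by
    rw [map_neg]
    exact (commute_srcHom_pairing ε (fermi β E) X).symm.neg_right
  have hweyl := nilExp_mul_nilExp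
    (isNilpotent_srcPairing_aMinus ε fun x => Pi.single (Sum.inl x) 1)
    (isNilpotent_srcPairing_aPlus ε (-psi)) (hqn.map (srcHom I)) hcomm (hqc _) (hqc _)
  rw [h1, srcTrace_nilExp_mul (srcPairing_mem (aMinus_mem_odd ε) bar)
    (isNilpotent_srcPairing_aMinus ε bar) ((evenSource I).mul_mem (hmemP psi)
      ((evenSource I).mul_mem ((evenSource I).mul_mem hK (hmemP _)) (hmemM _))), mul_assoc,
    srcPairing_neg,
    srcTrace_nilExp_mul (srcPairing_mem (aPlus_mem_odd ε) psi) (isNilpotent_srcPairing_aPlus ε psi)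
      ((evenSource I).mul_mem ((evenSource I).mul_mem ((evenSource I).mul_mem hK (hmemP _))
        (hmemM _)) (hmemM _)), srcPairing_neg]
  have h2 : ρ * nilExp (srcPairing ε (-psiShift β E) (aPlus ε)) *
      nilExp (srcPairing ε (-barShift β E) (aMinus ε)) * nilExp (srcPairing ε (-bar) (aMinus ε)) *
      nilExp (srcPairing ε (-psi) (aPlus ε)) = srcHom I (nilExp (-q)) *
        (ρ * nilExp (srcPairing ε (fun x => Pi.single (Sum.inr x) 1) (aPlus ε)) *
          nilExp (srcPairing ε (fun x => Pi.single (Sum.inl x) 1) (aMinus ε))) := by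
    rw [mul_assoc (ρ * _), hcM, hs1, mul_assoc, hweyl, ← mul_assoc, ← mul_assoc, mul_assoc ρ, hcP,
      hs2, map_nilExp _ hqn, (commute_nilExp_right (hqc _)).eq]
  rw [h2, srcTrace_src_mul]
  rfl

end Reduction

end FermionFI

open FermionFI
theorem theorem2 {I : Type*} [LinearOrder I] [Fintype I]
    (ε β μ : ℝ) (hε : 0 < ε) (hβ : 0 < β)
    (E : Matrix I I ℂ) (hE : E.IsHermitian)
    (H₀ V : Op I)
    (hH₀ : H₀ - (μ : ℂ) • numOp ε = quadOp ε E)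
    (hV : parity I * V = V * parity I) :
    (NormedSpace.exp (-(β : ℂ) • (H₀ - (μ : ℂ) • numOp ε))).trace =
        (1 + NormedSpace.exp (-(β : ℂ) • E)).det ∧
      (∃! v : Finset I → Finset I → ℂ, normalPoly v (aPlus ε) (aMinus ε) = V) ∧
      ∀ v : Finset I → Finset I → ℂ, normalPoly v (aPlus ε) (aMinus ε) = V →
        ∃ L : Gr (I ⊕ I),
          (∀ ℓ : Module.Dual ℂ (Gr (I ⊕ I)),
            Tendsto (fun N : ℕ => ℓ (discreteIntegral ε β E v N)) atTop (𝓝 (ℓ L))) ∧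
          genFun ε β (H₀ + V - (μ : ℂ) • numOp ε) =
            (1 + NormedSpace.exp (-(β : ℂ) • E)).det •
              (grExp (pairing ε cMinus (matApply (fermi β E) cPlus)) * L) := by
  refine ⟨?_, existsUnique_normalPoly hε V, fun v hv => ?_⟩
  · rw [hH₀, trace_exp_quadOp hε hE]
  have hK : H₀ + V - (μ : ℂ) • numOp ε = quadOp ε E + V := by
    rw [← hH₀]
    abel
  set Z₀ := (1 + NormedSpace.exp (-(β : ℂ) • E)).det with hZ₀
  have hZ : Z₀ ≠ 0 := by
    have := isUnit_one_add_exp hE (-β)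
    rw [Complex.ofReal_neg] at this
    exact this.ne_zero
  obtain ⟨m, u, hm, hu, hu1, hexp⟩ := exists_sliceCoeff fun J L h => normalPoly_even hε hV hv h
  set X := shiftOp ε β E 0 * (heat ε E β *
    liftHom I (NormedSpace.exp (-(β : ℂ) • (quadOp ε E + V)))) * shiftInv ε β E 0 with hX
  refine ⟨Z₀⁻¹ • srcTraceLin I (heat ε E (-(β : ℂ)) * X), fun ℓ => ?_, ?_⟩
  · have h1 : ∀ N : ℕ, discreteIntegral ε β E v N = Z₀⁻¹ • srcTraceLin I (heat ε E (-(β : ℂ)) *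
        ((List.finRange N).reverse.map (sliceOp ε β E
          (sliceCoeff u m (v ∅ ∅) ((β / N : ℝ) : ℂ)))).prod) := by
      intro N
      have h2 := srcTrace_prod_wordPoly (N := N) hε hβ hE
        (Sum.elim (etaBar β E N) (eta β E N)) (sliceCoeff u m (v ∅ ∅) ((β / N : ℝ) : ℂ))
      rw [← hexp β N, trace_exp_quadOp hε hE, ← hZ₀] at h2
      rw [eq_inv_smul_iff₀ hZ]
      exact h2.symm
    have h3 : Continuous (ℓ ∘ₗ (Z₀⁻¹ • srcTraceLin I ∘ₗ
        LinearMap.mulLeft ℂ (heat ε E (-(β : ℂ))))) :=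
      IsModuleTopology.continuous_of_linearMap _
    simp only [h1]
    exact (h3.tendsto X).comp (tendsto_prod_sliceOp hε hβ hE hv hm hu hu1)
  · rw [hK, mul_smul_comm, smul_inv_smul₀ hZ, srcTrace_limit hε hE hV, ← mul_assoc,
      grExp_eq_nilExp (algebraMapInv_pairing ε _), nilExp_mul_neg (isNilpotent_pairing ε _),
      one_mul]
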